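/- Let $\mathbb{T}=\mathbb{R}/\mathbb{Z}$ and let $X:\mathbb{T}\to\mathbb{R}^3$ be a closed $C^3$ curve parameterized by arclength $s$, with $|X(s)-X(s')|\ge c_\Gamma\,|s-s'|$ for all $s,s'\in\mathbb{T}$ (where $|s-s'|$ is the distance in $\mathbb{T}$) and some $c_\Gamma>0$; put $\kappa_{\max}=\max_{s}|X''(s)|$. Let $(e_t,e_{n_1},e_{n_2})$, $e_t=X'$, be a $C^2$ orthonormal frame along $X$, periodic in $s$, such that $$e_t'=\kappa_1e_{n_1}+\kappa_2e_{n_2},\qquad e_{n_1}'=-\kappa_1e_t+\kappa_3e_{n_2},\qquad e_{n_2}'=-\kappa_2e_t-\kappa_3e_{n_1},$$ where $\kappa_3$ is a constant with $|\kappa_3|\le\pi$, and put $e_\rho(s,\theta)=\cos\theta\,e_{n_1}(s)+\sin\theta\,e_{n_2}(s)$. Let $0<r_{\max}\le 1/(2\kappa_{\max})$ be such that every point at distance less than $r_{\max}$ from the curve can be written as $X(s)+\rho\,e_\rho(s,\theta)$ with unique $s\in\mathbb{T}$, $\rho\in[0,r_{\max})$ and, if $\rho>0$, unique $\theta\in[0,2\pi)$.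 For $0<\varepsilon<r_{\max}/4$ let $$\Sigma_\varepsilon=\{X(s)+\rho\,e_\rho(s,\theta):\ s\in\mathbb{T},\ 0\le\rho<\varepsilon,\ \theta\in[0,2\pi)\},\qquad \Omega_\varepsilon=\mathbb{R}^3\setminus\overline{\Sigma_\varepsilon},\qquad \Gamma_\varepsilon=\partial\Sigma_\varepsilon,$$ where $\Gamma_\varepsilon$ is parameterized by $(s,\theta)\mapsto X(s)+\varepsilon e_\rho(s,\theta)$ and carries the surface measure $dS=\varepsilon\bigl(1-\varepsilon(\kappa_1\cos\theta+\kappa_2\sin\theta)\bigr)\,d\theta\,ds$. Let $D^{1,2}(\Omega_\varepsilon)$ be the space of all $u\in L^6(\Omega_\varepsilon;\mathbb{R}^3)$ whose weak gradient $\nabla u$ is in $L^2(\Omega_\varepsilon)$. Then every $u\in D^{1,2}(\Omega_\varepsilon)$ has a trace $\mathrm{Tr}(u)\in L^2(\Gamma_\varepsilon)$ (the $L^2(\Gamma_\varepsilon)$-limit of the boundary values of functions in $C_c^\infty(\mathbb{R}^3;\mathbb{R}^3)$ that converge to $u$ in $L^6(\Omega_\varepsilon)$ with gradients converging in $L^2(\Omega_\varepsilon)$),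 and $$\|\mathrm{Tr}(u)\|_{L^2(\Gamma_\varepsilon)}\le C\sqrt{\varepsilon}\,|\log\varepsilon|^{1/2}\,\|\nabla u\|_{L^2(\Omega_\varepsilon)},$$ where the constant $C$ depends only on $c_\Gamma$ and $\kappa_{\max}$; in particular it is independent of $\varepsilon$. -/

import Mathlib

open MeasureTheory Filter Topology Set
open scoped ENNReal ContDiff

noncomputable section

/-- Euclidean three-space. -/
abbrev E3 : Type := EuclideanSpace ℝ (Fin 3)

/-- A closed `C³` curve of length one in space, parameterized by arclength (as a `1`-periodic
function on the line, i.e. a function on `𝕋 = ℝ / ℤ`), together with a `C²` periodic orthonormal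
frame `(e_t, e₁, e₂)`, `e_t = X'`, which satisfies the frame equations with coefficients
`κ₁`, `κ₂` and a constant `κ₃`, `|κ₃| ≤ π`. -/
structure FramedLoop where
  X : ℝ → E3
  X_periodic : Function.Periodic X 1
  X_contDiff : ContDiff ℝ 3 X
  unit_speed : ∀ s, ‖deriv X s‖ = 1
  e₁ : ℝ → E3
  e₂ : ℝ → E3
  e₁_periodic : Function.Periodic e₁ 1
  e₂_periodic : Function.Periodic e₂ 1
  e₁_contDiff : ContDiff ℝ 2 e₁
  e₂_contDiff : ContDiff ℝ 2 e₂
  orthonormal : ∀ s, Orthonormal ℝ ![deriv X s, e₁ s, e₂ s]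
  κ₁ : ℝ → ℝ
  κ₂ : ℝ → ℝ
  κ₃ : ℝ
  abs_κ₃_le : |κ₃| ≤ Real.pi
  hasDerivAt_et : ∀ s, HasDerivAt (deriv X) (κ₁ s • e₁ s + κ₂ s • e₂ s) s
  hasDerivAt_e₁ : ∀ s, HasDerivAt e₁ (-(κ₁ s) • deriv X s + κ₃ • e₂ s) s
  hasDerivAt_e₂ : ∀ s, HasDerivAt e₂ (-(κ₂ s) • deriv X s - κ₃ • e₁ s) s

namespace FramedLoop

variable (L : FramedLoop)

/-- `|X(s) - X(s')| ≥ c |s - s'|`, where `|s - s'|` is the distance in `𝕋 = ℝ / ℤ`. -/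
def ChordArc (c : ℝ) : Prop :=
  ∀ s s' : ℝ, c * ‖((s - s' : ℝ) : AddCircle (1 : ℝ))‖ ≤ ‖L.X s - L.X s'‖

/-- The maximal curvature of the curve. -/
def kappaMax : ℝ := ⨆ s : ℝ, ‖deriv (deriv L.X) s‖

/-- The radial unit vector `e_ρ(s, θ)` in the normal plane at `X(s)`. -/
def eρ (s θ : ℝ) : E3 := Real.cos θ • L.e₁ s + Real.sin θ • L.e₂ s

/-- The point with tubular coordinates `(s, ρ, θ)`. -/
def tube (s ρ θ : ℝ) : E3 := L.X s + ρ • L.eρ s θ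

/-- `r ≤ 1 / (2 κ_max)` is a positive radius such that every point at distance less than `r` from
the curve is `X(s) + ρ e_ρ(s, θ)` for unique `s ∈ 𝕋` and `ρ ∈ [0, r)` and some angle `θ`, which is
unique in `[0, 2π)` if `ρ > 0`. -/
structure IsTubeRadius (r : ℝ) : Prop where
  pos : 0 < r
  le_curv : 2 * L.kappaMax * r ≤ 1
  exists_coord : ∀ x : E3, Metric.infDist x (range L.X) < r →
    ∃ s ∈ Ico (0 : ℝ) 1, ∃ ρ ∈ Ico (0 : ℝ) r, ∃ θ ∈ Ico (0 : ℝ) (2 * Real.pi), x = L.tube s ρ θ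
  unique_coord : ∀ s ∈ Ico (0 : ℝ) 1, ∀ s' ∈ Ico (0 : ℝ) 1,
    ∀ ρ ∈ Ico (0 : ℝ) r, ∀ ρ' ∈ Ico (0 : ℝ) r,
    ∀ θ ∈ Ico (0 : ℝ) (2 * Real.pi), ∀ θ' ∈ Ico (0 : ℝ) (2 * Real.pi),
    L.tube s ρ θ = L.tube s' ρ' θ' → s = s' ∧ ρ = ρ' ∧ (0 < ρ → θ = θ')

/-- The slender body `Σ_ε` of uniform radius `ε`. -/
def body (ε : ℝ) : Set E3 := {x | ∃ s ρ θ : ℝ, 0 ≤ ρ ∧ ρ < ε ∧ x = L.tube s ρ θ}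

/-- The exterior domain `Ω_ε = ℝ³ \ closure Σ_ε`. -/
def ext (ε : ℝ) : Set E3 := (closure (L.body ε))ᶜ

/-- The Jacobian factor of the parameterization `(s, θ) ↦ X(s) + ε e_ρ(s, θ)` of `Γ_ε = ∂Σ_ε`. -/
def jac (ε s θ : ℝ) : ℝ := ε * (1 - ε * (L.κ₁ s * Real.cos θ + L.κ₂ s * Real.sin θ))

/-- The surface measure `dS = J_ε(s, θ) dθ ds` of `Γ_ε = ∂Σ_ε`, as a measure on space. -/
def surf (ε : ℝ) : Measure E3 :=
  Measure.map (fun p : ℝ × ℝ => L.tube p.1 ε p.2)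
    (((volume : Measure (ℝ × ℝ)).restrict (Ico (0 : ℝ) 1 ×ˢ Ico (0 : ℝ) (2 * Real.pi))).withDensity
      fun p => ENNReal.ofReal (L.jac ε p.1 p.2))

end FramedLoop

/-- `G j` is the weak partial derivative `∂_j u` on `Ω`, for each `j`. -/
def IsWeakGrad (Ω : Set E3) (u : E3 → E3) (G : Fin 3 → E3 → E3) : Prop :=
  ∀ φ : E3 → ℝ, ContDiff ℝ ∞ φ → HasCompactSupport φ → tsupport φ ⊆ Ω → ∀ j : Fin 3,
    ∫ x in Ω, (fderiv ℝ φ x (EuclideanSpace.single j 1)) • u x = -∫ x in Ω, φ x • G j x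

/-- `u ∈ D^{1,2}(Ω)`, with weak gradient `∇u = G`: `u ∈ L⁶(Ω)` and `∇u ∈ L²(Ω)`. -/
structure IsD12 (Ω : Set E3) (u : E3 → E3) (G : Fin 3 → E3 → E3) : Prop where
  memLp : MemLp u 6 (volume.restrict Ω)
  weakGrad : IsWeakGrad Ω u G
  memLp_grad : ∀ j, MemLp (G j) 2 (volume.restrict Ω)

/-- The norm `‖∇u‖_{L²(Ω)}` of a gradient `G = ∇u`, i.e. `(∑_j ∫_Ω |∂_j u|²)^{1/2}`. -/
def gradNorm (Ω : Set E3) (G : Fin 3 → E3 → E3) : ℝ≥0∞ :=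
  (∑ j, eLpNorm (G j) 2 (volume.restrict Ω) ^ 2) ^ (1 / 2 : ℝ)

/-- `g` is the trace in `L²(μ)` of `u ∈ D^{1,2}(Ω)` with `∇u = G`, where `μ` is the surface measure
of the boundary of `Ω`: the limit in `L²(μ)` of the boundary values of smooth compactly supported
functions on the whole space that converge to `u` in `D^{1,2}(Ω)`. -/
def IsTrace (Ω : Set E3) (μ : Measure E3) (u : E3 → E3) (G : Fin 3 → E3 → E3) (g : E3 → E3) :
    Prop :=
  MemLp g 2 μ ∧ ∃ φ : ℕ → E3 → E3,
    (∀ n, ContDiff ℝ ∞ (φ n)) ∧ (∀ n, HasCompactSupport (φ n)) ∧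
    Tendsto (fun n => eLpNorm (fun x => φ n x - u x) 6 (volume.restrict Ω)) atTop (𝓝 0) ∧
    (∀ j : Fin 3, Tendsto (fun n => eLpNorm
      (fun x => fderiv ℝ (φ n) x (EuclideanSpace.single j 1) - G j x) 2 (volume.restrict Ω))
      atTop (𝓝 0)) ∧
    Tendsto (fun n => eLpNorm (fun x => φ n x - g x) 2 μ) atTop (𝓝 0)

end

open MeasureTheory Filter Topology Set
open scoped ENNReal ContDiff RealInnerProductSpace Convolution Manifold

noncomputable section

/-! ### The moving frame, curvature bounds, and injectivity of tubes. -/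

namespace FramedLoop

variable (L : FramedLoop)

/-! For smooth compactly supported `φ` the bound combines a radial estimate with a Hardy inequality.
Along a normal ray, Cauchy–Schwarz with the weights `1/t` and `t` gives `|φ(ε)|² ≤ 2|φ(r)|² + 2
log(R/ε) ∫ t |∇φ|² dt`. Since `t dt dθ ds` is comparable to volume in a tube of radius `R`,
averaging over `r ∈ (R/2, R)` leaves only the `L²` mass of `φ` at distance of order `R` from the
curve (`TubeInj.lintegral_tube_sq_le`). The surface measure carries a factor `ε`, which yields `√ε
|log ε|^{1/2}`.

That remaining mass has to be controlled by the gradient on the exterior alone, uniformly in `ε`.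
This is a Hardy inequality with weight `w = 1/(1 + |x - X(0)|²)`, proved first in `L¹` for
nonnegative `f`. On the whole space it follows from the vector field `w (x - X(0))`, whose
divergence is at least `w`. For the exterior, `f` is blended over `ε < ρ < 2ε` with its values along
one parallel curve `s ↦ (s, ρ₀, θ₀)`, so that inside the body the new function depends on `s` only
(`TubeInj.exists_extension`). The errors depend on the chosen curve; averaged over `(ρ₀, θ₀)` in the
annulus they are bounded by the gradient, through an `L¹` Poincaré inequality. Inserting `f = |φ|²`
and absorbing gives the `L²` version (`exists_lintegral_outer_sq_le`).

The constant must not depend on the given tube radius, which could be small. The chord-arc condition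
together with the curvature bound provides an injectivity radius `r₀` of its own, and the estimates
run with `R = max(rmax, r₀)`: then `4ε < R`, while `1/R² ≤ 1/r₀²`.

Traces come from density. The closed tube satisfies a local interior cone condition, so a mollifier
shifted into the cone only samples values in the exterior. A partition of unity and cutoffs at
infinity with gradients bounded in `L³` (paired with `u ∈ L⁶`) complete the approximation. The
smooth bound makes the boundary values Cauchy in `L²`, and it passes to the limit. -/

lemma norm_e₁ (s : ℝ) : ‖L.e₁ s‖ = 1 := (L.orthonormal s).1 1

lemma norm_e₂ (s : ℝ) : ‖L.e₂ s‖ = 1 := (L.orthonormal s).1 2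

lemma inner_et_e₁ (s : ℝ) : ⟪deriv L.X s, L.e₁ s⟫ = 0 :=
  (L.orthonormal s).2 (show (0 : Fin 3) ≠ 1 by decide)

lemma inner_et_e₂ (s : ℝ) : ⟪deriv L.X s, L.e₂ s⟫ = 0 :=
  (L.orthonormal s).2 (show (0 : Fin 3) ≠ 2 by decide)

lemma inner_e₁_e₂ (s : ℝ) : ⟪L.e₁ s, L.e₂ s⟫ = 0 :=
  (L.orthonormal s).2 (show (1 : Fin 3) ≠ 2 by decide)

lemma norm_sq_normal (s a b : ℝ) : ‖a • L.e₁ s + b • L.e₂ s‖ ^ 2 = a ^ 2 + b ^ 2 := by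
  rw [norm_add_sq_real, norm_smul, norm_smul, L.norm_e₁, L.norm_e₂, inner_smul_left,
    inner_smul_right, L.inner_e₁_e₂]
  simp

lemma norm_eρ (s θ : ℝ) : ‖L.eρ s θ‖ = 1 := by
  have := L.norm_sq_normal s (Real.cos θ) (Real.sin θ)
  rw [Real.cos_sq_add_sin_sq] at this
  exact (pow_eq_one_iff_of_nonneg (norm_nonneg _) two_ne_zero).1 this

lemma inner_et_eρ (s θ : ℝ) : ⟪deriv L.X s, L.eρ s θ⟫ = 0 := by
  simp [eρ, inner_add_right, inner_smul_right, L.inner_et_e₁, L.inner_et_e₂]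

lemma deriv_deriv (s : ℝ) : deriv (deriv L.X) s = L.κ₁ s • L.e₁ s + L.κ₂ s • L.e₂ s :=
  (L.hasDerivAt_et s).deriv

lemma differentiable_X : Differentiable ℝ L.X := L.X_contDiff.differentiable (by norm_num)

lemma contDiff_deriv_X : ContDiff ℝ 2 (deriv L.X) :=
  ((contDiff_succ_iff_deriv (n := 2)).1 L.X_contDiff).2.2

lemma differentiable_deriv_X : Differentiable ℝ (deriv L.X) :=
  fun s => (L.hasDerivAt_et s).differentiableAt

lemma contDiff_deriv_deriv_X : ContDiff ℝ 1 (deriv (deriv L.X)) :=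
  ((contDiff_succ_iff_deriv (n := 1)).1 L.contDiff_deriv_X).2.2

lemma deriv_X_periodic : Function.Periodic (deriv L.X) 1 := fun s => by
  rw [← deriv_comp_add_const, L.X_periodic.funext]

lemma deriv_deriv_X_periodic : Function.Periodic (deriv (deriv L.X)) 1 := fun s => by
  rw [← deriv_comp_add_const, L.deriv_X_periodic.funext]

lemma bddAbove_curv : BddAbove (range fun s : ℝ => ‖deriv (deriv L.X) s‖) := by
  have h := L.deriv_deriv_X_periodic.isBounded_of_continuous one_ne_zero
    L.contDiff_deriv_deriv_X.continuous
  obtain ⟨C, hC⟩ := h.exists_norm_le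
  exact ⟨C, by rintro _ ⟨s, rfl⟩; exact hC _ ⟨s, rfl⟩⟩

lemma norm_deriv_deriv_le (s : ℝ) : ‖deriv (deriv L.X) s‖ ≤ L.kappaMax :=
  le_ciSup L.bddAbove_curv s

lemma sq_add_sq_le (s : ℝ) : L.κ₁ s ^ 2 + L.κ₂ s ^ 2 ≤ L.kappaMax ^ 2 := by
  rw [← L.norm_sq_normal, ← L.deriv_deriv]
  gcongr
  exact L.norm_deriv_deriv_le s

lemma norm_deriv_sub_le (s s' : ℝ) : ‖deriv L.X s' - deriv L.X s‖ ≤ L.kappaMax * |s' - s| :=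
  convex_univ.norm_image_sub_le_of_norm_deriv_le (fun x _ => L.differentiable_deriv_X x)
    (fun x _ => L.norm_deriv_deriv_le x) (mem_univ s) (mem_univ s')

lemma kappaMax_nonneg : 0 ≤ L.kappaMax := (norm_nonneg _).trans (L.norm_deriv_deriv_le 0)

lemma norm_X_sub_le (s s' : ℝ) : ‖L.X s' - L.X s‖ ≤ |s' - s| := by
  simpa using convex_univ.norm_image_sub_le_of_norm_deriv_le (C := 1)
    (fun x _ => L.differentiable_X x) (fun x _ => (L.unit_speed x).le) (mem_univ s) (mem_univ s')

/-- Mean value inequality for `t ↦ X(t) - t X'(s)`, whose derivative is at most `κ_max r` within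
distance `r` of `s`. The base point may lie between `a` and `b`; expanding at the midpoint is what
the next lemma uses. -/
lemma norm_taylor_le {s a b r : ℝ} (ha : |a - s| ≤ r) (hb : |b - s| ≤ r) :
    ‖L.X b - L.X a - (b - a) • deriv L.X s‖ ≤ L.kappaMax * r * |b - a| := by
  have key := (convex_closedBall s r).norm_image_sub_le_of_norm_hasDerivWithin_le
    (f := fun t => L.X t - t • deriv L.X s) (f' := fun t => deriv L.X t - deriv L.X s)
    (C := L.kappaMax * r) (x := a) (y := b)
    (fun t _ => (((L.differentiable_X t).hasDerivAt).sub (by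
      simpa using (hasDerivAt_id t).smul_const (deriv L.X s))).hasDerivWithinAt)
    (fun t ht => (L.norm_deriv_sub_le s t).trans
      (mul_le_mul_of_nonneg_left (by simpa [Real.dist_eq] using ht) L.kappaMax_nonneg))
    (by simpa [Real.dist_eq] using ha) (by simpa [Real.dist_eq] using hb)
  have e : L.X b - L.X a - (b - a) • deriv L.X s
      = L.X b - b • deriv L.X s - (L.X a - a • deriv L.X s) := by
    rw [sub_smul]; abel
  rw [e]; simpa [Real.norm_eq_abs] using key

/-- Over one period the displacement is zero, while the expansion at the midpoint predicts a unit
vector with error at most `κ_max / 2`. As a consequence `2 κ_max R ≤ 1` forces `R ≤ 1/4`, which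
makes many later constants absolute. -/
lemma two_le_kappaMax : 2 ≤ L.kappaMax := by
  have h := L.norm_taylor_le (s := 0) (a := -(1 / 2)) (b := 1 / 2) (r := 1 / 2)
    (by norm_num [abs_of_nonneg]) (by norm_num [abs_of_nonneg])
  have hX : L.X (1 / 2) = L.X (-(1 / 2)) := by
    rw [← L.X_periodic (-(1 / 2))]; norm_num
  rw [hX] at h
  norm_num [L.unit_speed] at h
  linarith

/-- Points of tubes of radius less than `R` determine the parameter `s` of their foot point. -/
def TubeInj (R : ℝ) : Prop :=
  ∀ s s' ρ ρ' θ θ' : ℝ, 0 ≤ ρ → ρ < R → 0 ≤ ρ' → ρ' < R →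
    L.tube s ρ θ = L.tube s' ρ' θ' → ∃ k : ℤ, s' = s + k

variable {L}

lemma X_add_int (s : ℝ) (k : ℤ) : L.X (s + k) = L.X s := by
  simpa using (L.X_periodic.int_mul k) s

lemma e₁_add_int (s : ℝ) (k : ℤ) : L.e₁ (s + k) = L.e₁ s := by
  simpa using (L.e₁_periodic.int_mul k) s

lemma e₂_add_int (s : ℝ) (k : ℤ) : L.e₂ (s + k) = L.e₂ s := by
  simpa using (L.e₂_periodic.int_mul k) s

lemma tube_add_int (s ρ θ : ℝ) (k : ℤ) : L.tube (s + k) ρ θ = L.tube s ρ θ := by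
  simp only [tube, eρ, X_add_int, e₁_add_int, e₂_add_int]

lemma tube_add_two_pi (s ρ θ : ℝ) : L.tube s ρ (θ + 2 * Real.pi) = L.tube s ρ θ := by
  simp only [tube, eρ, Real.cos_add_two_pi, Real.sin_add_two_pi]

lemma exists_tube_Ico (s ρ θ : ℝ) :
    ∃ s' ∈ Ico (0 : ℝ) 1, ∃ θ' ∈ Ico (0 : ℝ) (2 * Real.pi), ∃ k : ℤ, s = s' + k ∧
      L.tube s ρ θ = L.tube s' ρ θ' := by
  refine ⟨Int.fract s, ⟨Int.fract_nonneg s, Int.fract_lt_one s⟩,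
    toIcoMod Real.two_pi_pos 0 θ, by simpa using toIcoMod_mem_Ico Real.two_pi_pos 0 θ, ⌊s⌋,
    (Int.fract_add_floor s).symm, ?_⟩
  have h1 : L.tube s ρ θ = L.tube (Int.fract s) ρ θ := by
    rw [← tube_add_int (Int.fract s) ρ θ ⌊s⌋, Int.fract_add_floor]
  have h2 : Function.Periodic (fun θ => L.tube (Int.fract s) ρ θ) (2 * Real.pi) :=
    fun θ => tube_add_two_pi _ _ _
  rw [h1]
  have h3 := h2.sub_zsmul_eq (x := θ) (toIcoDiv Real.two_pi_pos 0 θ)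
  exact h3.symm

lemma IsTubeRadius.tubeInj {r : ℝ} (h : L.IsTubeRadius r) : L.TubeInj r := by
  intro s s' ρ ρ' θ θ' h0 h1 h0' h1' he
  obtain ⟨t, ht, φ, hφ, k, hk, e⟩ := exists_tube_Ico (L := L) s ρ θ
  obtain ⟨t', ht', φ', hφ', k', hk', e'⟩ := exists_tube_Ico (L := L) s' ρ' θ'
  have := (h.unique_coord t ht t' ht' ρ ⟨h0, h1⟩ ρ' ⟨h0', h1'⟩ φ hφ φ' hφ'
    (by rw [← e, ← e', he])).1
  exact ⟨k' - k, by rw [hk, hk', this]; push_cast; ring⟩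

/-- If two tube points coincide, their feet are within `2R`, so the chord-arc condition gives `|t -
s| ≤ 2R/c`. Pairing the difference of the feet with `X'(s)` then gives `|t - s| ≤ κ_max |t - s| (|t
- s| + ρ')`, and the smallness of `κ_max R (1 + 2/c)` leaves only `t = s`. The admissible `R`
depends on `c` and `κ_max` alone. -/
lemma ChordArc.tubeInj {c : ℝ} (hc : 0 < c) (h : L.ChordArc c) {R : ℝ}
    (hR : L.kappaMax * R * (1 + 2 / c) < 1) : L.TubeInj R := by
  intro s s' ρ ρ' θ θ' h0 h1 h0' h1' he
  -- Subtracting the nearest integer turns `|t - s|` into the distance in `𝕋`.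
  refine ⟨round (s' - s), ?_⟩
  set k : ℤ := round (s' - s)
  set t : ℝ := s' - k with ht
  have hs' : s' = t + k := by rw [ht]; ring
  rw [hs', tube_add_int] at he
  have hκ := L.kappaMax_nonneg
  have hd : c * |t - s| ≤ ‖L.X s' - L.X s‖ := by
    have := h s' s
    rw [UnitAddCircle.norm_eq] at this
    rwa [show t - s = s' - s - k by rw [ht]; ring]
  have hX : L.X t - L.X s = ρ • L.eρ s θ - ρ' • L.eρ t θ' := by
    simp only [tube] at he
    rw [sub_eq_sub_iff_add_eq_add, ← he]; abel
  have hXs : L.X s' = L.X t := by rw [hs', X_add_int]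
  have hb : |t - s| ≤ R * (2 / c) := by
    have : ‖L.X t - L.X s‖ ≤ 2 * R := by
      rw [hX]
      refine (norm_sub_le _ _).trans ?_
      rw [norm_smul, norm_smul, norm_eρ, norm_eρ, Real.norm_of_nonneg h0, Real.norm_of_nonneg h0']
      linarith
    rw [hXs] at hd
    rw [← mul_div_assoc, le_div_iff₀ hc]; linarith
  have htay := L.norm_taylor_le (s := s) (a := s) (b := t) (r := |t - s|) (by simp) le_rfl
  -- `X'(s)` annihilates the normal at `s`, and it meets the normal at `t` only through `X'(s) -
  -- X'(t)`, which is small by the curvature bound.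
  have h2 : ⟪deriv L.X s, L.X t - L.X s - (t - s) • deriv L.X s⟫
      = -(ρ' * ⟪deriv L.X s - deriv L.X t, L.eρ t θ'⟫) - (t - s) := by
    rw [inner_sub_right, hX, inner_sub_right, inner_smul_right, inner_smul_right, inner_smul_right,
      inner_et_eρ, real_inner_self_eq_norm_sq, L.unit_speed, inner_sub_left, inner_et_eρ]
    ring
  have h3 := abs_real_inner_le_norm (deriv L.X s) (L.X t - L.X s - (t - s) • deriv L.X s)
  have h4 := abs_real_inner_le_norm (deriv L.X s - deriv L.X t) (L.eρ t θ')
  have h5 := L.norm_deriv_sub_le t s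
  rw [L.unit_speed, h2, one_mul] at h3
  rw [norm_eρ, mul_one] at h4
  have h6 : |t - s| ≤ L.kappaMax * |t - s| * |t - s| + ρ' * (L.kappaMax * |t - s|) := by
    have h7 : |ρ' * ⟪deriv L.X s - deriv L.X t, L.eρ t θ'⟫| ≤ ρ' * (L.kappaMax * |t - s|) := by
      rw [abs_mul, abs_of_nonneg h0', abs_sub_comm t s]
      exact mul_le_mul_of_nonneg_left (h4.trans h5) h0'
    have h8 := h3.trans htay
    rw [abs_le] at h7 h8
    rcases abs_cases (t - s) with ⟨e, -⟩ | ⟨e, -⟩ <;> rw [e] at h7 h8 ⊢ <;> linarith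
  by_contra hne
  have hpos : 0 < |t - s| := abs_pos.2 fun h => hne (by rw [hs']; linarith)
  have h9 : 1 ≤ L.kappaMax * |t - s| + ρ' * L.kappaMax := by
    by_contra hlt
    push Not at hlt
    nlinarith
  have h10 : L.kappaMax * |t - s| ≤ L.kappaMax * (R * (2 / c)) := by gcongr
  have h11 : ρ' * L.kappaMax ≤ R * L.kappaMax := by gcongr
  linarith [show L.kappaMax * R * (1 + 2 / c) = R * L.kappaMax + L.kappaMax * (R * (2 / c)) by ring]

variable (L)

lemma isCompact_range_X : IsCompact (range L.X) :=
  L.X_periodic.compact_of_continuous one_ne_zero L.differentiable_X.continuous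

lemma exists_polar (a b : ℝ) : ∃ ρ θ : ℝ, 0 ≤ ρ ∧ a = ρ * Real.cos θ ∧ b = ρ * Real.sin θ := by
  refine ⟨‖(⟨a, b⟩ : ℂ)‖, Complex.arg ⟨a, b⟩, norm_nonneg _, ?_, ?_⟩
  · rw [Complex.norm_mul_cos_arg]
  · rw [Complex.norm_mul_sin_arg]

/-- The orthonormal frame `(e_t, e₁, e₂)` as a basis of space. -/
def frame (s : ℝ) : OrthonormalBasis (Fin 3) ℝ E3 :=
  OrthonormalBasis.mk (L.orthonormal s)
    ((L.orthonormal s).linearIndependent.span_eq_top_of_card_eq_finrank' (by simp)).ge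

lemma coe_frame (s : ℝ) : ⇑(L.frame s) = ![deriv L.X s, L.e₁ s, L.e₂ s] :=
  OrthonormalBasis.coe_mk _ _

lemma sum_frame (s : ℝ) (v : E3) :
    ⟪deriv L.X s, v⟫ • deriv L.X s + (⟪L.e₁ s, v⟫ • L.e₁ s + ⟪L.e₂ s, v⟫ • L.e₂ s) = v := by
  have hb := (L.frame s).sum_repr' v
  rw [Fin.sum_univ_three, L.coe_frame, add_assoc] at hb
  exact hb

lemma exists_tube_of_inner_eq_zero {s : ℝ} {v : E3} (h : ⟪deriv L.X s, v⟫ = 0) :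
    ∃ θ : ℝ, L.X s + v = L.tube s ‖v‖ θ := by
  have hb := L.sum_frame s v
  rw [h, zero_smul, zero_add] at hb
  obtain ⟨ρ, θ, hρ, e1, e2⟩ := exists_polar ⟪L.e₁ s, v⟫ ⟪L.e₂ s, v⟫
  rw [e1, e2, mul_smul, mul_smul, ← smul_add] at hb
  refine ⟨θ, ?_⟩
  have hv : v = ρ • L.eρ s θ := hb.symm
  have hn : ‖v‖ = ρ := by rw [hv, norm_smul, norm_eρ, mul_one, Real.norm_of_nonneg hρ]
  rw [tube, hn, hv]

/-- A nearest point on the curve is the foot of a normal. -/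
lemma exists_tube_of_infDist_eq {x : E3} {s : ℝ}
    (hs : Metric.infDist x (range L.X) = dist x (L.X s)) :
    ∃ θ : ℝ, x = L.tube s (Metric.infDist x (range L.X)) θ := by
  have horth : ⟪deriv L.X s, x - L.X s⟫ = 0 := by
    have hd : HasDerivAt (fun t => ‖x - L.X t‖ ^ 2) (2 * ⟪x - L.X s, -deriv L.X s⟫) s :=
      (((L.differentiable_X s).hasDerivAt).const_sub x).norm_sq
    have hmin : IsLocalMin (fun t => ‖x - L.X t‖ ^ 2) s := by
      refine Filter.Eventually.of_forall fun t => ?_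
      have : dist x (L.X s) ≤ dist x (L.X t) := hs ▸ Metric.infDist_le_dist_of_mem ⟨t, rfl⟩
      rw [dist_eq_norm, dist_eq_norm] at this
      dsimp only
      gcongr
    have := hmin.hasDerivAt_eq_zero hd
    rw [inner_neg_right, real_inner_comm] at this
    linarith
  obtain ⟨θ, hθ⟩ := L.exists_tube_of_inner_eq_zero horth
  exact ⟨θ, by rw [hs, dist_eq_norm, ← hθ]; abel⟩

lemma exists_infDist_eq (x : E3) : ∃ s : ℝ, Metric.infDist x (range L.X) = dist x (L.X s) := by
  obtain ⟨_, ⟨s, rfl⟩, hs⟩ := L.isCompact_range_X.exists_infDist_eq_dist (range_nonempty _) x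
  exact ⟨s, hs⟩

lemma exists_tube_infDist (x : E3) :
    ∃ s θ : ℝ, x = L.tube s (Metric.infDist x (range L.X)) θ := by
  obtain ⟨s, hs⟩ := L.exists_infDist_eq x
  exact ⟨s, L.exists_tube_of_infDist_eq hs⟩

lemma dist_tube (s ρ θ : ℝ) : dist (L.tube s ρ θ) (L.X s) = |ρ| := by
  rw [dist_eq_norm, tube, add_sub_cancel_left, norm_smul, norm_eρ, mul_one, Real.norm_eq_abs]

lemma infDist_tube_le {s ρ θ : ℝ} (h : 0 ≤ ρ) : Metric.infDist (L.tube s ρ θ) (range L.X) ≤ ρ := by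
  have := L.dist_tube s ρ θ
  rw [abs_of_nonneg h] at this
  exact (Metric.infDist_le_dist_of_mem (mem_range_self s)).trans this.le

variable {L}

/-- A nearest point of the curve provides a second tubular representation, of radius at most `ρ <
R`. Injectivity identifies the two feet, and both radii are the distance to that common foot. -/
lemma TubeInj.infDist_tube {R : ℝ} (hR : L.TubeInj R) {s ρ θ : ℝ} (h : 0 ≤ ρ) (h' : ρ < R) :
    Metric.infDist (L.tube s ρ θ) (range L.X) = ρ := by
  obtain ⟨t, φ, ht⟩ := L.exists_tube_infDist (L.tube s ρ θ)
  obtain ⟨k, hk⟩ := hR _ _ _ _ _ _ h h' Metric.infDist_nonneg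
    ((L.infDist_tube_le h).trans_lt h') ht
  have h1 := L.dist_tube t (Metric.infDist (L.tube s ρ θ) (range L.X)) φ
  rw [← ht, hk, X_add_int, dist_tube, abs_of_nonneg h, abs_of_nonneg Metric.infDist_nonneg] at h1
  exact h1.symm

variable (L)

lemma body_eq {ε : ℝ} : L.body ε = {x | Metric.infDist x (range L.X) < ε} := by
  ext x
  constructor
  · rintro ⟨s, ρ, θ, h0, h1, rfl⟩
    exact (L.infDist_tube_le h0).trans_lt h1
  · intro hx
    obtain ⟨s, θ, h⟩ := L.exists_tube_infDist x
    exact ⟨s, _, θ, Metric.infDist_nonneg, hx, h⟩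

lemma closure_body {ε : ℝ} (hε : 0 < ε) :
    closure (L.body ε) = {x | Metric.infDist x (range L.X) ≤ ε} := by
  have h1 : L.body ε = Metric.thickening ε (range L.X) := by
    rw [body_eq]; ext x
    rw [Metric.mem_thickening_iff_infDist_lt (range_nonempty _)]; rfl
  rw [h1, closure_thickening hε, Metric.cthickening]
  ext x
  simp only [Set.mem_ofPred_eq, Metric.infDist]
  rw [ENNReal.le_ofReal_iff_toReal_le (Metric.infEDist_ne_top (range_nonempty _)) hε.le]

lemma ext_eq {ε : ℝ} (hε : 0 < ε) : L.ext ε = {x | ε < Metric.infDist x (range L.X)} := by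
  rw [ext, L.closure_body hε]; ext x; simp

end FramedLoop

/-! ### Tubular coordinates: Jacobian, descent of functions to space, change of variables. -/

namespace FramedLoop

variable (L : FramedLoop)

lemma κ₁_eq (s : ℝ) : L.κ₁ s = ⟪L.e₁ s, deriv (deriv L.X) s⟫ := by
  rw [L.deriv_deriv, inner_add_right, inner_smul_right, inner_smul_right, L.inner_e₁_e₂,
    real_inner_self_eq_norm_sq, L.norm_e₁]
  ring

lemma κ₂_eq (s : ℝ) : L.κ₂ s = ⟪L.e₂ s, deriv (deriv L.X) s⟫ := by
  rw [L.deriv_deriv, inner_add_right, inner_smul_right, inner_smul_right, real_inner_comm,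
    L.inner_e₁_e₂, real_inner_self_eq_norm_sq, L.norm_e₂]
  ring

lemma continuous_κ₁ : Continuous L.κ₁ := by
  rw [funext L.κ₁_eq]
  exact L.e₁_contDiff.continuous.inner L.contDiff_deriv_deriv_X.continuous

lemma continuous_κ₂ : Continuous L.κ₂ := by
  rw [funext L.κ₂_eq]
  exact L.e₂_contDiff.continuous.inner L.contDiff_deriv_deriv_X.continuous

/-- Cartesian tubular coordinates around the curve. -/
def coord (p : E3) : E3 := L.X (p 0) + (p 1 • L.e₁ (p 0) + p 2 • L.e₂ (p 0))

lemma tube_eq_coord (s ρ θ : ℝ) :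
    L.tube s ρ θ = L.coord !₂[s, ρ * Real.cos θ, ρ * Real.sin θ] := by
  simp [tube, eρ, coord, smul_add, mul_smul]

/-- The Jacobian determinant of `coord`. -/
def coordJac (p : E3) : ℝ := 1 - (L.κ₁ (p 0) * p 1 + L.κ₂ (p 0) * p 2)

/-- The derivative of `coord`. -/
def coordDeriv (p : E3) : E3 →L[ℝ] E3 :=
  (EuclideanSpace.proj 0 : E3 →L[ℝ] ℝ).smulRight (L.coordJac p • deriv L.X (p 0)
      + (-(L.κ₃ * p 2) • L.e₁ (p 0) + (L.κ₃ * p 1) • L.e₂ (p 0)))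
    + (EuclideanSpace.proj 1 : E3 →L[ℝ] ℝ).smulRight (L.e₁ (p 0))
    + (EuclideanSpace.proj 2 : E3 →L[ℝ] ℝ).smulRight (L.e₂ (p 0))

lemma coordDeriv_apply (p v : E3) : L.coordDeriv p v =
    v 0 • (L.coordJac p • deriv L.X (p 0)
      + (-(L.κ₃ * p 2) • L.e₁ (p 0) + (L.κ₃ * p 1) • L.e₂ (p 0)))
    + v 1 • L.e₁ (p 0) + v 2 • L.e₂ (p 0) := rfl

lemma contDiff_apply_E3 (i : Fin 3) {n : WithTop ℕ∞} : ContDiff ℝ n fun p : E3 => p i :=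
  (EuclideanSpace.proj i : E3 →L[ℝ] ℝ).contDiff

lemma contDiff_coord : ContDiff ℝ 2 L.coord := by
  have h0 : ContDiff ℝ 2 fun p : E3 => p 0 := contDiff_apply_E3 0
  exact ((L.X_contDiff.of_le (by norm_num)).comp h0).add
    (((contDiff_apply_E3 1).smul (L.e₁_contDiff.comp h0)).add
      ((contDiff_apply_E3 2).smul (L.e₂_contDiff.comp h0)))

lemma hasFDerivAt_coord (p : E3) : HasFDerivAt L.coord (L.coordDeriv p) p := by
  have hp : ∀ i : Fin 3, HasFDerivAt (fun p : E3 => p i) (EuclideanSpace.proj i : E3 →L[ℝ] ℝ) p :=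
    fun i => (EuclideanSpace.proj i : E3 →L[ℝ] ℝ).hasFDerivAt
  have hX := ((L.differentiable_X (p 0)).hasDerivAt.hasFDerivAt).comp p (hp 0)
  have h1 := (hp 1).smul ((L.hasDerivAt_e₁ (p 0)).hasFDerivAt.comp p (hp 0))
  have h2 := (hp 2).smul ((L.hasDerivAt_e₂ (p 0)).hasFDerivAt.comp p (hp 0))
  refine (hX.add (h1.add h2)).congr_fderiv ?_
  ext1 v
  have hv : ∀ i : Fin 3, (EuclideanSpace.proj i : E3 →L[ℝ] ℝ) v = v i := fun i => rfl
  simp only [add_apply, ContinuousLinearMap.comp_apply,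
    smul_apply, ContinuousLinearMap.smulRight_apply,
    ContinuousLinearMap.toSpanSingleton_apply, coordDeriv_apply, Function.comp_apply,
    hv, coordJac]
  module

/-- With the standard basis in the source and the moving frame in the target the matrix is lower
triangular with diagonal `(J, 1, 1)`; `κ₃` enters only below the diagonal. The change of orthonormal
basis has determinant `±1`, hence the absolute values. -/
lemma abs_det_coordDeriv (p : E3) : |(L.coordDeriv p).det| = |L.coordJac p| := by
  set b := EuclideanSpace.basisFun (Fin 3) ℝ
  have h := basis_toMatrix_mul_linearMap_toMatrix b.toBasis b.toBasis (L.frame (p 0)).toBasis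
    (L.coordDeriv p : E3 →ₗ[ℝ] E3)
  have h1 : |(b.toBasis.toMatrix (L.frame (p 0)).toBasis).det| = 1 := by
    have := b.det_to_matrix_orthonormalBasis (L.frame (p 0))
    rw [Module.Basis.det_apply, Real.norm_eq_abs] at this
    simpa using this
  have h2 : (LinearMap.toMatrix b.toBasis (L.frame (p 0)).toBasis
      (L.coordDeriv p : E3 →ₗ[ℝ] E3)).det = L.coordJac p := by
    have hM : LinearMap.toMatrix b.toBasis (L.frame (p 0)).toBasis (L.coordDeriv p : E3 →ₗ[ℝ] E3)
        = !![L.coordJac p, 0, 0; -(L.κ₃ * p 2), 1, 0; L.κ₃ * p 1, 0, 1] := by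
      ext i j
      have e1 := L.inner_et_e₁ (p 0)
      have e2 := L.inner_et_e₂ (p 0)
      have e3 := L.inner_e₁_e₂ (p 0)
      have e1' := e1; have e2' := e2; have e3' := e3
      rw [real_inner_comm] at e1' e2' e3'
      rw [LinearMap.toMatrix_apply, OrthonormalBasis.coe_toBasis, OrthonormalBasis.coe_toBasis_repr_apply,
        OrthonormalBasis.repr_apply_apply, L.coe_frame]
      fin_cases i <;> fin_cases j <;>
        simp [b, coordDeriv_apply, inner_add_right, inner_smul_right, e1, e2, e3, e1', e2', e3',
          L.norm_e₁, L.norm_e₂, L.unit_speed]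
    rw [hM, Matrix.det_fin_three]; simp
  rw [ContinuousLinearMap.det, ← LinearMap.det_toMatrix b.toBasis, ← h, Matrix.det_mul, abs_mul,
    h1, h2, one_mul]

variable {L}

/-- Cauchy–Schwarz for `(κ₁, κ₂)` and `(p₁, p₂)`. It keeps the Jacobian factor in `[1/2, 3/2]`
throughout the tube. -/
lemma abs_coordJac_sub_le {R : ℝ} (hR : 2 * L.kappaMax * R ≤ 1) {p : E3}
    (hp : p 1 ^ 2 + p 2 ^ 2 < R ^ 2) (h0 : 0 ≤ R) :
    |L.κ₁ (p 0) * p 1 + L.κ₂ (p 0) * p 2| ≤ 1 / 2 := by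
  have h := L.sq_add_sq_le (p 0)
  have hk := L.kappaMax_nonneg
  have h2 : (L.κ₁ (p 0) * p 1 + L.κ₂ (p 0) * p 2) ^ 2 ≤ (L.kappaMax * R) ^ 2 := by
    have : (L.κ₁ (p 0) ^ 2 + L.κ₂ (p 0) ^ 2) * (p 1 ^ 2 + p 2 ^ 2) ≤ L.kappaMax ^ 2 * R ^ 2 := by
      gcongr
    nlinarith [sq_nonneg (L.κ₁ (p 0) * p 2 - L.κ₂ (p 0) * p 1)]
  have := abs_le_of_sq_le_sq h2 (by positivity)
  linarith

lemma half_le_coordJac {R : ℝ} (hR : 2 * L.kappaMax * R ≤ 1) {p : E3}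
    (hp : p 1 ^ 2 + p 2 ^ 2 < R ^ 2) (h0 : 0 ≤ R) : 1 / 2 ≤ L.coordJac p := by
  have := (abs_le.1 (abs_coordJac_sub_le hR hp h0)).2
  rw [coordJac]; linarith

/-- The preimage of `v` under the derivative of `coord` has norm at most a multiple of `‖v‖`. -/
lemma exists_coordDeriv_eq {R : ℝ} (hR : 2 * L.kappaMax * R ≤ 1) {p : E3}
    (hp : p 1 ^ 2 + p 2 ^ 2 < R ^ 2) (h0 : 0 ≤ R) (v : E3) :
    ∃ w : E3, L.coordDeriv p w = v ∧ |w 0| ≤ 2 * ‖v‖ ∧ |w 1| ≤ 3 * ‖v‖ ∧ |w 2| ≤ 3 * ‖v‖ := by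
  have hJ := half_le_coordJac hR hp h0
  have hJ0 : L.coordJac p ≠ 0 := by linarith
  set a := ⟪deriv L.X (p 0), v⟫ / L.coordJac p with ha
  have hv := L.sum_frame (p 0) v
  -- Together with `|κ₃| ≤ π ≤ 4` this bounds the twist terms `κ₃ pᵢ a` by `4 · (1/4) · 2‖v‖`, so
  -- the inverse derivative has an absolute bound.
  have hR4 : R ≤ 1 / 4 := by nlinarith [L.two_le_kappaMax]
  have hk3 : |L.κ₃| ≤ 4 := L.abs_κ₃_le.trans Real.pi_le_four
  have i0 := abs_real_inner_le_norm (deriv L.X (p 0)) v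
  have i1 := abs_real_inner_le_norm (L.e₁ (p 0)) v
  have i2 := abs_real_inner_le_norm (L.e₂ (p 0)) v
  rw [L.unit_speed, one_mul] at i0
  rw [L.norm_e₁, one_mul] at i1
  rw [L.norm_e₂, one_mul] at i2
  have hp1 : |p 1| ≤ 1 / 4 := by
    refine abs_le_of_sq_le_sq' ?_ (by norm_num) |> abs_le.2
    nlinarith [sq_nonneg (p 2)]
  have hp2 : |p 2| ≤ 1 / 4 := by
    refine abs_le_of_sq_le_sq' ?_ (by norm_num) |> abs_le.2
    nlinarith [sq_nonneg (p 1)]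
  have ha2 : |a| ≤ 2 * ‖v‖ := by
    rw [ha, abs_div, div_le_iff₀ (abs_pos.2 hJ0), abs_of_pos (by linarith : 0 < L.coordJac p)]
    nlinarith [norm_nonneg v]
  have hka : ∀ x : ℝ, |x| ≤ 1 / 4 → |L.κ₃ * x * a| ≤ 2 * ‖v‖ := fun x hx => by
    rw [abs_mul, abs_mul]
    calc |L.κ₃| * |x| * |a| ≤ 4 * (1 / 4) * (2 * ‖v‖) := by gcongr
      _ = _ := by ring
  refine ⟨!₂[a, ⟪L.e₁ (p 0), v⟫ + L.κ₃ * p 2 * a, ⟪L.e₂ (p 0), v⟫ - L.κ₃ * p 1 * a],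
    ?_, by simpa using ha2, ?_, ?_⟩
  · rw [coordDeriv_apply]
    simp only [Matrix.cons_val_zero, Matrix.cons_val_one, Matrix.cons_val]
    have : a * L.coordJac p = ⟪deriv L.X (p 0), v⟫ := div_mul_cancel₀ _ hJ0
    conv_rhs => rw [← hv, ← this]
    module
  · simp only [Matrix.cons_val_one]
    exact (abs_add_le _ _).trans (by linarith [hka _ hp2])
  · simp only [Matrix.cons_val]
    exact (abs_sub _ _).trans (by linarith [hka _ hp1])

variable (L)

lemma exists_coord_eq (x : E3) :
    ∃ p : E3, L.coord p = x ∧ p 1 ^ 2 + p 2 ^ 2 = Metric.infDist x (range L.X) ^ 2 := by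
  obtain ⟨s, θ, h⟩ := L.exists_tube_infDist x
  refine ⟨!₂[s, Metric.infDist x (range L.X) * Real.cos θ,
    Metric.infDist x (range L.X) * Real.sin θ], by rw [← tube_eq_coord, ← h], ?_⟩
  simp only [Matrix.cons_val_one, Matrix.cons_val]
  linear_combination Metric.infDist x (range L.X) ^ 2 * Real.cos_sq_add_sin_sq θ

lemma exists_tube_eq_coord (p : E3) :
    ∃ ρ θ : ℝ, 0 ≤ ρ ∧ p 1 ^ 2 + p 2 ^ 2 = ρ ^ 2 ∧ p 1 = ρ * Real.cos θ ∧ p 2 = ρ * Real.sin θ ∧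
      L.coord p = L.tube (p 0) ρ θ := by
  obtain ⟨ρ, θ, h0, h1, h2⟩ := exists_polar (p 1) (p 2)
  refine ⟨ρ, θ, h0, ?_, h1, h2, ?_⟩
  · rw [h1, h2]; linear_combination ρ ^ 2 * Real.cos_sq_add_sin_sq θ
  · rw [coord, tube, eρ, h1, h2, smul_add, mul_smul, mul_smul]

variable {L}

lemma TubeInj.infDist_coord {R : ℝ} (hR : L.TubeInj R) (h0 : 0 ≤ R) {p : E3}
    (hp : p 1 ^ 2 + p 2 ^ 2 < R ^ 2) :
    Metric.infDist (L.coord p) (range L.X) ^ 2 = p 1 ^ 2 + p 2 ^ 2 := by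
  obtain ⟨ρ, θ, h, h1, -, -, h2⟩ := L.exists_tube_eq_coord p
  rw [h2, hR.infDist_tube h (lt_of_pow_lt_pow_left₀ 2 h0 (h1 ▸ hp)), h1]

lemma TubeInj.coord_inj {R : ℝ} (hR : L.TubeInj R) (h0 : 0 ≤ R) {p q : E3}
    (hp : p 1 ^ 2 + p 2 ^ 2 < R ^ 2) (hq : q 1 ^ 2 + q 2 ^ 2 < R ^ 2)
    (h : L.coord p = L.coord q) : (∃ k : ℤ, q 0 = p 0 + k) ∧ q 1 = p 1 ∧ q 2 = p 2 := by
  obtain ⟨ρ, θ, hρ, h1, -, -, h2⟩ := L.exists_tube_eq_coord p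
  obtain ⟨ρ', θ', hρ', h1', -, -, h2'⟩ := L.exists_tube_eq_coord q
  obtain ⟨k, hk⟩ := hR _ _ _ _ _ _ hρ (lt_of_pow_lt_pow_left₀ 2 h0 (h1 ▸ hp)) hρ'
    (lt_of_pow_lt_pow_left₀ 2 h0 (h1' ▸ hq)) (by rw [← h2, ← h2', h])
  refine ⟨⟨k, hk⟩, ?_⟩
  rw [coord, coord, hk, X_add_int, e₁_add_int, e₂_add_int, add_right_inj] at h
  have h3 : (q 1 - p 1) • L.e₁ (p 0) + (q 2 - p 2) • L.e₂ (p 0) = 0 := by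
    rw [sub_smul, sub_smul]
    rw [← sub_eq_zero] at h
    rw [← neg_eq_zero, ← h]; abel
  have h4 := L.norm_sq_normal (p 0) (q 1 - p 1) (q 2 - p 2)
  rw [h3] at h4
  simp only [norm_zero, ne_eq, OfNat.ofNat_ne_zero, not_false_eq_true, zero_pow] at h4
  constructor <;> nlinarith [sq_nonneg (q 1 - p 1), sq_nonneg (q 2 - p 2)]

/-- A periodic function of the coordinates, supported near the axis, descends to a `C¹` function
on space. -/
lemma TubeInj.exists_pushforward {R : ℝ} (hR : L.TubeInj R) (hκ : 2 * L.kappaMax * R ≤ 1)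
    {r : ℝ} (hr0 : 0 ≤ r) (hr : r < R) {G : E3 → ℝ} (hG : ContDiff ℝ 1 G)
    (hper : ∀ p q : E3, (∃ k : ℤ, q 0 = p 0 + k) → q 1 = p 1 → q 2 = p 2 → G q = G p)
    (hsupp : ∀ p : E3, r ^ 2 ≤ p 1 ^ 2 + p 2 ^ 2 → G p = 0) :
    ∃ g : E3 → ℝ, ContDiff ℝ 1 g ∧ (∀ p : E3, p 1 ^ 2 + p 2 ^ 2 < R ^ 2 → g (L.coord p) = G p) ∧
      ∀ x, r ≤ Metric.infDist x (range L.X) → g x = 0 := by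
  have h0 : 0 ≤ R := hr0.trans hr.le
  -- `Q` is an arbitrary, possibly discontinuous, right inverse of `coord`. Injectivity modulo
  -- periods and the periodicity of `G` make `G ∘ Q` independent of the choice within the tube.
  choose Q hQ hQ' using L.exists_coord_eq
  have hg : ∀ p : E3, p 1 ^ 2 + p 2 ^ 2 < R ^ 2 → G (Q (L.coord p)) = G p := fun p hp => by
    obtain ⟨h1, h2, h3⟩ := hR.coord_inj h0 hp (q := Q (L.coord p))
      (by rw [hQ', hR.infDist_coord h0 hp]; exact hp) (hQ _).symm
    exact hper _ _ h1 h2 h3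
  have hz : ∀ x, r ≤ Metric.infDist x (range L.X) → G (Q x) = 0 := fun x hx =>
    hsupp _ (by rw [hQ']; gcongr)
  refine ⟨fun x => G (Q x), contDiff_iff_contDiffAt.2 fun x => ?_, hg, hz⟩
  rcases lt_or_ge (Metric.infDist x (range L.X)) R with hx | hx
  · have hp : (Q x) 1 ^ 2 + (Q x) 2 ^ 2 < R ^ 2 := by
      rw [hQ']; exact pow_lt_pow_left₀ hx Metric.infDist_nonneg two_ne_zero
    have hdet : (L.coordDeriv (Q x)).det ≠ 0 := by
      rw [← abs_pos, abs_det_coordDeriv, abs_pos]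
      linarith [half_le_coordJac hκ hp h0]
    have hd : HasFDerivAt L.coord
        (((L.coordDeriv (Q x)).toContinuousLinearEquivOfDetNeZero hdet : E3 ≃L[ℝ] E3) : E3 →L[ℝ] E3)
        (Q x) := by
      simpa using L.hasFDerivAt_coord (Q x)
    have hc : ContDiffAt ℝ 1 L.coord (Q x) := (L.contDiff_coord.of_le (by norm_num)).contDiffAt
    have hs := hc.hasStrictFDerivAt' hd one_ne_zero
    have hI := hc.to_localInverse hd one_ne_zero
    have hIx := hc.localInverse_apply_image hd one_ne_zero
    have hev := hs.eventually_right_inverse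
    rw [hQ] at hI hIx hev
    have hopen : IsOpen {p : E3 | p 1 ^ 2 + p 2 ^ 2 < R ^ 2} :=
      isOpen_lt (by fun_prop) continuous_const
    have hev2 := hI.continuousAt.eventually_mem (hopen.mem_nhds (by rw [hIx]; exact hp))
    -- Near `x` the function `G ∘ Q` equals `G` composed with the `C¹` local inverse of `coord`, so
    -- the irregularity of `Q` does no harm.
    refine (hG.contDiffAt.comp x hI).congr_of_eventuallyEq ?_
    filter_upwards [hev, hev2] with z hz1 hz2
    have := hg _ hz2
    change L.coord (hc.localInverse hd one_ne_zero z) = z at hz1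
    rw [hz1] at this
    exact this
  · have : (fun x => G (Q x)) =ᶠ[𝓝 x] fun _ => 0 := by
      have ho : IsOpen {x : E3 | r < Metric.infDist x (range L.X)} :=
        isOpen_lt continuous_const (Metric.continuous_infDist_pt _)
      filter_upwards [ho.mem_nhds (hr.trans_le hx)] with z hz1
      exact hz z (le_of_lt hz1)
    exact contDiffAt_const.congr_of_eventuallyEq this

lemma lintegral_E3 {g : E3 → ℝ≥0∞} (hg : Measurable g) :
    ∫⁻ p, g p = ∫⁻ s : ℝ, ∫⁻ z : ℝ × ℝ, g !₂[s, z.1, z.2] := by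
  have h1 := (PiLp.volume_preserving_toLp (Fin 3)).lintegral_comp hg
  have h2 := ((volume_preserving_piFinSuccAbove (fun _ : Fin 3 => ℝ) 0).symm).lintegral_comp
    (hg.comp (PiLp.volume_preserving_toLp (Fin 3)).measurable)
  have h3 : ∀ s : ℝ, ∫⁻ y : Fin 2 → ℝ, g (WithLp.toLp 2 (Fin.cons s y)) =
      ∫⁻ z : ℝ × ℝ, g !₂[s, z.1, z.2] := fun s => by
    refine ((volume_preserving_finTwoArrow ℝ).symm.lintegral_comp ?_).symm
    refine hg.comp ((PiLp.volume_preserving_toLp (Fin 3)).measurable.comp ?_)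
    refine measurable_pi_iff.2 fun i => ?_
    refine Fin.cases (by simp) (fun i => by simpa using measurable_pi_apply i) i
  rw [← h1]
  refine h2.symm.trans ?_
  rw [Measure.volume_eq_prod, lintegral_prod _ (by
    refine Measurable.aemeasurable ?_
    exact (hg.comp (PiLp.volume_preserving_toLp (Fin 3)).measurable).comp
      (MeasurableEquiv.measurable _))]
  refine lintegral_congr fun s => ?_
  rw [← h3]
  refine lintegral_congr fun y => ?_
  simp [MeasurableEquiv.piFinSuccAbove]
  rfl

lemma lintegral_E3_polar {g : E3 → ℝ≥0∞} (hg : Measurable g) :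
    ∫⁻ p, g p = ∫⁻ s : ℝ, ∫⁻ ρ in Ioi (0 : ℝ), ∫⁻ θ in Ioo (-Real.pi) Real.pi,
      ENNReal.ofReal ρ * g !₂[s, ρ * Real.cos θ, ρ * Real.sin θ] := by
  rw [lintegral_E3 hg]
  refine lintegral_congr fun s => ?_
  rw [← lintegral_comp_polarCoord_symm, polarCoord_target, Measure.volume_eq_prod, ← Measure.prod_restrict,
    lintegral_prod _ (by
      refine Measurable.aemeasurable ?_
      simp only [polarCoord_symm_apply, smul_eq_mul]
      refine (by fun_prop : Measurable fun p : ℝ × ℝ => ENNReal.ofReal p.1).mul (hg.comp ?_)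
      exact (by fun_prop : Continuous fun p : ℝ × ℝ =>
        (!₂[s, p.1 * Real.cos p.2, p.1 * Real.sin p.2] : E3)).measurable)]
  rfl

lemma continuous_tube : Continuous fun q : ℝ × ℝ × ℝ => L.tube q.1 q.2.1 q.2.2 := by
  have h0 := L.differentiable_X.continuous
  have h1 := L.e₁_contDiff.continuous
  have h2 := L.e₂_contDiff.continuous
  unfold tube eρ
  fun_prop

lemma measurableSet_infDist_lt (b : ℝ) :
    MeasurableSet {x : E3 | Metric.infDist x (range L.X) < b} :=
  (isOpen_lt (Metric.continuous_infDist_pt _) continuous_const).measurableSet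

/-- Integration in tubular polar coordinates. -/
lemma TubeInj.lintegral_tube {R : ℝ} (hR : L.TubeInj R) (hκ : 2 * L.kappaMax * R ≤ 1)
    {b : ℝ} (hb0 : 0 ≤ b) (hb : b ≤ R) {h : E3 → ℝ≥0∞} (hh : Measurable h) :
    ∫⁻ x in {x | Metric.infDist x (range L.X) < b}, h x =
      ∫⁻ s in Ico (0 : ℝ) 1, ∫⁻ ρ in Ioo 0 b, ∫⁻ θ in Ioo (-Real.pi) Real.pi,
        ENNReal.ofReal (ρ * (1 - ρ * (L.κ₁ s * Real.cos θ + L.κ₂ s * Real.sin θ)))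
          * h (L.tube s ρ θ) := by
  have h0 : 0 ≤ R := hb0.trans hb
  have hbR : ∀ {x : ℝ}, x < b ^ 2 → x < R ^ 2 := fun hx => hx.trans_le (by gcongr)
  -- One period of the axis times a disc: a region that `coord` maps bijectively onto the tube.
  set S : Set E3 := {p | p 0 ∈ Ico (0 : ℝ) 1 ∧ p 1 ^ 2 + p 2 ^ 2 < b ^ 2} with hS
  have hSm : MeasurableSet S :=
    ((contDiff_apply_E3 (n := 0) 0).continuous.measurable measurableSet_Ico).inter
      (isOpen_lt (by fun_prop : Continuous fun p : E3 => p 1 ^ 2 + p 2 ^ 2)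
        (continuous_const (y := b ^ 2))).measurableSet
  have himg : L.coord '' S = {x | Metric.infDist x (range L.X) < b} := by
    ext x
    constructor
    · rintro ⟨p, hp, rfl⟩
      have := hR.infDist_coord h0 (hbR hp.2)
      exact lt_of_pow_lt_pow_left₀ 2 hb0 (this ▸ hp.2)
    · intro hx
      obtain ⟨s, θ, he⟩ := L.exists_tube_infDist x
      obtain ⟨t, ht, φ, -, k, -, e⟩ := exists_tube_Ico (L := L) s (Metric.infDist x (range L.X)) θ
      refine ⟨!₂[t, Metric.infDist x (range L.X) * Real.cos φ,
        Metric.infDist x (range L.X) * Real.sin φ], ⟨by simpa using ht, ?_⟩, ?_⟩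
      · simp only [Matrix.cons_val_one, Matrix.cons_val]
        have : Metric.infDist x (range L.X) ^ 2 < b ^ 2 :=
          pow_lt_pow_left₀ hx Metric.infDist_nonneg two_ne_zero
        linarith [show (Metric.infDist x (range L.X) * Real.cos φ) ^ 2
          + (Metric.infDist x (range L.X) * Real.sin φ) ^ 2 = Metric.infDist x (range L.X) ^ 2 by
          linear_combination Metric.infDist x (range L.X) ^ 2 * Real.cos_sq_add_sin_sq φ]
      · rw [← tube_eq_coord, ← e, ← he]
  have hinj : InjOn L.coord S := by
    intro p hp q hq e
    obtain ⟨⟨k, h1⟩, h2, h3⟩ := hR.coord_inj h0 (hbR hp.2) (hbR hq.2) e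
    have hk : k = 0 := by
      have h4 := hp.1; have h5 := hq.1
      rw [h1] at h5
      have : (-1 : ℝ) < k := by linarith [h4.2, h5.1]
      have : (k : ℝ) < 1 := by linarith [h4.1, h5.2]
      have : -1 < k := by exact_mod_cast ‹(-1 : ℝ) < k›
      have : k < 1 := by exact_mod_cast ‹(k : ℝ) < 1›
      omega
    rw [hk] at h1
    ext i; fin_cases i
    · simpa using h1.symm
    · exact h2.symm
    · exact h3.symm
  rw [← himg, lintegral_image_eq_lintegral_abs_det_fderiv_mul volume hSm
    (fun p _ => (L.hasFDerivAt_coord p).hasFDerivWithinAt) hinj, ← lintegral_indicator hSm]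
  have hJ : Continuous L.coordJac := by
    have h1 := L.continuous_κ₁
    have h2 := L.continuous_κ₂
    unfold coordJac
    fun_prop
  rw [lintegral_E3_polar (Measurable.indicator (by
    simp only [abs_det_coordDeriv]
    exact (hJ.abs.measurable.ennreal_ofReal).mul
      (hh.comp L.contDiff_coord.continuous.measurable)) hSm), ← lintegral_indicator measurableSet_Ico]
  refine lintegral_congr fun s => ?_
  by_cases hs : s ∈ Ico (0 : ℝ) 1
  swap
  · rw [indicator_of_notMem hs]
    have : ∀ z : ℝ × ℝ, (!₂[s, z.1, z.2] : E3) ∉ S := fun z hz => hs (by simpa using hz.1)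
    simp only [indicator_of_notMem (this (_, _)), mul_zero, lintegral_zero]
  have hres : (volume : Measure ℝ).restrict (Ioo 0 b) =
      (volume.restrict (Ioi 0)).restrict (Iio b) := by
    rw [Measure.restrict_restrict measurableSet_Iio, inter_comm, Ioi_inter_Iio]
  rw [indicator_of_mem hs, hres, ← lintegral_indicator measurableSet_Iio]
  refine setLIntegral_congr_fun measurableSet_Ioi fun ρ (hρ : 0 < ρ) => ?_
  have hmem : ∀ θ, (!₂[s, ρ * Real.cos θ, ρ * Real.sin θ] : E3) ∈ S ↔ ρ < b := fun θ => by
    rw [hS, Set.mem_ofPred_eq]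
    simp only [Matrix.cons_val_zero, Matrix.cons_val_one, Matrix.cons_val, hs, true_and]
    rw [show (ρ * Real.cos θ) ^ 2 + (ρ * Real.sin θ) ^ 2 = ρ ^ 2 by
      linear_combination ρ ^ 2 * Real.cos_sq_add_sin_sq θ]
    exact pow_lt_pow_iff_left₀ hρ.le hb0 two_ne_zero
  by_cases hρb : ρ < b
  swap
  · rw [indicator_of_notMem (show ρ ∉ Iio b from hρb)]
    simp only [indicator_of_notMem (fun h => hρb ((hmem _).1 h)), mul_zero, lintegral_zero]
  rw [indicator_of_mem (show ρ ∈ Iio b from hρb)]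
  refine lintegral_congr fun θ => ?_
  have hm := (hmem θ).2 hρb
  rw [indicator_of_mem hm, abs_det_coordDeriv, ← mul_assoc, ← ENNReal.ofReal_mul hρ.le,
    tube_eq_coord, abs_of_pos (by linarith [half_le_coordJac hκ (hbR hm.2) h0])]
  congr 3
  simp [coordJac]
  ring

end FramedLoop

/-! ### Oscillation along a segment, and the radial cutoff. -/

lemma enorm_sub_le_lintegral_deriv {F : Type*} [NormedAddCommGroup F] [NormedSpace ℝ F]
    [CompleteSpace F] {γ γ' : ℝ → F} (h : ∀ t, HasDerivAt γ (γ' t) t) (hc : Continuous γ')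
    {a b x y : ℝ} (hx : x ∈ Icc a b) (hy : y ∈ Icc a b) :
    ‖γ x - γ y‖ₑ ≤ ∫⁻ t in Ioo a b, ‖γ' t‖ₑ := by
  wlog hxy : y ≤ x generalizing x y
  · rw [← enorm_neg, neg_sub]; exact this hy hx (le_of_not_ge hxy)
  rw [← intervalIntegral.integral_eq_sub_of_hasDerivAt (fun t _ => h t) (hc.intervalIntegrable _ _),
    intervalIntegral.integral_of_le hxy]
  refine (enorm_integral_le_lintegral_enorm _).trans ?_
  rw [setLIntegral_congr Ioo_ae_eq_Icc]
  exact lintegral_mono_set (Ioc_subset_Icc_self.trans (Icc_subset_Icc hy.1 hx.2))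

lemma exists_bound_deriv_smoothTransition :
    ∃ M : ℝ, 0 < M ∧ ∀ t, |deriv Real.smoothTransition t| ≤ M := by
  have hc : Continuous (deriv Real.smoothTransition) :=
    (Real.smoothTransition.contDiff (n := 1)).continuous_deriv le_rfl
  obtain ⟨M, hM⟩ := isCompact_Icc.exists_bound_of_continuousOn
    (s := Icc (0 : ℝ) 1) hc.continuousOn
  refine ⟨|M| + 1, by positivity, fun t => ?_⟩
  by_cases ht : t ∈ Icc (0 : ℝ) 1
  · exact (hM t ht).trans ((le_abs_self M).trans (by linarith))
  · have : deriv Real.smoothTransition t = 0 := by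
      rw [mem_Icc, not_and_or, not_le, not_le] at ht
      rcases ht with ht | ht
      · refine IsLocalMin.deriv_eq_zero (Eventually.of_forall fun y => ?_)
        rw [Real.smoothTransition.zero_of_nonpos ht.le]
        exact Real.smoothTransition.nonneg y
      · refine IsLocalMax.deriv_eq_zero (Eventually.of_forall fun y => ?_)
        rw [Real.smoothTransition.one_of_one_le ht.le]
        exact Real.smoothTransition.le_one y
    rw [this, abs_zero]; positivity

/-- The variable `t` stands for the squared radius, so that `η(p₁² + p₂²)` is regular on the axis;
the slope bound `M / ε²` is the natural one in this variable. The vanishing of `η'` is recorded up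
to the endpoints so that the gradient formula of the blended function collapses on both sides of the
transition. -/
lemma exists_radial_cutoff : ∃ M : ℝ, 0 < M ∧ ∀ ε : ℝ, 0 < ε → ∃ η : ℝ → ℝ, ContDiff ℝ 1 η ∧
    (∀ t ≤ ε ^ 2, η t = 1 ∧ deriv η t = 0) ∧ (∀ t, (2 * ε) ^ 2 ≤ t → η t = 0 ∧ deriv η t = 0) ∧
    (∀ t, 0 ≤ η t ∧ η t ≤ 1) ∧ ∀ t, |deriv η t| ≤ M / ε ^ 2 := by
  obtain ⟨M, hM0, hM⟩ := exists_bound_deriv_smoothTransition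
  refine ⟨M, hM0, fun ε hε => ?_⟩
  have hd : ContDiff ℝ 1 fun t : ℝ => 1 - Real.smoothTransition ((t - ε ^ 2) / ε ^ 2) :=
    contDiff_const.sub (Real.smoothTransition.contDiff.comp (by fun_prop))
  have hb : ∀ t : ℝ, 0 ≤ 1 - Real.smoothTransition ((t - ε ^ 2) / ε ^ 2) ∧
      1 - Real.smoothTransition ((t - ε ^ 2) / ε ^ 2) ≤ 1 := fun t =>
    ⟨by linarith [Real.smoothTransition.le_one ((t - ε ^ 2) / ε ^ 2)],
      by linarith [Real.smoothTransition.nonneg ((t - ε ^ 2) / ε ^ 2)]⟩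
  refine ⟨fun t => 1 - Real.smoothTransition ((t - ε ^ 2) / ε ^ 2), hd, fun t ht => ?_,
    fun t ht => ?_, hb, fun t => ?_⟩
  · have h1 : 1 - Real.smoothTransition ((t - ε ^ 2) / ε ^ 2) = 1 := by
      rw [Real.smoothTransition.zero_of_nonpos, sub_zero]
      exact div_nonpos_of_nonpos_of_nonneg (by linarith) (by positivity)
    refine ⟨h1, IsLocalMax.deriv_eq_zero (Eventually.of_forall fun y => ?_)⟩
    dsimp only
    rw [h1]; exact (hb y).2
  · have h1 : 1 - Real.smoothTransition ((t - ε ^ 2) / ε ^ 2) = 0 := by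
      rw [Real.smoothTransition.one_of_one_le, sub_self]
      rw [le_div_iff₀ (by positivity)]; nlinarith [sq_nonneg ε]
    refine ⟨h1, IsLocalMin.deriv_eq_zero (Eventually.of_forall fun y => ?_)⟩
    dsimp only
    rw [h1]; exact (hb y).1
  · have h2 : HasDerivAt (fun t : ℝ => 1 - Real.smoothTransition ((t - ε ^ 2) / ε ^ 2))
        (-(deriv Real.smoothTransition ((t - ε ^ 2) / ε ^ 2) * (1 / ε ^ 2))) t := by
      have h3 : HasDerivAt (fun t : ℝ => (t - ε ^ 2) / ε ^ 2) (1 / ε ^ 2) t :=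
        ((hasDerivAt_id t).sub_const _).div_const _
      have h4 := ((Real.smoothTransition.contDiff (n := 1)).differentiable one_ne_zero
        ((t - ε ^ 2) / ε ^ 2)).hasDerivAt
      exact (h4.comp t h3).const_sub 1
    rw [h2.deriv, abs_neg, abs_mul, abs_of_pos (by positivity : 0 < 1 / ε ^ 2), mul_one_div]
    gcongr
    exact hM _

/-! ### Polar integration around the curve and an `L¹` Poincaré inequality on annuli. -/

namespace FramedLoop

/-- The parameter measure of one period. -/
def period : Measure ℝ := volume.restrict (Ico 0 1)

/-- The parameter measure, in polar coordinates, of a planar annulus. -/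
def annulus (a b : ℝ) : Measure (ℝ × ℝ) :=
  (volume.restrict (Ioo a b)).prod (volume.restrict (Ioo (-Real.pi) Real.pi))

instance : SFinite period := by unfold period; infer_instance
instance (a b : ℝ) : SFinite (annulus a b) := by unfold annulus; infer_instance

variable {L : FramedLoop}

lemma annulus_eq (a b : ℝ) :
    annulus a b = volume.restrict (Ioo a b ×ˢ Ioo (-Real.pi) Real.pi) := by
  rw [annulus, Measure.prod_restrict, Measure.volume_eq_prod]

lemma annulus_univ (a b : ℝ) :
    annulus a b univ = ENNReal.ofReal (b - a) * ENNReal.ofReal (2 * Real.pi) := by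
  rw [annulus, ← univ_prod_univ, Measure.prod_prod, Measure.restrict_apply_univ,
    Measure.restrict_apply_univ, Real.volume_Ioo, Real.volume_Ioo, sub_neg_eq_add, two_mul]

lemma ae_annulus (a b : ℝ) :
    ∀ᵐ z ∂annulus a b, (a < z.1 ∧ z.1 < b) ∧ (-Real.pi < z.2 ∧ z.2 < Real.pi) := by
  rw [annulus_eq]
  filter_upwards [ae_restrict_mem (measurableSet_Ioo.prod measurableSet_Ioo)] with z hz
  exact hz

lemma annulus_restrict {a b c : ℝ} (h : a ≤ c) :
    (annulus a b).restrict {z | c < z.1} = annulus c b := by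
  rw [annulus_eq, annulus_eq, Measure.restrict_restrict
    (isOpen_lt continuous_const continuous_fst).measurableSet]
  congr 1
  ext z
  simp only [mem_inter_iff, mem_prod, mem_Ioo, Set.mem_ofPred_eq]
  constructor
  · rintro ⟨h1, h2, h3⟩; exact ⟨⟨h1, h2.2⟩, h3⟩
  · rintro ⟨h1, h2⟩; exact ⟨h1.1, ⟨h.trans_lt h1.1, h1.2⟩, h2⟩

lemma jac_factor_bound {R : ℝ} (hκ : 2 * L.kappaMax * R ≤ 1) {s ρ θ : ℝ} (h0 : 0 ≤ ρ)
    (hρ : ρ < R) : |ρ * (L.κ₁ s * Real.cos θ + L.κ₂ s * Real.sin θ)| ≤ 1 / 2 := by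
  have := abs_coordJac_sub_le (L := L) hκ (p := !₂[s, ρ * Real.cos θ, ρ * Real.sin θ]) (by
    simp only [Matrix.cons_val_one, Matrix.cons_val]
    rw [show (ρ * Real.cos θ) ^ 2 + (ρ * Real.sin θ) ^ 2 = ρ ^ 2 by
      linear_combination ρ ^ 2 * Real.cos_sq_add_sin_sq θ]
    exact pow_lt_pow_left₀ hρ h0 two_ne_zero) (h0.trans hρ.le)
  simp only [Matrix.cons_val_zero, Matrix.cons_val_one, Matrix.cons_val] at this
  rwa [show ρ * (L.κ₁ s * Real.cos θ + L.κ₂ s * Real.sin θ)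
    = L.κ₁ s * (ρ * Real.cos θ) + L.κ₂ s * (ρ * Real.sin θ) by ring]

lemma measurable_polar_integrand {h : E3 → ℝ≥0∞} (hh : Measurable h) (s : ℝ) :
    Measurable fun z : ℝ × ℝ => ENNReal.ofReal z.1 * h (L.tube s z.1 z.2) :=
  (by fun_prop : Measurable fun z : ℝ × ℝ => ENNReal.ofReal z.1).mul
    (hh.comp (continuous_tube.comp (by fun_prop : Continuous fun z : ℝ × ℝ => (s, z.1, z.2))).measurable)

lemma lintegral_annulus {g : ℝ × ℝ → ℝ≥0∞} (hg : Measurable g) (a b : ℝ) :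
    ∫⁻ z, g z ∂annulus a b = ∫⁻ ρ in Ioo a b, ∫⁻ θ in Ioo (-Real.pi) Real.pi, g (ρ, θ) := by
  rw [annulus, lintegral_prod _ hg.aemeasurable]

/-- The Jacobian factor lies in `[1/2, 3/2]`, so volume and `ρ dρ dθ ds` agree up to a factor `2`;
this and the following lemma are the two directions. The measure `annulus` itself is `dρ dθ`, so the
weight `ρ` is written out. -/
lemma TubeInj.lintegral_le_polar {R : ℝ} (hR : L.TubeInj R) (hκ : 2 * L.kappaMax * R ≤ 1)
    {b : ℝ} (hb0 : 0 ≤ b) (hb : b ≤ R) {h : E3 → ℝ≥0∞} (hh : Measurable h) :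
    ∫⁻ x in {x | Metric.infDist x (range L.X) < b}, h x ≤
      2 * ∫⁻ s, ∫⁻ z, ENNReal.ofReal z.1 * h (L.tube s z.1 z.2) ∂annulus 0 b ∂period := by
  rw [hR.lintegral_tube hκ hb0 hb hh, period, ← lintegral_const_mul' _ _ (by norm_num)]
  refine lintegral_mono fun s => ?_
  rw [lintegral_annulus (measurable_polar_integrand hh s), ← lintegral_const_mul' _ _ (by norm_num)]
  refine setLIntegral_mono' measurableSet_Ioo fun ρ hρ => ?_
  rw [← lintegral_const_mul' _ _ (by norm_num)]
  refine lintegral_mono fun θ => ?_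
  dsimp only
  rw [← mul_assoc, show (2 : ℝ≥0∞) = ENNReal.ofReal 2 by norm_num,
    ← ENNReal.ofReal_mul zero_le_two]
  refine mul_le_mul' (ENNReal.ofReal_le_ofReal ?_) le_rfl
  have := abs_le.1 (jac_factor_bound (L := L) hκ (s := s) (θ := θ) hρ.1.le (hρ.2.trans_le hb))
  nlinarith [hρ.1]

lemma TubeInj.polar_le_lintegral {R : ℝ} (hR : L.TubeInj R) (hκ : 2 * L.kappaMax * R ≤ 1)
    {a b : ℝ} (ha : 0 ≤ a) (hb0 : 0 ≤ b) (hb : b ≤ R) {h : E3 → ℝ≥0∞} (hh : Measurable h) :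
    ∫⁻ s, ∫⁻ z, ENNReal.ofReal z.1 * h (L.tube s z.1 z.2) ∂annulus a b ∂period ≤
      2 * ∫⁻ x in {x | a < Metric.infDist x (range L.X) ∧ Metric.infDist x (range L.X) < b},
        h x := by
  set S : Set E3 := {x | a < Metric.infDist x (range L.X)} with hS
  have hSm : MeasurableSet S :=
    (isOpen_lt continuous_const (Metric.continuous_infDist_pt _)).measurableSet
  have e : ∫⁻ x in {x | a < Metric.infDist x (range L.X) ∧ Metric.infDist x (range L.X) < b}, h x
      = ∫⁻ x in {x | Metric.infDist x (range L.X) < b}, S.indicator h x := by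
    rw [lintegral_indicator hSm, Measure.restrict_restrict hSm]; rfl
  rw [e, hR.lintegral_tube hκ hb0 hb (hh.indicator hSm), period,
    ← lintegral_const_mul' _ _ (by norm_num)]
  refine lintegral_mono fun s => ?_
  rw [← annulus_restrict ha, ← lintegral_indicator
    (isOpen_lt continuous_const continuous_fst).measurableSet, lintegral_annulus
    ((measurable_polar_integrand hh s).indicator
      (isOpen_lt continuous_const continuous_fst).measurableSet),
    ← lintegral_const_mul' _ _ (by norm_num)]
  refine setLIntegral_mono' measurableSet_Ioo fun ρ hρ => ?_
  rw [← lintegral_const_mul' _ _ (by norm_num)]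
  refine lintegral_mono fun θ => ?_
  dsimp only
  by_cases hρa : a < ρ
  swap
  · rw [indicator_of_notMem (by simpa using hρa)]; exact zero_le
  have hmem : L.tube s ρ θ ∈ S := by
    rw [hS, Set.mem_ofPred_eq, hR.infDist_tube hρ.1.le (hρ.2.trans_le hb)]
    exact hρa
  rw [indicator_of_mem (by simpa using hρa), indicator_of_mem hmem, ← mul_assoc,
    show (2 : ℝ≥0∞) = ENNReal.ofReal 2 by norm_num, ← ENNReal.ofReal_mul zero_le_two]
  refine mul_le_mul' (ENNReal.ofReal_le_ofReal ?_) le_rfl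
  have := abs_le.1 (jac_factor_bound (L := L) hκ (s := s) (θ := θ) hρ.1.le (hρ.2.trans_le hb))
  nlinarith [hρ.1]

variable (L)

lemma hasDerivAt_tube_radius (s ρ θ : ℝ) :
    HasDerivAt (fun ρ => L.tube s ρ θ) (L.eρ s θ) ρ := by
  simpa [tube] using ((hasDerivAt_id ρ).smul_const (L.eρ s θ)).const_add (L.X s)

/-- The angular unit vector. -/
def eθ (s θ : ℝ) : E3 := -Real.sin θ • L.e₁ s + Real.cos θ • L.e₂ s

lemma norm_eθ (s θ : ℝ) : ‖L.eθ s θ‖ = 1 := by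
  have := L.norm_sq_normal s (-Real.sin θ) (Real.cos θ)
  rw [neg_sq, Real.sin_sq_add_cos_sq] at this
  exact (pow_eq_one_iff_of_nonneg (norm_nonneg _) two_ne_zero).1 this

lemma hasDerivAt_tube_angle (s ρ θ : ℝ) :
    HasDerivAt (fun θ => L.tube s ρ θ) (ρ • L.eθ s θ) θ :=
  ((((Real.hasDerivAt_cos θ).smul_const (L.e₁ s)).add
    ((Real.hasDerivAt_sin θ).smul_const (L.e₂ s))).const_smul ρ).const_add (L.X s)

lemma continuous_eθ (s : ℝ) : Continuous fun θ => L.eθ s θ := by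
  unfold eθ; fun_prop

variable {L}

lemma enorm_sub_le_radial {F : Type*} [NormedAddCommGroup F] [NormedSpace ℝ F]
    [CompleteSpace F] {f : E3 → F} (hf : ContDiff ℝ 1 f) (s θ : ℝ) {a b x y : ℝ}
    (hx : x ∈ Icc a b) (hy : y ∈ Icc a b) :
    ‖f (L.tube s x θ) - f (L.tube s y θ)‖ₑ ≤ ∫⁻ t in Ioo a b, ‖fderiv ℝ f (L.tube s t θ)‖ₑ := by
  have hc : Continuous fun t => fderiv ℝ f (L.tube s t θ) (L.eρ s θ) :=
    ((hf.continuous_fderiv one_ne_zero).comp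
      (continuous_tube.comp (by fun_prop : Continuous fun t : ℝ => (s, t, θ)))).clm_apply
      continuous_const
  refine (enorm_sub_le_lintegral_deriv (fun t => ((hf.differentiable one_ne_zero
    (L.tube s t θ)).hasFDerivAt.comp_hasDerivAt t (L.hasDerivAt_tube_radius s t θ))) hc hx hy).trans ?_
  refine lintegral_mono fun t => ?_
  refine (ContinuousLinearMap.le_opENorm _ _).trans ?_
  rw [← ofReal_norm (L.eρ s θ), L.norm_eρ]; simp

lemma enorm_sub_le_angular {F : Type*} [NormedAddCommGroup F] [NormedSpace ℝ F]
    [CompleteSpace F] {f : E3 → F} (hf : ContDiff ℝ 1 f) (s : ℝ) {ρ : ℝ} (hρ : 0 ≤ ρ) {a b x y : ℝ}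
    (hx : x ∈ Icc a b) (hy : y ∈ Icc a b) :
    ‖f (L.tube s ρ x) - f (L.tube s ρ y)‖ₑ ≤
      ∫⁻ t in Ioo a b, ENNReal.ofReal ρ * ‖fderiv ℝ f (L.tube s ρ t)‖ₑ := by
  have hc : Continuous fun t => fderiv ℝ f (L.tube s ρ t) (ρ • L.eθ s t) :=
    ((hf.continuous_fderiv one_ne_zero).comp
      (continuous_tube.comp (by fun_prop : Continuous fun t : ℝ => (s, ρ, t)))).clm_apply
      ((L.continuous_eθ s).const_smul ρ)
  refine (enorm_sub_le_lintegral_deriv (fun t => ((hf.differentiable one_ne_zero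
    (L.tube s ρ t)).hasFDerivAt.comp_hasDerivAt t (L.hasDerivAt_tube_angle s ρ t))) hc hx hy).trans ?_
  refine lintegral_mono fun t => ?_
  refine (ContinuousLinearMap.le_opENorm _ _).trans ?_
  rw [← ofReal_norm (ρ • L.eθ s t), norm_smul, L.norm_eθ, mul_one, Real.norm_of_nonneg hρ, mul_comm]

/-- A Poincaré inequality on a planar annulus, in `L¹` and in integrated form. -/
lemma lintegral_annulus_sub_le {f : E3 → ℝ} (hf : ContDiff ℝ 1 f) (s : ℝ) {ε : ℝ} (hε : 0 < ε) :
    ∫⁻ z₀, ∫⁻ z, ‖f (L.tube s z₀.1 z₀.2) - f (L.tube s z.1 z.2)‖ₑ ∂annulus ε (2 * ε)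
        ∂annulus ε (2 * ε) ≤
      ENNReal.ofReal (100 * ε) *
        ∫⁻ z, ENNReal.ofReal z.1 * ‖fderiv ℝ f (L.tube s z.1 z.2)‖ₑ ∂annulus ε (2 * ε) := by
  set N : ℝ × ℝ → ℝ≥0∞ := fun z => ‖fderiv ℝ f (L.tube s z.1 z.2)‖ₑ with hN
  have hNm : Measurable N := ((hf.continuous_fderiv one_ne_zero).comp
      (continuous_tube.comp (by fun_prop : Continuous fun z : ℝ × ℝ => (s, z.1, z.2)))).measurable.enorm
  set P : ℝ → ℝ≥0∞ := fun r => ∫⁻ τ in Ioo (-Real.pi) Real.pi, ENNReal.ofReal r * N (r, τ) with hP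
  set Q : ℝ → ℝ≥0∞ := fun θ => ∫⁻ r in Ioo ε (2 * ε), N (r, θ) with hQ
  have hm : Measurable fun z : ℝ × ℝ => ENNReal.ofReal z.1 * N z := by fun_prop
  have hPm : Measurable P := hm.lintegral_prod_right'
  have hQm : Measurable Q := hNm.lintegral_prod_left'
  set I := ∫⁻ z, ENNReal.ofReal z.1 * N z ∂annulus ε (2 * ε) with hI
  have hIP : ∫⁻ z₀, P z₀.1 ∂annulus ε (2 * ε) = ENNReal.ofReal (2 * Real.pi) * I := by
    rw [hI, lintegral_annulus hm, lintegral_annulus (show Measurable fun z : ℝ × ℝ => P z.1 from hPm.comp measurable_fst),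
      ← lintegral_const_mul' _ _ ENNReal.ofReal_ne_top]
    refine lintegral_congr fun r => ?_
    dsimp only
    rw [lintegral_const, Measure.restrict_apply_univ, Real.volume_Ioo, sub_neg_eq_add, ← two_mul,
      mul_comm]
  -- Integrating over the unused radius gives the length `2ε - ε = ε`, which is at most `r` on the
  -- annulus and supplies the weight missing in `Q`.
  have hIQ : ∫⁻ z, Q z.2 ∂annulus ε (2 * ε) ≤ I := by
    rw [lintegral_annulus (show Measurable fun z : ℝ × ℝ => Q z.2 from hQm.comp measurable_snd)]
    dsimp only
    rw [lintegral_const, Measure.restrict_apply_univ,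
      Real.volume_Ioo, hI, lintegral_annulus hm]
    simp only [hQ]
    rw [lintegral_lintegral_swap (f := fun θ r => N (r, θ))
        (hNm.comp measurable_swap).aemeasurable, mul_comm,
      ← lintegral_const_mul' _ _ ENNReal.ofReal_ne_top]
    refine setLIntegral_mono' measurableSet_Ioo fun r hr => ?_
    rw [← lintegral_const_mul' _ _ ENNReal.ofReal_ne_top]
    refine lintegral_mono fun θ => ?_
    dsimp only
    gcongr
    linarith [hr.1]
  have hmass : annulus ε (2 * ε) univ = ENNReal.ofReal ε * ENNReal.ofReal (2 * Real.pi) := by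
    rw [annulus_univ]; ring_nf
  -- The two points are joined by rotating at radius `z₀.1` and then moving radially at angle `z.2`.
  -- One bound then involves only `z₀`, the other only `z`, and the double integral splits.
  calc _ ≤ ∫⁻ z₀, ∫⁻ z, (P z₀.1 + Q z.2) ∂annulus ε (2 * ε) ∂annulus ε (2 * ε) := by
        refine lintegral_mono_ae ?_
        filter_upwards [ae_annulus ε (2 * ε)] with z₀ hz₀
        refine lintegral_mono_ae ?_
        filter_upwards [ae_annulus ε (2 * ε)] with z hz
        calc _ = ‖(f (L.tube s z₀.1 z₀.2) - f (L.tube s z₀.1 z.2))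
              + (f (L.tube s z₀.1 z.2) - f (L.tube s z.1 z.2))‖ₑ := by rw [sub_add_sub_cancel]
          _ ≤ _ := enorm_add_le _ _
          _ ≤ _ := add_le_add
            (enorm_sub_le_angular hf s (by linarith [hz₀.1.1]) ⟨hz₀.2.1.le, hz₀.2.2.le⟩
              ⟨hz.2.1.le, hz.2.2.le⟩)
            (enorm_sub_le_radial hf s z.2 ⟨hz₀.1.1.le, hz₀.1.2.le⟩ ⟨hz.1.1.le, hz.1.2.le⟩)
    _ = annulus ε (2 * ε) univ * (ENNReal.ofReal (2 * Real.pi) * I)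
        + annulus ε (2 * ε) univ * ∫⁻ z, Q z.2 ∂annulus ε (2 * ε) := by
        simp_rw [lintegral_add_left measurable_const, lintegral_const]
        rw [lintegral_add_right _ measurable_const, lintegral_mul_const _ (show Measurable fun z : ℝ × ℝ => P z.1 from hPm.comp measurable_fst),
          lintegral_const, hIP]
        ring
    _ ≤ annulus ε (2 * ε) univ * (ENNReal.ofReal (2 * Real.pi) * I)
        + annulus ε (2 * ε) univ * I := by gcongr
    _ = ENNReal.ofReal (ε * (2 * Real.pi) * (2 * Real.pi + 1)) * I := by
        rw [hmass, ENNReal.ofReal_mul (p := ε * (2 * Real.pi)) (by positivity),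
          ENNReal.ofReal_mul (p := ε) hε.le,
          ENNReal.ofReal_add (p := 2 * Real.pi) (by positivity) zero_le_one, ENNReal.ofReal_one]
        ring
    _ ≤ _ := by
        refine mul_le_mul' (ENNReal.ofReal_le_ofReal ?_) le_rfl
        have : 2 * Real.pi * (2 * Real.pi + 1) ≤ 100 := by
          nlinarith [Real.pi_le_four, Real.pi_pos]
        nlinarith

end FramedLoop

/-! ### The regularized Hardy inequality on the whole space, in `L¹`. -/

lemma E3_eq_sum (v : E3) : v = ∑ j, v j • EuclideanSpace.single j (1 : ℝ) := by
  ext i; simp [Finset.sum_apply, Pi.single_apply]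

/-- The weight `1 / (1 + |x - a|²)`. -/
def weight (a x : E3) : ℝ := (1 + ‖x - a‖ ^ 2)⁻¹

lemma weight_pos (a x : E3) : 0 < weight a x := by unfold weight; positivity

lemma weight_le_one (a x : E3) : weight a x ≤ 1 :=
  inv_le_one_of_one_le₀ (by linarith [sq_nonneg ‖x - a‖])

lemma weight_mul (a x : E3) : weight a x * (1 + ‖x - a‖ ^ 2) = 1 :=
  inv_mul_cancel₀ (by positivity)

lemma hasFDerivAt_weight (a x : E3) :
    HasFDerivAt (weight a) (-(2 * weight a x ^ 2) • innerSL ℝ (x - a)) x := by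
  have h1 : HasFDerivAt (fun x => ‖x - a‖ ^ 2) (2 • innerSL ℝ (x - a)) x := by
    simpa using ((hasFDerivAt_id x).sub_const a).norm_sq
  have h2 := (hasDerivAt_inv (show (1 + ‖x - a‖ ^ 2) ≠ 0 by positivity)).comp_hasFDerivAt x
    (h1.const_add 1)
  refine h2.congr_fderiv ?_
  ext v
  simp [weight]
  ring

lemma contDiff_weight (a : E3) : ContDiff ℝ 1 (weight a) := by
  unfold weight
  exact (contDiff_const.add ((contDiff_id.sub contDiff_const).norm_sq ℝ)).inv
    fun x => by positivity

/-- A Hardy inequality in `L¹`. -/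
lemma lintegral_weight_mul_le {F : E3 → ℝ} (hF : ContDiff ℝ 1 F) (hc : HasCompactSupport F)
    (h0 : ∀ x, 0 ≤ F x) (a : E3) :
    ∫⁻ x, ENNReal.ofReal (F x * weight a x) ≤
      ∫⁻ x, ‖fderiv ℝ F x‖ₑ * ‖weight a x • (x - a)‖ₑ := by
  -- The field `w (x - a)` has divergence `3w - 2w · w|x - a|²`, which is at least `w` because `w|x
  -- - a|² ≤ 1`. Integrating it by parts against `F` is the whole proof; the `1` in the denominator
  -- of `w` makes the field `C¹` at `a`.
  set V : Fin 3 → E3 → ℝ := fun j x => weight a x * (x j - a j) with hV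
  have hVc : ∀ j, ContDiff ℝ 1 (V j) := fun j =>
    (contDiff_weight a).mul ((FramedLoop.contDiff_apply_E3 j).sub contDiff_const)
  have hVd : ∀ j x, fderiv ℝ (V j) x (EuclideanSpace.single j 1) =
      weight a x - 2 * weight a x ^ 2 * (x j - a j) ^ 2 := fun j x => by
    have h1 : HasFDerivAt (fun x : E3 => x j - a j) (EuclideanSpace.proj j : E3 →L[ℝ] ℝ) x :=
      (EuclideanSpace.proj j : E3 →L[ℝ] ℝ).hasFDerivAt.sub_const _
    have h2 : fderiv ℝ (V j) x = _ := ((hasFDerivAt_weight a x).mul h1).fderiv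
    rw [h2]
    simp [EuclideanSpace.inner_single_right]
    ring
  have hdF : Continuous (fderiv ℝ F) := hF.continuous_fderiv one_ne_zero
  have hcFv : ∀ v, HasCompactSupport fun x => fderiv ℝ F x v := fun v => hc.fderiv_apply ℝ v
  have i1 : ∀ j, Integrable fun x => fderiv ℝ F x (EuclideanSpace.single j 1) * V j x := fun j =>
    ((hdF.clm_apply continuous_const).mul (hVc j).continuous).integrable_of_hasCompactSupport
      (hcFv _).mul_right
  have i2 : ∀ j, Integrable fun x => F x * fderiv ℝ (V j) x (EuclideanSpace.single j 1) := fun j =>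
    (hF.continuous.mul (((hVc j).continuous_fderiv one_ne_zero).clm_apply
      continuous_const)).integrable_of_hasCompactSupport hc.mul_right
  have i3 : ∀ j, Integrable fun x => F x * V j x := fun j =>
    (hF.continuous.mul (hVc j).continuous).integrable_of_hasCompactSupport hc.mul_right
  have i4 : Integrable fun x => F x * weight a x :=
    (hF.continuous.mul (contDiff_weight a).continuous).integrable_of_hasCompactSupport hc.mul_right
  have ibp : ∀ j, ∫ x, F x * fderiv ℝ (V j) x (EuclideanSpace.single j 1) =
      -∫ x, fderiv ℝ F x (EuclideanSpace.single j 1) * V j x := fun j =>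
    integral_mul_fderiv_eq_neg_fderiv_mul_of_integrable (i1 j) (i2 j) (i3 j)
      (fun x _ => hF.differentiable one_ne_zero x) (fun x _ => (hVc j).differentiable one_ne_zero x)
  have hdir : ∀ x, ∑ j, fderiv ℝ F x (EuclideanSpace.single j 1) * V j x =
      fderiv ℝ F x (weight a x • (x - a)) := fun x => by
    conv_rhs => rw [E3_eq_sum (weight a x • (x - a)), map_sum]
    refine Finset.sum_congr rfl fun j _ => ?_
    rw [map_smul, smul_eq_mul, mul_comm]; rfl
  have key : ∫ x, F x * weight a x ≤ -∫ x, fderiv ℝ F x (weight a x • (x - a)) := by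
    calc ∫ x, F x * weight a x ≤
        ∫ x, ∑ j, F x * fderiv ℝ (V j) x (EuclideanSpace.single j 1) := by
          refine integral_mono i4 (integrable_finsetSum _ fun j _ => i2 j) fun x => ?_
          have hn : ‖x - a‖ ^ 2 = ∑ j, (x j - a j) ^ 2 := by
            rw [EuclideanSpace.norm_sq_eq]; simp
          have hs : ∑ j, fderiv ℝ (V j) x (EuclideanSpace.single j 1) =
              3 * weight a x - 2 * weight a x * (weight a x * ‖x - a‖ ^ 2) := by
            simp only [hVd, Finset.sum_sub_distrib, ← Finset.mul_sum, ← hn]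
            simp; ring
          dsimp only
          rw [← Finset.mul_sum, hs]
          refine mul_le_mul_of_nonneg_left ?_ (h0 x)
          nlinarith [weight_mul a x, weight_pos a x]
      _ = -∫ x, fderiv ℝ F x (weight a x • (x - a)) := by
          rw [integral_finsetSum _ fun j _ => i2 j]
          simp only [ibp, ← hdir]
          rw [integral_finsetSum _ fun j _ => i1 j, Finset.sum_neg_distrib]
  rw [← ofReal_integral_eq_lintegral_ofReal i4
    (Eventually.of_forall fun x => mul_nonneg (h0 x) (weight_pos a x).le)]
  calc _ ≤ ENNReal.ofReal ‖∫ x, fderiv ℝ F x (weight a x • (x - a))‖ :=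
        ENNReal.ofReal_le_ofReal (key.trans (by rw [Real.norm_eq_abs]; exact neg_le_abs _))
    _ = ‖∫ x, fderiv ℝ F x (weight a x • (x - a))‖ₑ := ofReal_norm _
    _ ≤ ∫⁻ x, ‖fderiv ℝ F x (weight a x • (x - a))‖ₑ := enorm_integral_le_lintegral_enorm _
    _ ≤ _ := lintegral_mono fun x => ContinuousLinearMap.le_opENorm _ _

/-! ### Extension into the body by blending along a parallel curve. -/

namespace FramedLoop

variable {L : FramedLoop}

lemma R_le_quarter {R : ℝ} (hκ : 2 * L.kappaMax * R ≤ 1) (h0 : 0 ≤ R) : R ≤ 1 / 4 := by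
  nlinarith [L.two_le_kappaMax]

variable (L) in
lemma hasDerivAt_tube_base (s ρ θ : ℝ) : HasDerivAt (fun s => L.tube s ρ θ)
    ((1 - ρ * (L.κ₁ s * Real.cos θ + L.κ₂ s * Real.sin θ)) • deriv L.X s
      + (ρ * L.κ₃) • L.eθ s θ) s := by
  have := (L.differentiable_X s).hasDerivAt.add
    ((((L.hasDerivAt_e₁ s).const_smul (Real.cos θ)).add
      ((L.hasDerivAt_e₂ s).const_smul (Real.sin θ))).const_smul ρ)
  refine this.congr_deriv ?_
  rw [eθ]
  module

lemma norm_tube_base_le {R : ℝ} (hκ : 2 * L.kappaMax * R ≤ 1) {s ρ θ : ℝ} (h0 : 0 ≤ ρ)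
    (hρ : ρ < R) : ‖(1 - ρ * (L.κ₁ s * Real.cos θ + L.κ₂ s * Real.sin θ)) • deriv L.X s
      + (ρ * L.κ₃) • L.eθ s θ‖ ≤ 4 := by
  refine (norm_add_le _ _).trans ?_
  rw [norm_smul, norm_smul, L.unit_speed, L.norm_eθ, mul_one, mul_one, Real.norm_eq_abs,
    Real.norm_eq_abs, abs_mul, abs_of_nonneg h0]
  have h1 := abs_le.1 (jac_factor_bound (L := L) hκ (s := s) (θ := θ) h0 hρ)
  have h2 := R_le_quarter hκ (h0.trans hρ.le)
  have h3 : |L.κ₃| ≤ 4 := L.abs_κ₃_le.trans Real.pi_le_four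
  have h4 : ρ * |L.κ₃| ≤ 1 / 4 * 4 := by gcongr; linarith
  have h5 : |1 - ρ * (L.κ₁ s * Real.cos θ + L.κ₂ s * Real.sin θ)| ≤ 3 / 2 := by
    rw [abs_le]; constructor <;> linarith
  linarith

/-- Extension of a function into the slender body, by blending with the values along one
fibre `s ↦ (s, ρ₀, θ₀)`. -/
lemma TubeInj.exists_extension {R : ℝ} (hR : L.TubeInj R) (hκ : 2 * L.kappaMax * R ≤ 1)
    {ε M : ℝ} (hε : 0 < ε) (hεR : 2 * ε < R) {η : ℝ → ℝ} (hη : ContDiff ℝ 1 η)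
    (hη1 : ∀ t ≤ ε ^ 2, η t = 1 ∧ deriv η t = 0)
    (hη2 : ∀ t, (2 * ε) ^ 2 ≤ t → η t = 0 ∧ deriv η t = 0)
    (hη3 : ∀ t, 0 ≤ η t ∧ η t ≤ 1) (hη4 : ∀ t, |deriv η t| ≤ M / ε ^ 2)
    {f : E3 → ℝ} (hf : ContDiff ℝ 1 f) (hfc : HasCompactSupport f) (hf0 : ∀ x, 0 ≤ f x)
    {ρ₀ θ₀ : ℝ} (hρ₀ : 0 ≤ ρ₀) (hρ₀R : ρ₀ < R) :
    ∃ F : E3 → ℝ, ContDiff ℝ 1 F ∧ HasCompactSupport F ∧ (∀ x, 0 ≤ F x) ∧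
      (∀ s ρ θ, 0 ≤ ρ → ρ < R → |F (L.tube s ρ θ) - f (L.tube s ρ θ)| ≤
        |f (L.tube s ρ₀ θ₀) - f (L.tube s ρ θ)|) ∧
      (∀ x, 2 * ε ≤ Metric.infDist x (range L.X) → F x = f x ∧ ‖fderiv ℝ F x‖ ≤ ‖fderiv ℝ f x‖) ∧
      (∀ s ρ θ, 0 ≤ ρ → ρ ≤ ε →
        ‖fderiv ℝ F (L.tube s ρ θ)‖ ≤ 8 * ‖fderiv ℝ f (L.tube s ρ₀ θ₀)‖) ∧
      (∀ s ρ θ, ε < ρ → ρ < 2 * ε → ‖fderiv ℝ F (L.tube s ρ θ)‖ ≤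
        8 * ‖fderiv ℝ f (L.tube s ρ₀ θ₀)‖ + (‖fderiv ℝ f (L.tube s ρ θ)‖
          + 24 * M / ε * |f (L.tube s ρ₀ θ₀) - f (L.tube s ρ θ)|)) := by
  have hR0 : 0 ≤ R := by linarith
  have hfd : Differentiable ℝ f := hf.differentiable one_ne_zero
  have hηd : Differentiable ℝ η := hη.differentiable one_ne_zero
  have hq : ContDiff ℝ 1 fun p : E3 => p 1 ^ 2 + p 2 ^ 2 :=
    ((contDiff_apply_E3 1).pow 2).add ((contDiff_apply_E3 2).pow 2)
  have htube0 : ContDiff ℝ 1 fun p : E3 => L.tube (p 0) ρ₀ θ₀ := by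
    have h0 : ContDiff ℝ 1 fun p : E3 => p 0 := contDiff_apply_E3 0
    exact ((L.X_contDiff.of_le (by norm_num)).comp h0).add (ContDiff.const_smul ρ₀
      ((((L.e₁_contDiff.of_le (by norm_num)).comp h0).const_smul (Real.cos θ₀)).add
        (((L.e₂_contDiff.of_le (by norm_num)).comp h0).const_smul (Real.sin θ₀))))
  -- The extension is `f + g`, that is `(1 - η) f + η f(fibre)` in coordinates. It is nonnegative as
  -- a convex combination, equals `f` beyond `2ε`, and depends on `s` alone for `ρ ≤ ε`.
  obtain ⟨g, hg, hgG, hg0⟩ := hR.exists_pushforward hκ (r := 2 * ε) (by positivity) hεR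
    (G := fun p => η (p 1 ^ 2 + p 2 ^ 2) * (f (L.tube (p 0) ρ₀ θ₀) - f (L.coord p)))
    ((hη.comp hq).mul ((hf.comp htube0).sub (hf.comp (L.contDiff_coord.of_le (by norm_num)))))
    (by
      rintro p q ⟨k, hk⟩ h1 h2
      simp only [coord, hk, h1, h2, X_add_int, e₁_add_int, e₂_add_int, tube_add_int])
    (fun p hp => by simp only [(hη2 _ hp).1, zero_mul])
  have hFp : ∀ p : E3, p 1 ^ 2 + p 2 ^ 2 < R ^ 2 → f (L.coord p) + g (L.coord p) =
      f (L.coord p) + η (p 1 ^ 2 + p 2 ^ 2) * (f (L.tube (p 0) ρ₀ θ₀) - f (L.coord p)) :=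
    fun p hp => by rw [hgG p hp]
  have hgc : HasCompactSupport g := by
    refine HasCompactSupport.of_support_subset_isCompact
      (L.isCompact_range_X.cthickening (r := 2 * ε)) fun x hx => ?_
    by_contra hcon
    refine hx (hg0 x (le_of_lt ?_))
    rw [Metric.mem_cthickening_iff, ENNReal.le_ofReal_iff_toReal_le
      (Metric.infEDist_ne_top (range_nonempty _)) (by positivity)] at hcon
    exact not_le.1 hcon
  have hFd : Differentiable ℝ (fun x => f x + g x) :=
    hfd.add (hg.differentiable one_ne_zero)
  -- Directional derivative in the direction `V`, computed along the coordinate line whose direction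
  -- `w` is the preimage of `V`. Here `2a` is the derivative of `p₁² + p₂²`, and `b` that of the
  -- fibre value; the factor `8` is `2 · 4`, from `|w 0| ≤ 2‖V‖` and the speed bound `4` of the
  -- fibre.
  have key : ∀ p : E3, p 1 ^ 2 + p 2 ^ 2 < R ^ 2 → ∀ V : E3, ∃ a b : ℝ,
      |a| ≤ 3 * ‖V‖ * (|p 1| + |p 2|) ∧ |b| ≤ 8 * ‖V‖ * ‖fderiv ℝ f (L.tube (p 0) ρ₀ θ₀)‖ ∧
      fderiv ℝ (fun x => f x + g x) (L.coord p) V = fderiv ℝ f (L.coord p) V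
        + (deriv η (p 1 ^ 2 + p 2 ^ 2) * (2 * a) * (f (L.tube (p 0) ρ₀ θ₀) - f (L.coord p))
        + η (p 1 ^ 2 + p 2 ^ 2) * (b - fderiv ℝ f (L.coord p) V)) := by
    intro p hp V
    obtain ⟨w, hw, w0, w1, w2⟩ := exists_coordDeriv_eq hκ hp hR0 V
    have hline : HasDerivAt (fun t : ℝ => p + t • w) w 0 := by
      simpa using ((hasDerivAt_id (0 : ℝ)).smul_const w).const_add p
    have hlin : ∀ i : Fin 3, HasDerivAt (fun t : ℝ => (p + t • w) i) (w i) 0 := fun i => by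
      simpa using ((hasDerivAt_id (0 : ℝ)).mul_const (w i)).const_add (p i)
    have hz : p + (0 : ℝ) • w = p := by simp
    have hcoord : HasDerivAt (fun t : ℝ => L.coord (p + t • w)) V 0 := by
      have := (hz.symm ▸ L.hasFDerivAt_coord p :
        HasFDerivAt L.coord (L.coordDeriv p) (p + (0 : ℝ) • w)).comp_hasDerivAt 0 hline
      rwa [hw] at this
    have d1 : HasDerivAt (fun t : ℝ => f (L.coord (p + t • w)))
        (fderiv ℝ f (L.coord p) V) 0 := by
      have h := (hfd (L.coord (p + (0 : ℝ) • w))).hasFDerivAt.comp_hasDerivAt 0 hcoord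
      rwa [hz] at h
    have d2 : HasDerivAt (fun t : ℝ => f (L.coord (p + t • w)) + g (L.coord (p + t • w)))
        (fderiv ℝ (fun x => f x + g x) (L.coord p) V) 0 := by
      have h := (hFd (L.coord (p + (0 : ℝ) • w))).hasFDerivAt.comp_hasDerivAt 0 hcoord
      rwa [hz] at h
    have d3 : HasDerivAt (fun t : ℝ => f (L.tube ((p + t • w) 0) ρ₀ θ₀))
        (fderiv ℝ f (L.tube (p 0) ρ₀ θ₀) (w 0 • ((1 - ρ₀ * (L.κ₁ (p 0) * Real.cos θ₀
          + L.κ₂ (p 0) * Real.sin θ₀)) • deriv L.X (p 0) + (ρ₀ * L.κ₃) • L.eθ (p 0) θ₀))) 0 := by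
      have h' := HasDerivAt.scomp (h := fun t : ℝ => (p + t • w) 0) 0
        (L.hasDerivAt_tube_base ((p + (0 : ℝ) • w) 0) ρ₀ θ₀) (hlin 0)
      have h := (hfd (L.tube ((p + (0 : ℝ) • w) 0) ρ₀ θ₀)).hasFDerivAt.comp_hasDerivAt 0 h'
      rwa [hz] at h
    have d4 : HasDerivAt (fun t : ℝ => η ((p + t • w) 1 ^ 2 + (p + t • w) 2 ^ 2))
        (deriv η (p 1 ^ 2 + p 2 ^ 2) * (2 * (p 1 * w 1 + p 2 * w 2))) 0 := by
      have h := (hηd ((p + (0 : ℝ) • w) 1 ^ 2 + (p + (0 : ℝ) • w) 2 ^ 2)).hasDerivAt.comp 0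
        (((hlin 1).pow 2).add ((hlin 2).pow 2))
      rw [hz] at h
      refine h.congr_deriv ?_
      simp; left; ring
    have hopen : IsOpen {p : E3 | p 1 ^ 2 + p 2 ^ 2 < R ^ 2} :=
      isOpen_lt hq.continuous continuous_const
    have hev : (fun t : ℝ => f (L.coord (p + t • w)) + g (L.coord (p + t • w))) =ᶠ[𝓝 0]
        fun t : ℝ => f (L.coord (p + t • w)) + η ((p + t • w) 1 ^ 2 + (p + t • w) 2 ^ 2) *
          (f (L.tube ((p + t • w) 0) ρ₀ θ₀) - f (L.coord (p + t • w))) := by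
      have := hline.continuousAt.eventually_mem (hopen.mem_nhds (hz.symm ▸ hp :
        (p + (0 : ℝ) • w) 1 ^ 2 + (p + (0 : ℝ) • w) 2 ^ 2 < R ^ 2))
      filter_upwards [this] with t ht
      exact hFp _ ht
    have d5 := (d2.congr_of_eventuallyEq hev.symm).unique (d1.add (d4.mul (d3.sub d1)))
    refine ⟨p 1 * w 1 + p 2 * w 2, fderiv ℝ f (L.tube (p 0) ρ₀ θ₀)
      (w 0 • ((1 - ρ₀ * (L.κ₁ (p 0) * Real.cos θ₀ + L.κ₂ (p 0) * Real.sin θ₀)) • deriv L.X (p 0)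
        + (ρ₀ * L.κ₃) • L.eθ (p 0) θ₀)), ?_, ?_, ?_⟩
    rotate_left 2
    · rw [d5]; simp only [hz]
    · refine (abs_add_le _ _).trans ?_
      rw [abs_mul, abs_mul]
      nlinarith [mul_le_mul_of_nonneg_left w1 (abs_nonneg (p 1)),
        mul_le_mul_of_nonneg_left w2 (abs_nonneg (p 2))]
    · rw [← Real.norm_eq_abs]
      refine ((fderiv ℝ f (L.tube (p 0) ρ₀ θ₀)).le_opNorm _).trans ?_
      rw [norm_smul, Real.norm_eq_abs, mul_comm]
      have := norm_tube_base_le hκ (s := p 0) (θ := θ₀) hρ₀ hρ₀R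
      refine mul_le_mul_of_nonneg_right ?_ (norm_nonneg _)
      calc _ ≤ (2 * ‖V‖) * 4 := mul_le_mul w0 this (norm_nonneg _) (by positivity)
        _ = 8 * ‖V‖ := by ring
  have polar : ∀ s ρ θ : ℝ, 0 ≤ ρ → ρ < R → ∃ p : E3, L.coord p = L.tube s ρ θ ∧ p 0 = s ∧
      p 1 ^ 2 + p 2 ^ 2 = ρ ^ 2 ∧ p 1 ^ 2 + p 2 ^ 2 < R ^ 2 := fun s ρ θ h0 h1 => by
    have e : (ρ * Real.cos θ) ^ 2 + (ρ * Real.sin θ) ^ 2 = ρ ^ 2 := by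
      linear_combination ρ ^ 2 * Real.cos_sq_add_sin_sq θ
    exact ⟨!₂[s, ρ * Real.cos θ, ρ * Real.sin θ], (L.tube_eq_coord s ρ θ).symm, by simp,
      by simpa using e, by simpa [e] using pow_lt_pow_left₀ h1 h0 two_ne_zero⟩
  refine ⟨fun x => f x + g x, hf.add hg, hfc.add hgc, fun x => ?_, fun s ρ θ h0 h1 => ?_,
    fun x hx => ⟨by simp [hg0 x hx], ?_⟩, fun s ρ θ h0 h1 => ?_, fun s ρ θ h0 h1 => ?_⟩
  · rcases le_or_gt (2 * ε) (Metric.infDist x (range L.X)) with hx | hx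
    · simpa [hg0 x hx] using hf0 x
    · obtain ⟨p, rfl, hp⟩ := L.exists_coord_eq x
      have hpR : p 1 ^ 2 + p 2 ^ 2 < R ^ 2 := by
        rw [hp]; exact pow_lt_pow_left₀ (hx.trans hεR) Metric.infDist_nonneg two_ne_zero
      dsimp only
      rw [hFp p hpR]
      have h1 := hη3 (p 1 ^ 2 + p 2 ^ 2)
      nlinarith [mul_nonneg h1.1 (hf0 (L.tube (p 0) ρ₀ θ₀)),
        mul_nonneg (sub_nonneg.2 h1.2) (hf0 (L.coord p))]
  · obtain ⟨p, hp, rfl, -, hpR⟩ := polar s ρ θ h0 h1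
    rw [← hp, add_sub_cancel_left, hgG p hpR, abs_mul, abs_of_nonneg (hη3 _).1]
    exact mul_le_of_le_one_left (abs_nonneg _) (hη3 _).2
  · rcases lt_or_ge (Metric.infDist x (range L.X)) R with hxR | hxR
    · obtain ⟨p, rfl, hp⟩ := L.exists_coord_eq x
      have hpR : p 1 ^ 2 + p 2 ^ 2 < R ^ 2 := by
        rw [hp]; exact pow_lt_pow_left₀ hxR Metric.infDist_nonneg two_ne_zero
      refine ContinuousLinearMap.opNorm_le_bound _ (norm_nonneg _) fun V => ?_
      obtain ⟨a, b, -, -, e⟩ := key p hpR V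
      obtain ⟨e1, e2⟩ := hη2 (p 1 ^ 2 + p 2 ^ 2) (by rw [hp]; gcongr)
      rw [e, e1, e2]
      simpa using (fderiv ℝ f (L.coord p)).le_opNorm V
    · have : (fun x => f x + g x) =ᶠ[𝓝 x] f := by
        have ho : IsOpen {x : E3 | 2 * ε < Metric.infDist x (range L.X)} :=
          isOpen_lt continuous_const (Metric.continuous_infDist_pt _)
        filter_upwards [ho.mem_nhds (hεR.trans_le hxR)] with z hz1
        simp [hg0 z (le_of_lt hz1)]
      rw [this.fderiv_eq]
  · obtain ⟨p, hp, rfl, hpρ, hpR⟩ := polar s ρ θ h0 (by linarith)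
    obtain ⟨e1, e2⟩ := hη1 (p 1 ^ 2 + p 2 ^ 2) (by rw [hpρ]; gcongr)
    rw [← hp]
    refine ContinuousLinearMap.opNorm_le_bound _ (by positivity) fun V => ?_
    obtain ⟨a, b, -, hb, e⟩ := key p hpR V
    rw [e, e1, e2]
    simp only [zero_mul, zero_add, one_mul, add_sub_cancel, Real.norm_eq_abs]
    linarith
  · obtain ⟨p, hp, rfl, hpρ, hpR⟩ := polar s ρ θ (by linarith) (by linarith)
    rw [← hp]
    have hM : 0 ≤ M / ε ^ 2 := (abs_nonneg _).trans (hη4 0)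
    have hM0 : 0 ≤ M := by
      rwa [le_div_iff₀ (by positivity), zero_mul] at hM
    refine ContinuousLinearMap.opNorm_le_bound _ (by positivity) fun V => ?_
    obtain ⟨a, b, ha, hb, e⟩ := key p hpR V
    obtain ⟨h3, h3'⟩ := hη3 (p 1 ^ 2 + p 2 ^ 2)
    have hV := (fderiv ℝ f (L.coord p)).le_opNorm V
    rw [Real.norm_eq_abs] at hV
    -- This is where `24 M / ε` comes from: `|η'| · 2|a| ≤ (M / ε²) · 24 ε ‖V‖`.
    have ha' : |a| ≤ 12 * ε * ‖V‖ := by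
      have hp1 : |p 1| ≤ 2 * ε := by
        refine abs_le_of_sq_le_sq ?_ (by positivity)
        nlinarith [sq_nonneg (p 2)]
      have hp2 : |p 2| ≤ 2 * ε := by
        refine abs_le_of_sq_le_sq ?_ (by positivity)
        nlinarith [sq_nonneg (p 1)]
      calc |a| ≤ _ := ha
        _ ≤ 3 * ‖V‖ * (2 * ε + 2 * ε) := by gcongr
        _ = _ := by ring
    set Δ := f (L.tube (p 0) ρ₀ θ₀) - f (L.coord p)
    have t1 : |deriv η (p 1 ^ 2 + p 2 ^ 2) * (2 * a) * Δ| ≤ 24 * M / ε * |Δ| * ‖V‖ := by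
      rw [abs_mul, abs_mul, abs_mul, abs_two]
      calc _ ≤ M / ε ^ 2 * (2 * (12 * ε * ‖V‖)) * |Δ| := by
            gcongr; exact hη4 _
        _ = _ := by field_simp; ring
    rw [e, Real.norm_eq_abs]
    set D := fderiv ℝ f (L.coord p) V
    set t := η (p 1 ^ 2 + p 2 ^ 2)
    calc |D + (deriv η (p 1 ^ 2 + p 2 ^ 2) * (2 * a) * Δ + t * (b - D))|
        = |(1 - t) * D + t * b + deriv η (p 1 ^ 2 + p 2 ^ 2) * (2 * a) * Δ| := by ring_nf
      _ ≤ |(1 - t) * D| + |t * b| + |deriv η (p 1 ^ 2 + p 2 ^ 2) * (2 * a) * Δ| :=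
          abs_add_three _ _ _
      _ ≤ |D| + |b| + 24 * M / ε * |Δ| * ‖V‖ := by
          rw [abs_mul, abs_mul, abs_of_nonneg h3, abs_of_nonneg (sub_nonneg.2 h3')]
          refine add_le_add (add_le_add ?_ ?_) t1
          · exact mul_le_of_le_one_left (abs_nonneg _) (by linarith)
          · exact mul_le_of_le_one_left (abs_nonneg _) h3'
      _ ≤ _ := by linarith

end FramedLoop

lemma norm_weight_smul_le (a x : E3) : ‖weight a x • (x - a)‖ ≤ √(weight a x) := by
  rw [norm_smul, Real.norm_of_nonneg (weight_pos a x).le]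
  refine Real.le_sqrt_of_sq_le ?_
  nlinarith [weight_mul a x, weight_pos a x, sq_nonneg (weight a x)]

/-! ### Weighted Hardy inequalities in the exterior, with constants independent of `ε`. -/

namespace FramedLoop

variable {L : FramedLoop}

/-- Every point of the curve is within arclength `1/2` of `X 0`, and `R ≤ 1/4`, so the tube lies in
the unit ball around `X 0`. Inside the tube the weight can therefore be inserted or removed at the
cost of a constant. -/
lemma half_le_weight {R : ℝ} (hκ : 2 * L.kappaMax * R ≤ 1) (h0 : 0 ≤ R) {x : E3}
    (hx : Metric.infDist x (range L.X) < R) : 1 / 2 ≤ weight (L.X 0) x := by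
  obtain ⟨_, ⟨s, rfl⟩, hs⟩ := L.isCompact_range_X.exists_infDist_eq_dist (range_nonempty _) x
  have h1 : L.X s = L.X (s - round s) := by
    rw [← X_add_int (s - round s) (round s)]; congr 1; ring
  have h2 := L.norm_X_sub_le 0 (s - round s)
  have h3 : ‖x - L.X 0‖ ≤ 1 := by
    calc ‖x - L.X 0‖ = ‖(x - L.X s) + (L.X s - L.X 0)‖ := by rw [sub_add_sub_cancel]
      _ ≤ ‖x - L.X s‖ + ‖L.X s - L.X 0‖ := norm_add_le _ _
      _ ≤ 1 / 4 + 1 / 2 := by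
          refine add_le_add ?_ ?_
          · rw [← dist_eq_norm, ← hs]; exact hx.le.trans (R_le_quarter hκ h0)
          · rw [h1]; refine h2.trans ?_
            rw [sub_zero]; exact abs_sub_round s
      _ ≤ 1 := by norm_num
  have h4 := weight_mul (L.X 0) x
  have h5 : ‖x - L.X 0‖ ^ 2 ≤ 1 := pow_le_one₀ (norm_nonneg _) h3
  nlinarith [weight_pos (L.X 0) x]

lemma half_le_sqrt_weight {R : ℝ} (hκ : 2 * L.kappaMax * R ≤ 1) (h0 : 0 ≤ R) {x : E3}
    (hx : Metric.infDist x (range L.X) < R) : 1 / 2 ≤ √(weight (L.X 0) x) := by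
  refine Real.le_sqrt_of_sq_le ?_
  linarith [half_le_weight hκ h0 hx]

lemma measurableSet_lt_infDist (a : ℝ) :
    MeasurableSet {x : E3 | a < Metric.infDist x (range L.X)} :=
  (isOpen_lt continuous_const (Metric.continuous_infDist_pt _)).measurableSet

lemma TubeInj.lintegral_indicator_le_polar {R : ℝ} (hR : L.TubeInj R)
    (hκ : 2 * L.kappaMax * R ≤ 1) {a b : ℝ} (ha : 0 ≤ a) (hb0 : 0 ≤ b) (hb : b ≤ R)
    {h : E3 → ℝ≥0∞} (hh : Measurable h) :
    ∫⁻ x in {x | Metric.infDist x (range L.X) < b},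
        {x : E3 | a < Metric.infDist x (range L.X)}.indicator h x ≤
      2 * ∫⁻ s, ∫⁻ z, ENNReal.ofReal z.1 * h (L.tube s z.1 z.2) ∂annulus a b ∂period := by
  refine (hR.lintegral_le_polar hκ hb0 hb (hh.indicator (measurableSet_lt_infDist a))).trans ?_
  refine mul_le_mul' le_rfl (lintegral_mono fun s => ?_)
  rw [← annulus_restrict ha, ← lintegral_indicator
    (isOpen_lt continuous_const continuous_fst).measurableSet]
  refine lintegral_mono_ae ?_
  filter_upwards [ae_annulus 0 b] with z hz
  by_cases hza : a < z.1
  · rw [indicator_of_mem (show z ∈ {z : ℝ × ℝ | a < z.1} from hza)]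
    gcongr
    exact indicator_le_self _ _ _
  · rw [indicator_of_notMem (show z ∉ {z : ℝ × ℝ | a < z.1} from hza), indicator_of_notMem,
      mul_zero]
    rw [Set.mem_ofPred_eq, hR.infDist_tube hz.1.1.le (hz.1.2.trans_le hb)]
    exact hza

lemma lintegral_radius_le {b : ℝ} (hb : 0 ≤ b) :
    ∫⁻ z : ℝ × ℝ, ENNReal.ofReal z.1 ∂annulus 0 b ≤ ENNReal.ofReal (8 * b ^ 2) := by
  calc _ ≤ ∫⁻ _ : ℝ × ℝ, ENNReal.ofReal b ∂annulus 0 b := by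
        refine lintegral_mono_ae ?_
        filter_upwards [ae_annulus 0 b] with z hz
        exact ENNReal.ofReal_le_ofReal hz.1.2.le
    _ = ENNReal.ofReal (b * (b * (2 * Real.pi))) := by
        rw [lintegral_const, annulus_univ, sub_zero, ← ENNReal.ofReal_mul hb,
          ← ENNReal.ofReal_mul hb]
    _ ≤ _ := ENNReal.ofReal_le_ofReal (by nlinarith [Real.pi_le_four, sq_nonneg b])

lemma period_univ : period univ = 1 := by
  rw [period, Measure.restrict_apply_univ, Real.volume_Ico]; norm_num

variable (L) in
/-- The exterior of the closed tube of radius `ε`. -/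
def outer (ε : ℝ) : Set E3 := {x | ε < Metric.infDist x (range L.X)}

lemma measurableSet_outer (ε : ℝ) : MeasurableSet (L.outer ε) := measurableSet_lt_infDist ε

/-- The estimate for one blending fibre. -/
lemma TubeInj.lintegral_outer_le_fibre {R : ℝ} (hR : L.TubeInj R) (hκ : 2 * L.kappaMax * R ≤ 1)
    {ε M : ℝ} (hM : 0 ≤ M) (hε : 0 < ε) (hεR : 4 * ε < R) {η : ℝ → ℝ} (hη : ContDiff ℝ 1 η)
    (hη1 : ∀ t ≤ ε ^ 2, η t = 1 ∧ deriv η t = 0)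
    (hη2 : ∀ t, (2 * ε) ^ 2 ≤ t → η t = 0 ∧ deriv η t = 0)
    (hη3 : ∀ t, 0 ≤ η t ∧ η t ≤ 1) (hη4 : ∀ t, |deriv η t| ≤ M / ε ^ 2)
    {f : E3 → ℝ} (hf : ContDiff ℝ 1 f) (hfc : HasCompactSupport f) (hf0 : ∀ x, 0 ≤ f x)
    {z₀ : ℝ × ℝ} (hz₀ : 0 ≤ z₀.1) (hz₀R : z₀.1 < R) :
    ∫⁻ x in L.outer ε, ENNReal.ofReal (f x * weight (L.X 0) x) ≤
      ((∫⁻ x in L.outer ε, ‖fderiv ℝ f x‖ₑ * ENNReal.ofReal √(weight (L.X 0) x))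
        + 2 * ∫⁻ s, ∫⁻ z, ENNReal.ofReal z.1 * ‖fderiv ℝ f (L.tube s z.1 z.2)‖ₑ
            ∂annulus ε (2 * ε) ∂period)
      + (ENNReal.ofReal (1024 * ε ^ 2) * (∫⁻ s, ‖fderiv ℝ f (L.tube s z₀.1 z₀.2)‖ₑ ∂period)
        + ENNReal.ofReal (96 * M + 1) *
          ∫⁻ s, ∫⁻ z, ‖f (L.tube s z₀.1 z₀.2) - f (L.tube s z.1 z.2)‖ₑ
            ∂annulus ε (2 * ε) ∂period) := by
  have hR0 : 0 ≤ R := by linarith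
  have h2ε : 0 ≤ 2 * ε := by linarith
  have h2R : 2 * ε ≤ R := by linarith
  have hR4 := R_le_quarter hκ hR0
  obtain ⟨F, hF, hFc, hF0, hF1, hF2, hF3, hF4⟩ := hR.exists_extension hκ hε (by linarith) hη hη1 hη2
    hη3 hη4 hf hfc hf0 (θ₀ := z₀.2) hz₀ hz₀R
  set w := weight (L.X 0) with hw
  set T : Set E3 := {x | Metric.infDist x (range L.X) < 2 * ε} with hT
  have hTm : MeasurableSet T := measurableSet_infDist_lt _
  set S := L.outer ε with hS
  have hSm : MeasurableSet S := measurableSet_outer ε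
  set n : ℝ → ℝ≥0∞ := fun s => ‖fderiv ℝ f (L.tube s z₀.1 z₀.2)‖ₑ with hn
  set N : E3 → ℝ≥0∞ := fun x => ‖fderiv ℝ f x‖ₑ with hN
  set d : ℝ → ℝ × ℝ → ℝ≥0∞ := fun s z => ‖f (L.tube s z₀.1 z₀.2) - f (L.tube s z.1 z.2)‖ₑ with hd
  have hNc : Continuous N := (hf.continuous_fderiv one_ne_zero).enorm
  have hnm : Measurable n := (hNc.comp (continuous_tube.comp
    (by fun_prop : Continuous fun s : ℝ => (s, z₀.1, z₀.2)))).measurable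
  have hDF : Measurable fun x => ‖fderiv ℝ F x‖ₑ :=
    (hF.continuous_fderiv one_ne_zero).measurable.enorm
  have hFf : Measurable fun x => ‖F x - f x‖ₑ := (hF.continuous.sub hf.continuous).measurable.enorm
  set B := ∫⁻ s, ∫⁻ z, ENNReal.ofReal z.1 * N (L.tube s z.1 z.2) ∂annulus ε (2 * ε) ∂period with hB
  set Dl := ∫⁻ s, ∫⁻ z, d s z ∂annulus ε (2 * ε) ∂period with hDl
  set A := ∫⁻ x in S, N x * ENNReal.ofReal √(w x) with hA
  -- `f w ≤ F w + |F - f|`, where the error lives only in the shell between `ε` and `2ε`.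
  have hs1 : ∫⁻ x in S, ENNReal.ofReal (f x * w x) ≤
      (∫⁻ x, ENNReal.ofReal (F x * w x)) + ∫⁻ x in T, S.indicator (fun x => ‖F x - f x‖ₑ) x := by
    rw [← lintegral_indicator hSm, ← lintegral_indicator hTm]
    refine le_of_le_of_eq (lintegral_mono fun x => ?_)
      (lintegral_add_right (fun x => ENNReal.ofReal (F x * w x)) ((hFf.indicator hSm).indicator hTm))
    by_cases hx : x ∈ S
    swap
    · rw [indicator_of_notMem hx]; exact zero_le
    rw [indicator_of_mem hx]
    by_cases hxT : x ∈ T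
    · rw [indicator_of_mem hxT, indicator_of_mem hx, ← ofReal_norm (F x - f x), Real.norm_eq_abs,
        ← ENNReal.ofReal_add (mul_nonneg (hF0 x) (weight_pos _ _).le) (abs_nonneg _)]
      refine ENNReal.ofReal_le_ofReal ?_
      have h1 := weight_le_one (L.X 0) x
      have h2 := weight_pos (L.X 0) x
      have h3 : (f x - F x) * w x ≤ |F x - f x| * 1 := by
        refine mul_le_mul ?_ h1 h2.le (abs_nonneg _)
        rw [abs_sub_comm]; exact le_abs_self _
      linarith
    · rw [(hF2 x (not_lt.1 hxT)).1]; exact le_self_add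
  -- The whole-space inequality for the extension. Outside `T` the gradient is that of `f` and
  -- contributes to `A`; inside `T` the field has norm at most `1` and the weight is dropped.
  have hs2 : ∫⁻ x, ENNReal.ofReal (F x * w x) ≤ (∫⁻ x in T, ‖fderiv ℝ F x‖ₑ) + A := by
    refine (lintegral_weight_mul_le hF hFc hF0 (L.X 0)).trans ?_
    rw [← lintegral_add_compl _ hTm]
    refine add_le_add (lintegral_mono fun x => ?_) ?_
    · refine mul_le_of_le_one_right' ?_
      rw [← ofReal_norm, ← ENNReal.ofReal_one]
      refine ENNReal.ofReal_le_ofReal ((norm_weight_smul_le _ _).trans ?_)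
      exact Real.sqrt_le_one.2 (weight_le_one _ _)
    · calc _ ≤ ∫⁻ x in Tᶜ, N x * ENNReal.ofReal √(w x) := by
            refine setLIntegral_mono' hTm.compl fun x hx => ?_
            refine mul_le_mul' ?_ ?_
            · exact enorm_le_iff_norm_le.2 (hF2 x (not_lt.1 hx)).2
            · rw [← ofReal_norm]
              exact ENNReal.ofReal_le_ofReal (norm_weight_smul_le _ _)
        _ ≤ A := lintegral_mono_set fun x hx => by
            have : 2 * ε ≤ Metric.infDist x (range L.X) := not_lt.1 hx
            exact lt_of_lt_of_le (by linarith) this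
  -- The polar factor `2ρ` is at most `1`, since `ρ < 2ε` and `4ε < R ≤ 1/4`.
  have hs3 : ∫⁻ x in T, S.indicator (fun x => ‖F x - f x‖ₑ) x ≤ Dl := by
    refine (hR.lintegral_indicator_le_polar hκ hε.le h2ε h2R hFf).trans ?_
    rw [← lintegral_const_mul' _ _ (by norm_num)]
    refine lintegral_mono fun s => ?_
    dsimp only
    rw [← lintegral_const_mul' _ _ (by norm_num)]
    refine lintegral_mono_ae ?_
    filter_upwards [ae_annulus ε (2 * ε)] with z hz
    rw [← mul_assoc]
    calc _ ≤ 1 * d s z := by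
          refine mul_le_mul' ?_ ?_
          · rw [show (2 : ℝ≥0∞) = ENNReal.ofReal 2 by norm_num, ← ENNReal.ofReal_mul zero_le_two,
              ← ENNReal.ofReal_one]
            exact ENNReal.ofReal_le_ofReal (by linarith [hz.1.2])
          · exact enorm_le_iff_norm_le.2 (hF1 s z.1 z.2 (by linarith [hz.1.1]) (by linarith [hz.1.2]))
      _ = _ := one_mul _
  have hrad : ∀ b : ℝ≥0∞, ∫⁻ z : ℝ × ℝ, ENNReal.ofReal z.1 * b ∂annulus 0 (2 * ε) ≤
      ENNReal.ofReal (32 * ε ^ 2) * b := fun b => by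
    rw [lintegral_mul_const _ (by fun_prop)]
    gcongr
    refine (lintegral_radius_le h2ε).trans (ENNReal.ofReal_le_ofReal (by linarith))
  have e8 : (8 : ℝ≥0∞) = ENNReal.ofReal 8 := by norm_num
  -- In the body the gradient is at most `8 n(s)`, and a disc of radius `2ε` has weighted mass at
  -- most `32 ε²`; with the polar factor, `512 = 2 · 32 · 8`.
  have hs4 : ∫⁻ x in T, Sᶜ.indicator (fun x => ‖fderiv ℝ F x‖ₑ) x ≤
      ENNReal.ofReal (512 * ε ^ 2) * ∫⁻ s, n s ∂period := by
    refine (hR.lintegral_le_polar hκ h2ε h2R (hDF.indicator hSm.compl)).trans ?_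
    rw [← lintegral_const_mul' _ _ (by norm_num), ← lintegral_const_mul' _ _ ENNReal.ofReal_ne_top]
    refine lintegral_mono fun s => ?_
    calc _ ≤ 2 * ∫⁻ z : ℝ × ℝ, ENNReal.ofReal z.1 * (8 * n s) ∂annulus 0 (2 * ε) := by
          refine mul_le_mul' le_rfl (lintegral_mono_ae ?_)
          filter_upwards [ae_annulus 0 (2 * ε)] with z hz
          refine mul_le_mul' le_rfl ?_
          by_cases hzS : L.tube s z.1 z.2 ∈ Sᶜ
          · rw [indicator_of_mem hzS]
            have : z.1 ≤ ε := by
              have h1 : ¬ ε < Metric.infDist (L.tube s z.1 z.2) (range L.X) := hzS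
              rw [hR.infDist_tube hz.1.1.le (hz.1.2.trans_le h2R)] at h1
              exact not_lt.1 h1
            have h3 := hF3 s z.1 z.2 hz.1.1.le this
            rw [e8, hn]
            dsimp only
            rw [← ofReal_norm, ← ofReal_norm, ← ENNReal.ofReal_mul (by norm_num)]
            exact ENNReal.ofReal_le_ofReal h3
          · rw [indicator_of_notMem hzS]; exact zero_le
      _ ≤ 2 * (ENNReal.ofReal (32 * ε ^ 2) * (8 * n s)) := by gcongr; exact hrad _
      _ = _ := by
          rw [e8, show (2 : ℝ≥0∞) = ENNReal.ofReal 2 by norm_num, ← mul_assoc, ← mul_assoc,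
            ← ENNReal.ofReal_mul (by positivity), ← ENNReal.ofReal_mul (by positivity)]
          congr 2; ring
  -- In the shell the cutoff contributes `ρ · 24 M / ε ≤ 48 M`, doubled by the polar comparison.
  have hs5 : ∫⁻ x in T, S.indicator (fun x => ‖fderiv ℝ F x‖ₑ) x ≤
      ENNReal.ofReal (512 * ε ^ 2) * (∫⁻ s, n s ∂period) + (2 * B + ENNReal.ofReal (96 * M) * Dl) := by
    refine (hR.lintegral_indicator_le_polar hκ hε.le h2ε h2R hDF).trans ?_
    have hpt : ∀ s, ∫⁻ z, ENNReal.ofReal z.1 * ‖fderiv ℝ F (L.tube s z.1 z.2)‖ₑ ∂annulus ε (2 * ε) ≤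
        ENNReal.ofReal (256 * ε ^ 2) * n s
          + ((∫⁻ z, ENNReal.ofReal z.1 * N (L.tube s z.1 z.2) ∂annulus ε (2 * ε))
            + ENNReal.ofReal (48 * M) * ∫⁻ z, d s z ∂annulus ε (2 * ε)) := fun s => by
      have m1 : Measurable fun z : ℝ × ℝ => ENNReal.ofReal z.1 * (8 * n s) := by fun_prop
      have m2 : Measurable fun z : ℝ × ℝ => ENNReal.ofReal z.1 * N (L.tube s z.1 z.2) :=
        measurable_polar_integrand hNc.measurable s
      calc _ ≤ ∫⁻ z : ℝ × ℝ, (ENNReal.ofReal z.1 * (8 * n s)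
            + (ENNReal.ofReal z.1 * N (L.tube s z.1 z.2) + ENNReal.ofReal (48 * M) * d s z))
              ∂annulus ε (2 * ε) := by
            refine lintegral_mono_ae ?_
            filter_upwards [ae_annulus ε (2 * ε)] with z hz
            have h4 := hF4 s z.1 z.2 hz.1.1 hz.1.2
            have hz1 : 0 ≤ z.1 := hε.le.trans hz.1.1.le
            have h24 : 0 ≤ 24 * M / ε := by positivity
            have h5 : ENNReal.ofReal z.1 * ‖fderiv ℝ F (L.tube s z.1 z.2)‖ₑ ≤
                ENNReal.ofReal z.1 * (8 * n s + (N (L.tube s z.1 z.2)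
                  + ENNReal.ofReal (24 * M / ε) * d s z)) := by
              gcongr
              rw [e8, hn, hN, hd]
              dsimp only
              rw [← ofReal_norm, ← ofReal_norm, ← ofReal_norm, ← ofReal_norm,
                ← ENNReal.ofReal_mul (by norm_num), ← ENNReal.ofReal_mul h24,
                ← ENNReal.ofReal_add (by positivity) (by positivity),
                ← ENNReal.ofReal_add (by positivity) (by positivity)]
              exact ENNReal.ofReal_le_ofReal h4
            refine h5.trans ?_
            rw [mul_add, mul_add, ← mul_assoc _ (ENNReal.ofReal (24 * M / ε)),
              ← ENNReal.ofReal_mul hz1]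
            refine add_le_add le_rfl (add_le_add le_rfl (mul_le_mul' (ENNReal.ofReal_le_ofReal ?_)
              le_rfl))
            calc z.1 * (24 * M / ε) ≤ 2 * ε * (24 * M / ε) :=
                mul_le_mul_of_nonneg_right hz.1.2.le h24
              _ = 48 * M := by field_simp; ring
        _ = (∫⁻ z : ℝ × ℝ, ENNReal.ofReal z.1 * (8 * n s) ∂annulus ε (2 * ε))
            + ((∫⁻ z, ENNReal.ofReal z.1 * N (L.tube s z.1 z.2) ∂annulus ε (2 * ε))
            + ENNReal.ofReal (48 * M) * ∫⁻ z, d s z ∂annulus ε (2 * ε)) := by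
            rw [lintegral_add_left m1, lintegral_add_left m2,
              lintegral_const_mul' _ _ ENNReal.ofReal_ne_top]
        _ ≤ _ := by
            gcongr
            calc _ ≤ ∫⁻ z : ℝ × ℝ, ENNReal.ofReal z.1 * (8 * n s) ∂annulus 0 (2 * ε) := by
                  rw [← annulus_restrict hε.le]
                  exact setLIntegral_le_lintegral _ _
              _ ≤ _ := hrad _
              _ = _ := by
                  rw [e8, ← mul_assoc, ← ENNReal.ofReal_mul (by positivity)]
                  congr 2; ring
    have m3 : Measurable fun s => ∫⁻ z, ENNReal.ofReal z.1 * N (L.tube s z.1 z.2)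
        ∂annulus ε (2 * ε) := by
      refine Measurable.lintegral_prod_right' (f := fun p : ℝ × ℝ × ℝ =>
        ENNReal.ofReal p.2.1 * N (L.tube p.1 p.2.1 p.2.2)) ?_
      exact (by fun_prop : Measurable fun p : ℝ × ℝ × ℝ => ENNReal.ofReal p.2.1).mul
        (hNc.comp continuous_tube).measurable
    calc _ ≤ 2 * ∫⁻ s, (ENNReal.ofReal (256 * ε ^ 2) * n s
          + ((∫⁻ z, ENNReal.ofReal z.1 * N (L.tube s z.1 z.2) ∂annulus ε (2 * ε))
            + ENNReal.ofReal (48 * M) * ∫⁻ z, d s z ∂annulus ε (2 * ε))) ∂period := by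
          gcongr with s; exact hpt s
      _ = 2 * (ENNReal.ofReal (256 * ε ^ 2) * (∫⁻ s, n s ∂period) + (B + ENNReal.ofReal (48 * M) * Dl)) := by
          rw [lintegral_add_left (hnm.const_mul _), lintegral_add_left m3,
            lintegral_const_mul' _ _ ENNReal.ofReal_ne_top,
            lintegral_const_mul' _ _ ENNReal.ofReal_ne_top]
      _ = _ := by
          rw [show 512 * ε ^ 2 = 2 * (256 * ε ^ 2) by ring, show 96 * M = 2 * (48 * M) by ring,
            ENNReal.ofReal_mul zero_le_two, ENNReal.ofReal_mul zero_le_two, ENNReal.ofReal_ofNat]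
          ring
  have hs6 : ∫⁻ x in T, ‖fderiv ℝ F x‖ₑ = (∫⁻ x in T, Sᶜ.indicator (fun x => ‖fderiv ℝ F x‖ₑ) x)
      + ∫⁻ x in T, S.indicator (fun x => ‖fderiv ℝ F x‖ₑ) x := by
    rw [← lintegral_add_left (hDF.indicator hSm.compl)]
    refine lintegral_congr fun x => ?_
    exact (congrFun (indicator_compl_add_self S fun x => ‖fderiv ℝ F x‖ₑ) x).symm
  calc _ ≤ _ := hs1
    _ ≤ ((ENNReal.ofReal (512 * ε ^ 2) * (∫⁻ s, n s ∂period) + (ENNReal.ofReal (512 * ε ^ 2) *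
          (∫⁻ s, n s ∂period) + (2 * B + ENNReal.ofReal (96 * M) * Dl))) + A) + Dl := by
        refine add_le_add (hs2.trans ?_) hs3
        rw [hs6]
        gcongr
    _ = _ := by
        rw [show 1024 * ε ^ 2 = 512 * ε ^ 2 + 512 * ε ^ 2 by ring,
          ENNReal.ofReal_add (by positivity) (by positivity),
          ENNReal.ofReal_add (by positivity) zero_le_one, ENNReal.ofReal_one]
        ring

end FramedLoop

namespace FramedLoop

lemma lintegral_annulus_period_le {L : FramedLoop} {h : E3 → ℝ≥0∞} (hh : Measurable h) {a b : ℝ} :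
    ENNReal.ofReal a * ∫⁻ z, ∫⁻ s, h (L.tube s z.1 z.2) ∂period ∂annulus a b ≤
      ∫⁻ s, ∫⁻ z, ENNReal.ofReal z.1 * h (L.tube s z.1 z.2) ∂annulus a b ∂period := by
  have hm : Measurable (Function.uncurry fun (z : ℝ × ℝ) (s : ℝ) => h (L.tube s z.1 z.2)) :=
    hh.comp (continuous_tube.comp
      (by fun_prop : Continuous fun p : (ℝ × ℝ) × ℝ => (p.2, p.1.1, p.1.2))).measurable
  rw [lintegral_lintegral_swap hm.aemeasurable, ← lintegral_const_mul' _ _ ENNReal.ofReal_ne_top]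
  refine lintegral_mono fun s => ?_
  dsimp only
  rw [← lintegral_const_mul' _ _ ENNReal.ofReal_ne_top]
  refine lintegral_mono_ae ?_
  filter_upwards [ae_annulus a b] with z hz
  exact mul_le_mul' (ENNReal.ofReal_le_ofReal hz.1.1.le) le_rfl

set_option maxHeartbeats 1000000 in
/-- A weighted Hardy inequality in `L¹` outside tubes. -/
lemma exists_lintegral_outer_le : ∃ C : ℝ, 0 < C ∧ ∀ (L : FramedLoop) (R : ℝ), L.TubeInj R →
    2 * L.kappaMax * R ≤ 1 → ∀ ε : ℝ, 0 < ε → 4 * ε < R → ∀ f : E3 → ℝ, ContDiff ℝ 1 f →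
    HasCompactSupport f → (∀ x, 0 ≤ f x) →
    ∫⁻ x in L.outer ε, ENNReal.ofReal (f x * weight (L.X 0) x) ≤
      ENNReal.ofReal C *
        ∫⁻ x in L.outer ε, ‖fderiv ℝ f x‖ₑ * ENNReal.ofReal √(weight (L.X 0) x) := by
  obtain ⟨M, hM, hη⟩ := exists_radial_cutoff
  -- `1026 = 1024 + 2` collects the fibre term and the `2B` term, `100` is the Poincaré constant,
  -- `96 M + 1` the factor of the differences, and `4` comes from `B ≤ 4A`.
  refine ⟨1 + 4 * (1026 + 100 * (96 * M + 1)), by positivity, ?_⟩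
  intro L R hR hκ ε hε hεR f hf hfc hf0
  obtain ⟨η, hη0, hη1, hη2, hη3, hη4⟩ := hη ε hε
  have hR0 : 0 ≤ R := by linarith
  set A := ∫⁻ x in L.outer ε, ‖fderiv ℝ f x‖ₑ * ENNReal.ofReal √(weight (L.X 0) x) with hA
  set J := ∫⁻ x in L.outer ε, ENNReal.ofReal (f x * weight (L.X 0) x) with hJ
  set N : E3 → ℝ≥0∞ := fun x => ‖fderiv ℝ f x‖ₑ with hN
  have hNc : Continuous N := (hf.continuous_fderiv one_ne_zero).enorm
  set ν := annulus ε (2 * ε) with hν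
  set B := ∫⁻ s, ∫⁻ z, ENNReal.ofReal z.1 * N (L.tube s z.1 z.2) ∂ν ∂period with hB
  set K : ℝ := 96 * M + 1 with hK
  have hK0 : 0 < K := by positivity
  set n : ℝ × ℝ → ℝ≥0∞ := fun z => ∫⁻ s, N (L.tube s z.1 z.2) ∂period with hn
  set d : ℝ → ℝ × ℝ → ℝ × ℝ → ℝ≥0∞ :=
    fun s z₀ z => ‖f (L.tube s z₀.1 z₀.2) - f (L.tube s z.1 z.2)‖ₑ with hd
  have hnm : Measurable n := by
    refine Measurable.lintegral_prod_right' (f := fun p : (ℝ × ℝ) × ℝ =>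
      N (L.tube p.2 p.1.1 p.1.2)) ?_
    exact (hNc.comp (continuous_tube.comp
      (by fun_prop : Continuous fun p : (ℝ × ℝ) × ℝ => (p.2, p.1.1, p.1.2)))).measurable
  have hdm : Measurable fun p : ((ℝ × ℝ) × ℝ) × ℝ × ℝ => d p.1.2 p.1.1 p.2 := by
    refine Measurable.enorm (Measurable.sub ?_ ?_)
    · exact (hf.continuous.comp (continuous_tube.comp (by fun_prop :
        Continuous fun p : ((ℝ × ℝ) × ℝ) × ℝ × ℝ => (p.1.2, p.1.1.1, p.1.1.2)))).measurable
    · exact (hf.continuous.comp (continuous_tube.comp (by fun_prop :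
        Continuous fun p : ((ℝ × ℝ) × ℝ) × ℝ × ℝ => (p.1.2, p.2.1, p.2.2)))).measurable
  have hdm2 : Measurable fun p : (ℝ × ℝ) × ℝ => ∫⁻ z, d p.2 p.1 z ∂ν := hdm.lintegral_prod_right'
  have hfib : ∀ᵐ z₀ ∂ν, J ≤ (A + 2 * B) + (ENNReal.ofReal (1024 * ε ^ 2) * n z₀
      + ENNReal.ofReal K * ∫⁻ s, ∫⁻ z, d s z₀ z ∂ν ∂period) := by
    filter_upwards [ae_annulus ε (2 * ε)] with z₀ hz₀
    exact hR.lintegral_outer_le_fibre hκ hM.le hε hεR hη0 hη1 hη2 hη3 hη4 hf hfc hf0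
      (hε.le.trans hz₀.1.1.le) (by linarith [hz₀.1.2])
  have hswap1 : ENNReal.ofReal ε * ∫⁻ z, n z ∂ν ≤ B := lintegral_annulus_period_le hNc.measurable
  have hswap2 : ∫⁻ z₀, ∫⁻ s, ∫⁻ z, d s z₀ z ∂ν ∂period ∂ν ≤ ENNReal.ofReal (100 * ε) * B := by
    rw [lintegral_lintegral_swap (f := fun z₀ s => ∫⁻ z, d s z₀ z ∂ν) hdm2.aemeasurable, hB,
      ← lintegral_const_mul' _ _ ENNReal.ofReal_ne_top]
    exact lintegral_mono fun s => lintegral_annulus_sub_le hf s hε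
  have hmass : ν univ = ENNReal.ofReal (ε * (2 * Real.pi)) := by
    rw [hν, annulus_univ, ← ENNReal.ofReal_mul (by linarith)]; ring_nf
  have hm1 : ENNReal.ofReal ε ≤ ν univ := by
    rw [hmass]; exact ENNReal.ofReal_le_ofReal (by nlinarith [Real.pi_gt_three])
  have hm0 : ν univ ≠ 0 := by
    refine (lt_of_lt_of_le (ENNReal.ofReal_pos.2 hε) hm1).ne'
  have hmt : ν univ ≠ ⊤ := by rw [hmass]; exact ENNReal.ofReal_ne_top
  -- The values of `f` and of its gradient on one fibre are not controlled by volume integrals, but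
  -- their averages over fibres are. Integrated over `z₀`, each fibre term is at most a constant
  -- times `ε B`, and `ε` is dominated by the total mass `2π ε` of `ν`, which then cancels.
  have havg : ν univ * J ≤ ν univ * (A + ENNReal.ofReal (1026 + 100 * K) * B) := by
    calc ν univ * J = ∫⁻ _, J ∂ν := by rw [lintegral_const, mul_comm]
      _ ≤ _ := lintegral_mono_ae hfib
      _ = (A + 2 * B) * ν univ + (ENNReal.ofReal (1024 * ε ^ 2) * (∫⁻ z, n z ∂ν)
          + ENNReal.ofReal K * ∫⁻ z₀, ∫⁻ s, ∫⁻ z, d s z₀ z ∂ν ∂period ∂ν) := by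
          rw [lintegral_add_left measurable_const, lintegral_const,
            lintegral_add_left (hnm.const_mul _), lintegral_const_mul' _ _ ENNReal.ofReal_ne_top,
            lintegral_const_mul' _ _ ENNReal.ofReal_ne_top]
      _ ≤ (A + 2 * B) * ν univ + (ENNReal.ofReal (1024 * ε) * B
          + ENNReal.ofReal K * (ENNReal.ofReal (100 * ε) * B)) := by
          refine add_le_add le_rfl (add_le_add ?_ (mul_le_mul' le_rfl hswap2))
          rw [show 1024 * ε ^ 2 = 1024 * ε * ε by ring, ENNReal.ofReal_mul (by positivity), mul_assoc]
          exact mul_le_mul' le_rfl hswap1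
      _ = (A + 2 * B) * ν univ + ENNReal.ofReal ε * (ENNReal.ofReal (1024 + 100 * K) * B) := by
          rw [← mul_assoc, ← mul_assoc, ← ENNReal.ofReal_mul hK0.le, ← ENNReal.ofReal_mul hε.le,
            ← add_mul, ← ENNReal.ofReal_add (by positivity) (by positivity)]
          ring_nf
      _ ≤ (A + 2 * B) * ν univ + ν univ * (ENNReal.ofReal (1024 + 100 * K) * B) :=
          add_le_add le_rfl (mul_le_mul' hm1 le_rfl)
      _ = _ := by
          rw [show 1026 + 100 * K = 2 + (1024 + 100 * K) by ring,
            ENNReal.ofReal_add zero_le_two (by positivity), ENNReal.ofReal_ofNat]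
          ring
  have hJA : J ≤ A + ENNReal.ofReal (1026 + 100 * K) * B :=
    (ENNReal.mul_le_mul_iff_right hm0 hmt).1 havg
  have hBA : B ≤ 4 * A := by
    refine (hR.polar_le_lintegral hκ hε.le (by linarith) (by linarith) hNc.measurable).trans ?_
    rw [show (4 : ℝ≥0∞) = 2 * 2 by norm_num, mul_assoc]
    refine mul_le_mul' le_rfl ?_
    rw [hA, ← lintegral_const_mul' _ _ (by norm_num)]
    have hm : MeasurableSet {x : E3 | ε < Metric.infDist x (range L.X) ∧
        Metric.infDist x (range L.X) < 2 * ε} :=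
      (measurableSet_lt_infDist ε).inter (measurableSet_infDist_lt _)
    refine le_trans ?_ (lintegral_mono_set (fun x hx => hx.1 :
      {x : E3 | ε < Metric.infDist x (range L.X) ∧ Metric.infDist x (range L.X) < 2 * ε} ⊆ L.outer ε))
    refine setLIntegral_mono' hm fun x hx => ?_
    have h2 := half_le_sqrt_weight hκ hR0 (x := x) (by linarith [hx.2])
    rw [mul_left_comm]
    refine le_mul_of_one_le_right' ?_
    rw [← ENNReal.ofReal_ofNat, ← ENNReal.ofReal_mul zero_le_two, ← ENNReal.ofReal_one]
    exact ENNReal.ofReal_le_ofReal (by linarith)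
  calc J ≤ A + ENNReal.ofReal (1026 + 100 * K) * (4 * A) := hJA.trans (by gcongr)
    _ = _ := by
        rw [ENNReal.ofReal_add zero_le_one (by positivity), ENNReal.ofReal_one,
          ENNReal.ofReal_mul (by norm_num), ENNReal.ofReal_ofNat]
        ring

set_option maxHeartbeats 1000000 in
/-- A weighted Hardy inequality in `L²` outside tubes. -/
lemma exists_lintegral_outer_sq_le : ∃ C : ℝ, 0 < C ∧ ∀ (L : FramedLoop) (R : ℝ), L.TubeInj R →
    2 * L.kappaMax * R ≤ 1 → ∀ ε : ℝ, 0 < ε → 4 * ε < R → ∀ φ : E3 → E3, ContDiff ℝ 1 φ →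
    HasCompactSupport φ →
    ∫⁻ x in L.outer ε, ENNReal.ofReal (‖φ x‖ ^ 2 * weight (L.X 0) x) ≤
      ENNReal.ofReal C * ∫⁻ x in L.outer ε, ENNReal.ofReal (‖fderiv ℝ φ x‖ ^ 2) := by
  obtain ⟨C, hC, h⟩ := exists_lintegral_outer_le
  refine ⟨4 * C ^ 2, by positivity, fun L R hR hκ ε hε hεR φ hφ hφc => ?_⟩
  -- The `L¹` inequality is applied to `‖φ‖²`, which is `C¹` even where `φ` vanishes.
  have h1 := h L R hR hκ ε hε hεR (fun x => ‖φ x‖ ^ 2) (hφ.norm_sq ℝ)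
    (hφc.mono fun x hx => by
      rw [Function.mem_support] at hx ⊢
      intro h0
      rw [h0] at hx
      simp at hx) (fun x => sq_nonneg _)
  set w := weight (L.X 0) with hw
  set J := ∫⁻ x in L.outer ε, ENNReal.ofReal (‖φ x‖ ^ 2 * w x) with hJ
  set D := ∫⁻ x in L.outer ε, ENNReal.ofReal (‖fderiv ℝ φ x‖ ^ 2) with hD
  have hfd : ∀ x, ‖fderiv ℝ (fun x => ‖φ x‖ ^ 2) x‖ ≤ 2 * ‖φ x‖ * ‖fderiv ℝ φ x‖ := fun x => by
    have h2 := ((hφ.differentiable one_ne_zero x).hasFDerivAt.norm_sq).fderiv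
    rw [h2, two_smul]
    refine (norm_add_le _ _).trans ?_
    have h3 : ‖(innerSL ℝ (φ x)).comp (fderiv ℝ φ x)‖ ≤ ‖φ x‖ * ‖fderiv ℝ φ x‖ := by
      refine (ContinuousLinearMap.opNorm_comp_le _ _).trans ?_
      rw [innerSL_apply_norm]
    linarith
  have hm1 : Measurable fun x => ENNReal.ofReal (‖φ x‖ ^ 2 * w x) :=
    ((hφ.continuous.norm.pow 2).mul (contDiff_weight _).continuous).measurable.ennreal_ofReal
  -- Finiteness of `J` is what permits subtracting `J / 2` below; compact support of `φ` provides
  -- it.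
  have hJt : J ≠ ⊤ := by
    have hc : HasCompactSupport fun x => ‖φ x‖ ^ 2 * w x := by
      refine hφc.mono fun x hx => ?_
      rw [Function.mem_support] at hx ⊢
      intro h0
      rw [h0] at hx
      simp at hx
    have hi : Integrable fun x => ‖φ x‖ ^ 2 * w x :=
      ((hφ.continuous.norm.pow 2).mul
        (contDiff_weight _).continuous).integrable_of_hasCompactSupport hc
    exact (hi.integrableOn (s := L.outer ε)).lintegral_lt_top.ne
  -- Young's inequality: `2C |φ| |∇φ| √w ≤ |φ|² w / 2 + 2 C² |∇φ|²`.
  have h2 : J ≤ J / 2 + ENNReal.ofReal (2 * C ^ 2) * D := by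
    calc J ≤ _ := h1
      _ = ∫⁻ x in L.outer ε, ENNReal.ofReal C *
          (‖fderiv ℝ (fun x => ‖φ x‖ ^ 2) x‖ₑ * ENNReal.ofReal √(w x)) := by
          rw [lintegral_const_mul' _ _ ENNReal.ofReal_ne_top]
      _ ≤ ∫⁻ x in L.outer ε, (ENNReal.ofReal (‖φ x‖ ^ 2 * w x) * 2⁻¹
          + ENNReal.ofReal (2 * C ^ 2) * ENNReal.ofReal (‖fderiv ℝ φ x‖ ^ 2)) := by
          refine lintegral_mono fun x => ?_
          have hw0 := weight_pos (L.X 0) x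
          have hsq := Real.sq_sqrt hw0.le
          have e2 : (2 : ℝ≥0∞)⁻¹ = ENNReal.ofReal 2⁻¹ := by
            rw [ENNReal.ofReal_inv_of_pos zero_lt_two, ENNReal.ofReal_ofNat]
          dsimp only
          rw [← ofReal_norm, ← ENNReal.ofReal_mul (norm_nonneg _), ← ENNReal.ofReal_mul hC.le, e2,
            ← ENNReal.ofReal_mul (mul_nonneg (sq_nonneg _) hw0.le),
            ← ENNReal.ofReal_mul (by positivity),
            ← ENNReal.ofReal_add (mul_nonneg (mul_nonneg (sq_nonneg _) hw0.le) (by norm_num))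
              (by positivity)]
          refine ENNReal.ofReal_le_ofReal ?_
          calc C * (‖fderiv ℝ (fun x => ‖φ x‖ ^ 2) x‖ * √(w x))
              ≤ C * ((2 * ‖φ x‖ * ‖fderiv ℝ φ x‖) * √(w x)) := by gcongr; exact hfd x
            _ ≤ ‖φ x‖ ^ 2 * √(w x) ^ 2 * 2⁻¹ + 2 * C ^ 2 * ‖fderiv ℝ φ x‖ ^ 2 := by
                nlinarith [sq_nonneg (‖φ x‖ * √(w x) - 2 * C * ‖fderiv ℝ φ x‖)]
            _ = _ := by rw [hsq]
      _ = _ := by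
          rw [lintegral_add_left (hm1.mul_const _), lintegral_mul_const _ hm1,
            lintegral_const_mul' _ _ ENNReal.ofReal_ne_top, ENNReal.div_eq_inv_mul, mul_comm J]
  have h3 : J / 2 ≤ ENNReal.ofReal (2 * C ^ 2) * D := by
    have h4 : J / 2 ≠ ⊤ := (ENNReal.div_lt_top hJt (by norm_num)).ne
    refine (ENNReal.add_le_add_iff_left h4).1 ?_
    rwa [ENNReal.add_halves]
  calc J = J / 2 + J / 2 := (ENNReal.add_halves J).symm
    _ ≤ ENNReal.ofReal (2 * C ^ 2) * D + ENNReal.ofReal (2 * C ^ 2) * D := add_le_add h3 h3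
    _ = _ := by
        rw [← add_mul, ← ENNReal.ofReal_add (by positivity) (by positivity)]
        ring_nf

end FramedLoop

/-! ### The trace inequality for smooth functions. -/

lemma lintegral_Ioo_inv {a b : ℝ} (ha : 0 < a) (hab : a ≤ b) :
    ∫⁻ t in Ioo a b, ENNReal.ofReal t⁻¹ = ENNReal.ofReal (Real.log (b / a)) := by
  rw [setLIntegral_congr Ioo_ae_eq_Ioc, ← integral_inv_of_pos ha (ha.trans_le hab),
    intervalIntegral.integral_of_le hab, ofReal_integral_eq_lintegral_ofReal]
  · have h : IntervalIntegrable (fun t : ℝ => t⁻¹) volume a b :=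
      intervalIntegral.intervalIntegrable_inv (fun t ht => by
        rw [uIcc_of_le hab] at ht; linarith [ht.1]) continuousOn_id
    exact (intervalIntegrable_iff_integrableOn_Ioc_of_le hab).1 h
  · filter_upwards [ae_restrict_mem measurableSet_Ioc] with t ht
    exact inv_nonneg.2 (ha.trans ht.1).le

/-- Cauchy–Schwarz for `t^{-1/2} · t^{1/2} g`. The integral of `1/t` is the sole source of the
logarithm, and the weight `t` left on `g²` is the one of polar coordinates. -/
lemma sq_lintegral_Ioo_le {a b : ℝ} (ha : 0 < a) (hab : a ≤ b) {g : ℝ → ℝ≥0∞} (hg : Measurable g) :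
    (∫⁻ t in Ioo a b, g t) ^ 2 ≤
      ENNReal.ofReal (Real.log (b / a)) * ∫⁻ t in Ioo a b, ENNReal.ofReal t * g t ^ 2 := by
  have hpq : (2 : ℝ).HolderConjugate 2 := Real.HolderConjugate.two_two
  have key := ENNReal.lintegral_mul_le_Lp_mul_Lq (volume.restrict (Ioo a b)) hpq
    (f := fun t => ENNReal.ofReal (√t⁻¹)) (g := fun t => ENNReal.ofReal √t * g t)
    (by fun_prop) (by fun_prop)
  have e1 : ∫⁻ t in Ioo a b, g t =
      ∫⁻ t in Ioo a b, ((fun t => ENNReal.ofReal (√t⁻¹)) * fun t => ENNReal.ofReal √t * g t) t := by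
    refine setLIntegral_congr_fun measurableSet_Ioo fun t ht => ?_
    have h0 : 0 < t := ha.trans ht.1
    simp only [Pi.mul_apply]
    rw [← mul_assoc, ← ENNReal.ofReal_mul (Real.sqrt_nonneg _), ← Real.sqrt_mul (by positivity),
      inv_mul_cancel₀ h0.ne']
    simp
  have e2 : ∫⁻ t in Ioo a b, ENNReal.ofReal (√t⁻¹) ^ (2 : ℝ) = ENNReal.ofReal (Real.log (b / a)) := by
    rw [← lintegral_Ioo_inv ha hab]
    refine setLIntegral_congr_fun measurableSet_Ioo fun t ht => ?_
    have h0 : 0 < t := ha.trans ht.1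
    rw [ENNReal.rpow_two, ← ENNReal.ofReal_pow (Real.sqrt_nonneg _), Real.sq_sqrt (by positivity)]
  have e3 : ∫⁻ t in Ioo a b, (ENNReal.ofReal √t * g t) ^ (2 : ℝ) =
      ∫⁻ t in Ioo a b, ENNReal.ofReal t * g t ^ 2 := by
    refine setLIntegral_congr_fun measurableSet_Ioo fun t ht => ?_
    have h0 : 0 < t := ha.trans ht.1
    rw [ENNReal.rpow_two, mul_pow, ← ENNReal.ofReal_pow (Real.sqrt_nonneg _), Real.sq_sqrt h0.le]
  rw [← e1, e2, e3, ← ENNReal.mul_rpow_of_nonneg _ _ (by norm_num)] at key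
  calc _ ≤ _ := pow_le_pow_left' key 2
    _ = _ := by rw [← ENNReal.rpow_two, ← ENNReal.rpow_mul]; norm_num

namespace FramedLoop

variable {L : FramedLoop}

lemma sq_enorm_tube_le {φ : E3 → E3} (hφ : ContDiff ℝ 1 φ) (s θ : ℝ) {a b r : ℝ} (ha : 0 < a)
    (hr : r ∈ Icc a b) :
    ‖φ (L.tube s a θ)‖ₑ ^ 2 ≤ 2 * ‖φ (L.tube s r θ)‖ₑ ^ 2 + 2 * (ENNReal.ofReal (Real.log (b / a)) *
      ∫⁻ t in Ioo a b, ENNReal.ofReal t * ‖fderiv ℝ φ (L.tube s t θ)‖ₑ ^ 2) := by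
  have hab : a ≤ b := hr.1.trans hr.2
  have hm : Measurable fun t => ‖fderiv ℝ φ (L.tube s t θ)‖ₑ :=
    ((hφ.continuous_fderiv one_ne_zero).comp
      (continuous_tube.comp (by fun_prop : Continuous fun t : ℝ => (s, t, θ)))).measurable.enorm
  have h1 : ‖φ (L.tube s a θ)‖ₑ ≤ ‖φ (L.tube s r θ)‖ₑ
      + ∫⁻ t in Ioo a b, ‖fderiv ℝ φ (L.tube s t θ)‖ₑ := by
    calc _ = ‖φ (L.tube s r θ) + (φ (L.tube s a θ) - φ (L.tube s r θ))‖ₑ := by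
          rw [add_sub_cancel]
      _ ≤ _ := enorm_add_le _ _
      _ ≤ _ := add_le_add le_rfl (enorm_sub_le_radial hφ s θ (left_mem_Icc.2 hab) hr)
  calc _ ≤ _ := pow_le_pow_left' h1 2
    _ ≤ 2 ^ (2 - 1 : ℕ) * (‖φ (L.tube s r θ)‖ₑ ^ 2
          + (∫⁻ t in Ioo a b, ‖fderiv ℝ φ (L.tube s t θ)‖ₑ) ^ 2) := by
        have := ENNReal.rpow_add_le_mul_rpow_add_rpow ‖φ (L.tube s r θ)‖ₑ
          (∫⁻ t in Ioo a b, ‖fderiv ℝ φ (L.tube s t θ)‖ₑ) (p := 2) (by norm_num)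
        norm_num at this ⊢
        exact this
    _ ≤ _ := by
        norm_num
        rw [mul_add]
        gcongr
        exact sq_lintegral_Ioo_le ha hab hm

/-- The surface Jacobian is at most `3ε/2`; this `ε` becomes the `√ε` of the theorem. Periodicity
moves the angular window from `[0, 2π)` to `(-π, π)`, the one used in polar coordinates. -/
lemma lintegral_surf_le {R : ℝ} (hκ : 2 * L.kappaMax * R ≤ 1) {ε : ℝ} (h0 : 0 ≤ ε) (hε : ε < R)
    {h : E3 → ℝ≥0∞} (hh : Measurable h) :
    ∫⁻ x, h x ∂L.surf ε ≤ ENNReal.ofReal (3 / 2 * ε) *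
      ∫⁻ s, (∫⁻ θ in Ioo (-Real.pi) Real.pi, h (L.tube s ε θ)) ∂period := by
  have hc : Continuous fun p : ℝ × ℝ => L.tube p.1 ε p.2 :=
    continuous_tube.comp (by fun_prop : Continuous fun p : ℝ × ℝ => (p.1, ε, p.2))
  have hht : Measurable fun p : ℝ × ℝ => h (L.tube p.1 ε p.2) := hh.comp hc.measurable
  have hj : Measurable fun p : ℝ × ℝ => ENNReal.ofReal (L.jac ε p.1 p.2) := by
    refine Measurable.ennreal_ofReal (Continuous.measurable ?_)
    unfold jac
    have := L.continuous_κ₁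
    have := L.continuous_κ₂
    fun_prop
  have hfd := fun s => (isAddFundamentalDomain_Ioc Real.two_pi_pos 0).setLIntegral_eq
    (isAddFundamentalDomain_Ioc Real.two_pi_pos (-Real.pi)) (fun θ => h (L.tube s ε θ))
    (fun g θ => congrArg h (Function.Periodic.map_vadd_zmultiples
      (f := fun θ => L.tube s ε θ) (fun θ => tube_add_two_pi s ε θ) g θ))
  rw [surf, lintegral_map hh hc.measurable, lintegral_withDensity_eq_lintegral_mul _ hj hht]
  calc _ ≤ ∫⁻ p in Ico (0 : ℝ) 1 ×ˢ Ico (0 : ℝ) (2 * Real.pi),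
        ENNReal.ofReal (3 / 2 * ε) * h (L.tube p.1 ε p.2) := by
        refine lintegral_mono fun p => mul_le_mul' (ENNReal.ofReal_le_ofReal ?_) le_rfl
        have := abs_le.1 (jac_factor_bound (L := L) hκ (s := p.1) (θ := p.2) h0 hε)
        unfold jac
        nlinarith
    _ = _ := by
        rw [lintegral_const_mul _ hht, Measure.volume_eq_prod, ← Measure.prod_restrict,
          lintegral_prod _ hht.aemeasurable, period]
        congr 1
        refine lintegral_congr fun s => ?_
        have := hfd s
        rw [zero_add, show -Real.pi + 2 * Real.pi = Real.pi by ring] at this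
        rw [setLIntegral_congr Ico_ae_eq_Ioc, this, setLIntegral_congr Ioo_ae_eq_Ioc]

/-- The radial estimate is averaged over end radii in `(R/2, R)`. One factor `R/2` is the length of
that interval, the other bounds the polar weight `ρ` from below; keeping both on the left avoids
division. On this shell the weight is at least `1/2`, so the Hardy term absorbs the values of `φ`.
-/
lemma TubeInj.lintegral_tube_sq_le {R : ℝ} (hR : L.TubeInj R) (hκ : 2 * L.kappaMax * R ≤ 1)
    {ε : ℝ} (hε : 0 < ε) (hεR : 4 * ε < R) {φ : E3 → E3} (hφ : ContDiff ℝ 1 φ) :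
    ENNReal.ofReal ((R / 2) ^ 2) * ∫⁻ s, (∫⁻ θ in Ioo (-Real.pi) Real.pi, ‖φ (L.tube s ε θ)‖ₑ ^ 2) ∂period ≤
      8 * (∫⁻ x in L.outer ε, ENNReal.ofReal (‖φ x‖ ^ 2 * weight (L.X 0) x)) +
      ENNReal.ofReal ((R / 2) ^ 2) * (4 * ENNReal.ofReal (Real.log (R / ε)) *
        ∫⁻ x in L.outer ε, ENNReal.ofReal (‖fderiv ℝ φ x‖ ^ 2)) := by
  have hR0 : 0 < R := by linarith
  set l := ENNReal.ofReal (Real.log (R / ε)) with hl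
  set ph : E3 → ℝ≥0∞ := fun x => ‖φ x‖ₑ ^ 2 with hph
  set N : E3 → ℝ≥0∞ := fun x => ‖fderiv ℝ φ x‖ₑ ^ 2 with hN
  have hphm : Measurable ph := hφ.continuous.measurable.enorm.pow_const 2
  have hNm : Measurable N := (hφ.continuous_fderiv one_ne_zero).measurable.enorm.pow_const 2
  have htm : Measurable fun p : ℝ × ℝ × ℝ => L.tube p.1 p.2.1 p.2.2 := continuous_tube.measurable
  have m1 : ∀ s, Measurable fun z : ℝ × ℝ => ENNReal.ofReal z.1 * N (L.tube s z.1 z.2) :=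
    fun s => measurable_polar_integrand hNm s
  have m2 : ∀ s, Measurable fun z : ℝ × ℝ => ph (L.tube s z.1 z.2) := fun s =>
    hphm.comp (htm.comp (by fun_prop : Measurable fun z : ℝ × ℝ => (s, z.1, z.2)))
  have m4 : ∀ s, Measurable fun θ => ∫⁻ t in Ioo ε R, ENNReal.ofReal t * N (L.tube s t θ) :=
    fun s => (m1 s).lintegral_prod_left'
  have hs : ∀ s, ENNReal.ofReal (R / 2) * ∫⁻ θ in Ioo (-Real.pi) Real.pi, ph (L.tube s ε θ) ≤
      2 * (∫⁻ z, ph (L.tube s z.1 z.2) ∂annulus (R / 2) R)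
        + ENNReal.ofReal (R / 2) * (2 * (l *
          ∫⁻ z, ENNReal.ofReal z.1 * N (L.tube s z.1 z.2) ∂annulus ε R)) := fun s => by
    have e0 : ∀ g : ℝ → ℝ≥0∞, Measurable g → ∫⁻ z : ℝ × ℝ, g z.2 ∂annulus (R / 2) R =
        ENNReal.ofReal (R / 2) * ∫⁻ θ in Ioo (-Real.pi) Real.pi, g θ := fun g hg => by
      rw [lintegral_annulus (show Measurable fun z : ℝ × ℝ => g z.2 from hg.comp measurable_snd)]
      dsimp only
      rw [lintegral_const, Measure.restrict_apply_univ, Real.volume_Ioo, mul_comm]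
      ring_nf
    have e1 : ∫⁻ z, ENNReal.ofReal z.1 * N (L.tube s z.1 z.2) ∂annulus ε R =
        ∫⁻ θ in Ioo (-Real.pi) Real.pi, ∫⁻ t in Ioo ε R, ENNReal.ofReal t * N (L.tube s t θ) := by
      rw [annulus, lintegral_prod_symm' _ (m1 s)]
    rw [← e0 (fun θ => ph (L.tube s ε θ))
      (hphm.comp (htm.comp (by fun_prop : Measurable fun θ : ℝ => (s, ε, θ)))), e1]
    calc _ ≤ ∫⁻ z : ℝ × ℝ, (2 * ph (L.tube s z.1 z.2) + 2 * (l *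
          ∫⁻ t in Ioo ε R, ENNReal.ofReal t * N (L.tube s t z.2))) ∂annulus (R / 2) R := by
          refine lintegral_mono_ae ?_
          filter_upwards [ae_annulus (R / 2) R] with z hz
          exact sq_enorm_tube_le hφ s z.2 hε ⟨by linarith [hz.1.1], hz.1.2.le⟩
      _ = _ := by
          rw [lintegral_add_left ((m2 s).const_mul _), lintegral_const_mul' _ _ (by norm_num),
            lintegral_const_mul' _ _ (by norm_num), lintegral_const_mul' _ _ ENNReal.ofReal_ne_top,
            e0 _ (m4 s)]
          ring
  have hB : ∫⁻ s, ∫⁻ z, ENNReal.ofReal z.1 * N (L.tube s z.1 z.2) ∂annulus ε R ∂period ≤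
      2 * ∫⁻ x in L.outer ε, ENNReal.ofReal (‖fderiv ℝ φ x‖ ^ 2) := by
    refine (hR.polar_le_lintegral hκ hε.le hR0.le le_rfl hNm).trans (mul_le_mul' le_rfl ?_)
    refine (lintegral_mono_set fun x hx => hx.1).trans (lintegral_mono fun x => ?_)
    rw [hN, ENNReal.ofReal_pow (norm_nonneg _), ofReal_norm]
  have hA : ENNReal.ofReal (R / 2) *
      ∫⁻ s, ∫⁻ z, ph (L.tube s z.1 z.2) ∂annulus (R / 2) R ∂period ≤
      4 * ∫⁻ x in L.outer ε, ENNReal.ofReal (‖φ x‖ ^ 2 * weight (L.X 0) x) := by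
    calc _ ≤ ∫⁻ s, ∫⁻ z, ENNReal.ofReal z.1 * ph (L.tube s z.1 z.2) ∂annulus (R / 2) R ∂period := by
          rw [← lintegral_const_mul' _ _ ENNReal.ofReal_ne_top]
          refine lintegral_mono fun s => ?_
          dsimp only
          rw [← lintegral_const_mul' _ _ ENNReal.ofReal_ne_top]
          refine lintegral_mono_ae ?_
          filter_upwards [ae_annulus (R / 2) R] with z hz
          exact mul_le_mul' (ENNReal.ofReal_le_ofReal hz.1.1.le) le_rfl
      _ ≤ _ := hR.polar_le_lintegral hκ (by linarith) hR0.le le_rfl hphm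
      _ ≤ 2 * ∫⁻ x in {x | R / 2 < Metric.infDist x (range L.X) ∧
            Metric.infDist x (range L.X) < R},
            2 * ENNReal.ofReal (‖φ x‖ ^ 2 * weight (L.X 0) x) := by
          refine mul_le_mul' le_rfl (setLIntegral_mono' ?_ fun x hx => ?_)
          · exact (measurableSet_lt_infDist (R / 2)).inter (measurableSet_infDist_lt _)
          · have := half_le_weight hκ hR0.le hx.2
            have e : ∀ b : ℝ, 2 * ENNReal.ofReal b = ENNReal.ofReal (2 * b) := fun b => by
              rw [ENNReal.ofReal_mul zero_le_two, ENNReal.ofReal_ofNat]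
            rw [e, hph]
            dsimp only
            rw [← ofReal_norm, ← ENNReal.ofReal_pow (norm_nonneg _)]
            refine ENNReal.ofReal_le_ofReal ?_
            nlinarith [sq_nonneg ‖φ x‖]
      _ ≤ 2 * ∫⁻ x in L.outer ε, 2 * ENNReal.ofReal (‖φ x‖ ^ 2 * weight (L.X 0) x) := by
          refine mul_le_mul' le_rfl (lintegral_mono_set fun x hx => ?_)
          exact lt_trans (by linarith) hx.1
      _ = _ := by
          rw [lintegral_const_mul' _ _ (by norm_num), ← mul_assoc]; norm_num
  have m5 : Measurable fun s => ∫⁻ z, ph (L.tube s z.1 z.2) ∂annulus (R / 2) R :=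
    Measurable.lintegral_prod_right' (f := fun p : ℝ × ℝ × ℝ => ph (L.tube p.1 p.2.1 p.2.2))
      (hphm.comp htm)
  rw [sq, ENNReal.ofReal_mul (by positivity)]
  set c := ENNReal.ofReal (R / 2) with hc
  calc _ = c * ∫⁻ s, (c * ∫⁻ θ in Ioo (-Real.pi) Real.pi, ph (L.tube s ε θ)) ∂period := by
        rw [lintegral_const_mul' _ _ ENNReal.ofReal_ne_top, mul_assoc]
    _ ≤ c * ∫⁻ s, (2 * (∫⁻ z, ph (L.tube s z.1 z.2) ∂annulus (R / 2) R)
        + c * (2 * (l * ∫⁻ z, ENNReal.ofReal z.1 * N (L.tube s z.1 z.2) ∂annulus ε R))) ∂period :=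
        mul_le_mul' le_rfl (lintegral_mono hs)
    _ = 2 * (c * ∫⁻ s, ∫⁻ z, ph (L.tube s z.1 z.2) ∂annulus (R / 2) R ∂period)
        + c * c * (2 * l * ∫⁻ s, ∫⁻ z, ENNReal.ofReal z.1 * N (L.tube s z.1 z.2)
          ∂annulus ε R ∂period) := by
        rw [lintegral_add_left (m5.const_mul _), lintegral_const_mul' _ _ (by norm_num),
          lintegral_const_mul' _ _ ENNReal.ofReal_ne_top, lintegral_const_mul' _ _ (by norm_num),
          lintegral_const_mul' _ _ ENNReal.ofReal_ne_top]
        ring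
    _ ≤ 2 * (4 * ∫⁻ x in L.outer ε, ENNReal.ofReal (‖φ x‖ ^ 2 * weight (L.X 0) x))
        + c * c * (2 * l * (2 * ∫⁻ x in L.outer ε, ENNReal.ofReal (‖fderiv ℝ φ x‖ ^ 2))) :=
        add_le_add (mul_le_mul' le_rfl hA) (mul_le_mul' le_rfl (mul_le_mul' le_rfl hB))
    _ = _ := by ring

/-- The trace inequality for smooth functions. -/
lemma exists_lintegral_surf_le : ∃ C : ℝ, 0 < C ∧ ∀ (L : FramedLoop) (R : ℝ), L.TubeInj R →
    2 * L.kappaMax * R ≤ 1 → ∀ ε : ℝ, 0 < ε → 4 * ε < R → ∀ φ : E3 → E3, ContDiff ℝ 1 φ →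
    HasCompactSupport φ →
    ∫⁻ x, ‖φ x‖ₑ ^ 2 ∂L.surf ε ≤ ENNReal.ofReal (C * ε * (1 / R ^ 2 + Real.log (R / ε))) *
      ∫⁻ x in L.outer ε, ENNReal.ofReal (‖fderiv ℝ φ x‖ ^ 2) := by
  obtain ⟨C, hC, h⟩ := exists_lintegral_outer_sq_le
  -- `6 = (3/2) · 4` multiplies the logarithm and `48 C = (3/2) · 8 C · 4` multiplies `1/R²`, as
  -- `(R/2)² = R²/4`.
  refine ⟨6 + 48 * C, by positivity, fun L R hR hκ ε hε hεR φ hφ hφc => ?_⟩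
  have hR0 : 0 < R := by linarith
  have h1 := hR.lintegral_tube_sq_le hκ hε hεR hφ
  have h2 := h L R hR hκ ε hε hεR φ hφ hφc
  have hlog : 0 ≤ Real.log (R / ε) := Real.log_nonneg (by rw [le_div_iff₀ hε]; linarith)
  set D := ∫⁻ x in L.outer ε, ENNReal.ofReal (‖fderiv ℝ φ x‖ ^ 2) with hD
  set S := ∫⁻ s, (∫⁻ θ in Ioo (-Real.pi) Real.pi, ‖φ (L.tube s ε θ)‖ₑ ^ 2) ∂period with hS
  set q : ℝ := (R / 2) ^ 2 with hq
  have hq0 : 0 < q := by positivity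
  have h3 : S ≤ ENNReal.ofReal (8 * C / q + 4 * Real.log (R / ε)) * D := by
    refine (ENNReal.mul_le_mul_iff_right (a := ENNReal.ofReal q) (by simpa using hq0)
      ENNReal.ofReal_ne_top).1 (h1.trans ?_)
    calc _ ≤ 8 * (ENNReal.ofReal C * D) + ENNReal.ofReal q *
          (4 * ENNReal.ofReal (Real.log (R / ε)) * D) := by gcongr
      _ = _ := by
          rw [← mul_assoc (ENNReal.ofReal q) (ENNReal.ofReal (8 * C / q + 4 * Real.log (R / ε))) D, ← ENNReal.ofReal_mul hq0.le,
            show q * (8 * C / q + 4 * Real.log (R / ε)) = 8 * C + q * (4 * Real.log (R / ε)) by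
              field_simp,
            ENNReal.ofReal_add (by positivity) (by positivity), ENNReal.ofReal_mul hq0.le,
            ENNReal.ofReal_mul (by norm_num), ENNReal.ofReal_mul (by norm_num),
            ENNReal.ofReal_ofNat, ENNReal.ofReal_ofNat]
          ring
  calc _ ≤ _ := lintegral_surf_le hκ hε.le (by linarith) (hφ.continuous.measurable.enorm.pow_const 2)
    _ ≤ ENNReal.ofReal (3 / 2 * ε) * (ENNReal.ofReal (8 * C / q + 4 * Real.log (R / ε)) * D) := by
        gcongr
    _ ≤ _ := by
        rw [← mul_assoc, ← ENNReal.ofReal_mul (by positivity)]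
        refine mul_le_mul' (ENNReal.ofReal_le_ofReal ?_) le_rfl
        have e : 3 / 2 * ε * (8 * C / q + 4 * Real.log (R / ε))
            = 48 * C * ε * (1 / R ^ 2) + 6 * ε * Real.log (R / ε) := by
          rw [hq]; field_simp; ring
        rw [e]
        have : 0 ≤ C * ε * Real.log (R / ε) := by positivity
        have : 0 ≤ ε * (1 / R ^ 2) := by positivity
        nlinarith

end FramedLoop

/-! ### The interior cone condition for closed tubes. -/

/-- Every point of `U ∩ K` is the vertex of a cone of fixed shape contained in `K`. -/
def ConeOn (K U : Set E3) : Prop :=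
  ∃ (n : E3) (c t₀ : ℝ), 0 < c ∧ 0 < t₀ ∧ ∀ y ∈ U, y ∈ K → ∀ w : E3, ‖w‖ ≤ c →
    ∀ t : ℝ, 0 < t → t < t₀ → y - t • (n + w) ∈ K

namespace FramedLoop

variable {L : FramedLoop}

/-- Inside the tube the foot of `x` is unique, so by compactness the part of the curve away from
that foot is farther from `x` by a definite amount. This keeps the feet of points near `x` from
jumping. -/
lemma TubeInj.exists_infDist_ge {R : ℝ} (hR : L.TubeInj R) {x : E3} {s₀ : ℝ}
    (hs₀ : Metric.infDist x (range L.X) = dist x (L.X s₀)) (hx : Metric.infDist x (range L.X) < R)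
    {r : ℝ} (hr : 0 < r) : ∃ δ > 0, ∀ s, r ≤ dist (L.X s) (L.X s₀) →
      Metric.infDist x (range L.X) + δ ≤ dist x (L.X s) := by
  set Γ : Set E3 := range L.X \ Metric.ball (L.X s₀) r with hΓ
  have hΓc : IsCompact Γ := L.isCompact_range_X.diff Metric.isOpen_ball
  rcases Γ.eq_empty_or_nonempty with he | hne
  · refine ⟨1, one_pos, fun s hs => ?_⟩
    have : L.X s ∈ Γ := ⟨mem_range_self s, by simpa [Metric.mem_ball] using hs⟩
    rw [he] at this; exact this.elim
  obtain ⟨_, ⟨⟨s₁, rfl⟩, hs₁r⟩, hs₁⟩ := hΓc.exists_infDist_eq_dist hne x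
  have hle : Metric.infDist x (range L.X) ≤ dist x (L.X s₁) :=
    Metric.infDist_le_dist_of_mem (mem_range_self s₁)
  have hlt : Metric.infDist x (range L.X) < dist x (L.X s₁) := by
    refine lt_of_le_of_ne hle fun he => hs₁r ?_
    obtain ⟨θ₀, h0⟩ := L.exists_tube_of_infDist_eq hs₀
    obtain ⟨θ₁, h1⟩ := L.exists_tube_of_infDist_eq he
    obtain ⟨k, hk⟩ := hR _ _ _ _ _ _ Metric.infDist_nonneg hx Metric.infDist_nonneg hx (h0.symm.trans h1)
    rw [hk, X_add_int]
    exact Metric.mem_ball_self hr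
  refine ⟨_, sub_pos.2 hlt, fun s hs => ?_⟩
  rw [add_sub_cancel, ← hs₁]
  exact Metric.infDist_le_dist_of_mem ⟨mem_range_self s, by simpa [Metric.mem_ball] using hs⟩

/-- In the expanded square the linear term is at most `-tε`, which beats the quadratic term `(25/16)
t²` as long as `t < ε/4`. -/
lemma norm_sub_smul_sq_le {v n w : E3} {ε t : ℝ} (hε : 0 < ε) (hn : ‖n‖ = 1) (hw : ‖w‖ ≤ 1 / 4)
    (hv : ‖v‖ ≤ ε) (hvn : ‖v - ε • n‖ ≤ ε / 4) (ht : 0 < t) (htε : t < ε / 4) :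
    ‖v - t • (n + w)‖ ≤ ε := by
  have h1 : ‖n + w‖ ≤ 5 / 4 := (norm_add_le _ _).trans (by rw [hn]; linarith)
  have h2 : ⟪v, n⟫ = ε + ⟪v - ε • n, n⟫ := by
    rw [inner_sub_left, inner_smul_left, real_inner_self_eq_norm_sq, hn]; simp
  have h3 := abs_le.1 (abs_real_inner_le_norm (v - ε • n) n)
  have h4 := abs_le.1 (abs_real_inner_le_norm v w)
  rw [hn, mul_one] at h3
  have h5 : ‖v‖ * ‖w‖ ≤ ε * (1 / 4) := mul_le_mul hv hw (norm_nonneg _) hε.le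
  have h6 : ‖v - t • (n + w)‖ ^ 2 = ‖v‖ ^ 2 - 2 * t * (⟪v, n⟫ + ⟪v, w⟫) + t ^ 2 * ‖n + w‖ ^ 2 := by
    rw [norm_sub_sq_real, inner_smul_right, inner_add_right, norm_smul, Real.norm_of_nonneg ht.le]
    ring
  have h7 : ε / 2 ≤ ⟪v, n⟫ + ⟪v, w⟫ := by linarith [h3.1, h4.1]
  have h8 : ‖n + w‖ ^ 2 ≤ 25 / 16 := by nlinarith [norm_nonneg (n + w)]
  have h9 : ‖v‖ ^ 2 ≤ ε ^ 2 := pow_le_pow_left₀ (norm_nonneg _) hv 2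
  refine le_of_sq_le_sq ?_ hε.le
  rw [h6]
  have h10 : t ^ 2 * ‖n + w‖ ^ 2 ≤ t ^ 2 * (25 / 16) := by gcongr
  nlinarith

/-- Closed tubes satisfy a uniform interior cone condition locally. -/
lemma TubeInj.exists_coneOn {R : ℝ} (hR : L.TubeInj R) {ε : ℝ} (hε : 0 < ε) (hεR : ε < R) (x : E3) :
    ∃ U : Set E3, IsOpen U ∧ x ∈ U ∧ ConeOn (L.outer ε)ᶜ U := by
  have hmem : ∀ y : E3, y ∈ (L.outer ε)ᶜ ↔ Metric.infDist y (range L.X) ≤ ε := fun y => by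
    rw [mem_compl_iff, outer, Set.mem_ofPred_eq, not_lt]
  -- In the open tube any small displacement is allowed, and outside the closed tube the condition
  -- is vacuous near `x`. Only boundary points need an argument: there the axis is the outward
  -- normal at `x`, which almost agrees with the direction from a nearby foot to a nearby point.
  rcases lt_trichotomy (Metric.infDist x (range L.X)) ε with hx | hx | hx
  · set δ := (ε - Metric.infDist x (range L.X)) / 2 with hδ
    have hδ0 : 0 < δ := by rw [hδ]; linarith
    refine ⟨Metric.ball x δ, Metric.isOpen_ball, Metric.mem_ball_self hδ0, 0, 1, δ, one_pos, hδ0, ?_⟩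
    intro y hy _ w hw t ht htδ
    rw [hmem, zero_add]
    have h1 : dist (y - t • w) x ≤ 2 * δ := by
      have h2 : dist (y - t • w) y ≤ δ := by
        rw [dist_eq_norm, sub_sub_cancel_left, norm_neg, norm_smul, Real.norm_of_nonneg ht.le]
        nlinarith [norm_nonneg w]
      linarith [dist_triangle (y - t • w) y x, Metric.mem_ball.1 hy]
    have h3 := Metric.infDist_le_infDist_add_dist (s := range L.X) (x := y - t • w) (y := x)
    linarith
  · obtain ⟨s₀, hs₀⟩ := L.exists_infDist_eq x
    obtain ⟨δ, hδ, h⟩ := hR.exists_infDist_ge hs₀ (by rwa [hx]) (r := ε / 8) (by positivity)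
    set r := min δ (ε / 8) with hr
    have hr0 : 0 < r := lt_min hδ (by positivity)
    refine ⟨Metric.ball x r, Metric.isOpen_ball, Metric.mem_ball_self hr0, ε⁻¹ • (x - L.X s₀), 1 / 4,
      ε / 4, by norm_num, by positivity, ?_⟩
    intro y hy hyK w hw t ht htε
    rw [hmem] at hyK ⊢
    have hyx : dist y x < r := hy
    obtain ⟨s, hs⟩ := L.exists_infDist_eq y
    have hss : dist (L.X s) (L.X s₀) < ε / 8 := by
      by_contra hge
      have h1 := h s (not_lt.1 hge)
      have h2 := dist_triangle x y (L.X s)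
      rw [dist_comm x y] at h2
      have h3 : dist y (L.X s) ≤ ε := hs ▸ hyK
      linarith [min_le_left δ (ε / 8)]
    have hn : ‖ε⁻¹ • (x - L.X s₀)‖ = 1 := by
      rw [norm_smul, ← dist_eq_norm, ← hs₀, hx, norm_inv, Real.norm_of_nonneg hε.le,
        inv_mul_cancel₀ hε.ne']
    have key := norm_sub_smul_sq_le (v := y - L.X s) hε hn hw
      (by rw [← dist_eq_norm, ← hs]; exact hyK) (by
        rw [smul_inv_smul₀ hε.ne', show y - L.X s - (x - L.X s₀) = (y - x) - (L.X s - L.X s₀) by abel]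
        refine (norm_sub_le _ _).trans ?_
        rw [← dist_eq_norm, ← dist_eq_norm]
        linarith [min_le_right δ (ε / 8)]) ht htε
    refine (Metric.infDist_le_dist_of_mem (mem_range_self s)).trans ?_
    rwa [dist_eq_norm, sub_right_comm]
  · refine ⟨L.outer ε, isOpen_lt continuous_const (Metric.continuous_infDist_pt _), hx, 0, 1, 1,
      one_pos, one_pos, fun y hy hyK => (hyK hy).elim⟩

end FramedLoop

/-! ### Density of smooth compactly supported functions under the cone condition. -/

lemma tendsto_eLpNorm_translate_sub {p : ℝ≥0∞} (h1 : 1 ≤ p) (hp : p ≠ ⊤) {F : E3 → E3}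
    (hF : MemLp F p volume) :
    Tendsto (fun z : E3 => eLpNorm (fun x => F (z + x) - F x) p volume) (𝓝 0) (𝓝 0) := by
  have : Fact (1 ≤ p) := ⟨h1⟩
  have : Fact (p ≠ ⊤) := ⟨hp⟩
  have hc : Continuous fun z : E3 => DomAddAct.mk z +ᵥ hF.toLp F := by
    exact (continuous_vadd (M := DomAddAct E3) (X := Lp E3 p volume)).comp
      ((DomAddAct.continuous_mk (M := E3)).prodMk continuous_const)
  have h0 := hc.tendsto 0
  have e0 : DomAddAct.mk (0 : E3) +ᵥ hF.toLp F = hF.toLp F := by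
    rw [DomAddAct.mk_vadd_toLp]
    congr 1
    ext x
    simp
  rw [e0] at h0
  simp_rw [DomAddAct.mk_vadd_toLp] at h0
  rw [Lp.tendsto_Lp_iff_tendsto_eLpNorm''] at h0
  exact h0

lemma rpow_lintegral_le {α : Type*} [MeasurableSpace α] {ν : Measure α} [IsProbabilityMeasure ν]
    {f : α → E3} (hf : AEStronglyMeasurable f ν) {q : ℝ} (hq : 1 ≤ q) :
    (∫⁻ z, ‖f z‖ₑ ∂ν) ^ q ≤ ∫⁻ z, ‖f z‖ₑ ^ q ∂ν := by
  have := eLpNorm'_le_eLpNorm'_of_exponent_le (μ := ν) one_pos hq hf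
  have hq0 : 0 < q := by linarith
  simp only [eLpNorm', ENNReal.rpow_one, div_one] at this
  calc _ ≤ _ := ENNReal.rpow_le_rpow this hq0.le
    _ = _ := by rw [← ENNReal.rpow_mul, one_div, inv_mul_cancel₀ hq0.ne', ENNReal.rpow_one]

/-- With `k dz` as a probability measure, `k ⋆ F - F` is an average of translation differences;
Jensen and Tonelli conclude. The kernel need not be centred at the origin, which matters because it
will be shifted into a cone. Strong measurability of `F` serves the joint measurability in Tonelli,
and the next lemma removes it. -/
lemma eLpNorm_convolution_sub_le_of_stronglyMeasurable {p : ℝ≥0∞} (h1 : 1 ≤ p) (hp : p ≠ ⊤)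
    {F : E3 → E3} (hFm : StronglyMeasurable F) (hF : MemLp F p volume) {k : E3 → ℝ}
    (hkc : Continuous k) (hks : HasCompactSupport k) (hk0 : ∀ z, 0 ≤ k z) (hk1 : ∫ z, k z = 1)
    {δ : ℝ≥0∞} (hδ : ∀ z, k z ≠ 0 → eLpNorm (fun x => F (-z + x) - F x) p volume ≤ δ) :
    eLpNorm (fun x => (k ⋆[ContinuousLinearMap.lsmul ℝ ℝ, volume] F) x - F x) p volume ≤ δ := by
  have hp0 : p ≠ 0 := (zero_lt_one.trans_le h1).ne'
  set q := p.toReal with hq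
  have hq1 : 1 ≤ q := by
    rw [hq, ← ENNReal.toReal_one]; exact ENNReal.toReal_mono hp h1
  have hq0 : 0 < q := by linarith
  set κ : E3 → ℝ≥0∞ := fun z => ENNReal.ofReal (k z) with hκ
  have hκm : Measurable κ := hkc.measurable.ennreal_ofReal
  have hki : Integrable k := hkc.integrable_of_hasCompactSupport hks
  set ν : Measure E3 := volume.withDensity κ with hν
  have hν1 : IsProbabilityMeasure ν := ⟨by
    rw [hν, withDensity_apply _ MeasurableSet.univ, Measure.restrict_univ,
      ← ofReal_integral_eq_lintegral_ofReal hki (Eventually.of_forall hk0), hk1, ENNReal.ofReal_one]⟩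
  have hdm : StronglyMeasurable fun q : E3 × E3 => F (q.1 - q.2) - F q.1 :=
    (hFm.comp_measurable (measurable_fst.sub measurable_snd)).sub (hFm.comp_measurable measurable_fst)
  have hpt : ∀ x, ‖(k ⋆[ContinuousLinearMap.lsmul ℝ ℝ, volume] F) x - F x‖ₑ ^ q ≤
      ∫⁻ z, ‖F (x - z) - F x‖ₑ ^ q ∂ν := fun x => by
    have hex : Integrable fun z => k z • F (x - z) :=
      (hks.convolutionExists_left (ContinuousLinearMap.lsmul ℝ ℝ) hkc
        (hF.locallyIntegrable h1) x)
    have e : (k ⋆[ContinuousLinearMap.lsmul ℝ ℝ, volume] F) x - F x =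
        ∫ z, k z • (F (x - z) - F x) := by
      simp_rw [smul_sub]
      rw [integral_sub hex (hki.smul_const _), integral_smul_const, hk1, one_smul]
      rfl
    have hsm : StronglyMeasurable fun z => F (x - z) - F x :=
      hdm.comp_measurable (measurable_const.prodMk measurable_id)
    refine le_trans (ENNReal.rpow_le_rpow ?_ hq0.le) (rpow_lintegral_le hsm.aestronglyMeasurable hq1)
    rw [e]
    refine (enorm_integral_le_lintegral_enorm _).trans ?_
    rw [hν, lintegral_withDensity_eq_lintegral_mul _ hκm hsm.enorm]
    refine lintegral_mono fun z => ?_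
    rw [enorm_smul, Pi.mul_apply, Real.enorm_of_nonneg (hk0 z)]
  rw [eLpNorm_eq_lintegral_rpow_enorm_toReal hp0 hp, ← hq]
  calc _ ≤ (∫⁻ x, ∫⁻ z, ‖F (x - z) - F x‖ₑ ^ q ∂ν) ^ (1 / q) :=
        ENNReal.rpow_le_rpow (lintegral_mono hpt) (by positivity)
    _ = (∫⁻ z, (∫⁻ x, ‖F (x - z) - F x‖ₑ ^ q) ∂ν) ^ (1 / q) := by
        rw [lintegral_lintegral_swap]
        exact (hdm.enorm.pow_const q).aemeasurable
    _ ≤ (∫⁻ _, δ ^ q ∂ν) ^ (1 / q) := by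
        refine ENNReal.rpow_le_rpow ?_ (by positivity)
        refine lintegral_mono_ae ?_
        rw [hν, ae_withDensity_iff hκm]
        refine Eventually.of_forall fun z hz => ?_
        have hz' : k z ≠ 0 := fun h0 => hz (by rw [hκ]; simp [h0])
        have := hδ z hz'
        rw [eLpNorm_eq_lintegral_rpow_enorm_toReal hp0 hp, ← hq, one_div,
          ENNReal.rpow_inv_le_iff hq0] at this
        simpa only [neg_add_eq_sub] using this
    _ = δ := by
        rw [lintegral_const, measure_univ, mul_one, ← ENNReal.rpow_mul, mul_one_div_cancel hq0.ne',
          ENNReal.rpow_one]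

lemma eLpNorm_convolution_sub_le {p : ℝ≥0∞} (h1 : 1 ≤ p) (hp : p ≠ ⊤)
    {F : E3 → E3} (hF : MemLp F p volume) {k : E3 → ℝ}
    (hkc : Continuous k) (hks : HasCompactSupport k) (hk0 : ∀ z, 0 ≤ k z) (hk1 : ∫ z, k z = 1)
    {δ : ℝ≥0∞} (hδ : ∀ z, k z ≠ 0 → eLpNorm (fun x => F (-z + x) - F x) p volume ≤ δ) :
    eLpNorm (fun x => (k ⋆[ContinuousLinearMap.lsmul ℝ ℝ, volume] F) x - F x) p volume ≤ δ := by
  set F' := hF.1.mk F with hF'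
  have hae : F =ᵐ[volume] F' := hF.1.ae_eq_mk
  have hconv : k ⋆[ContinuousLinearMap.lsmul ℝ ℝ, volume] F =
      k ⋆[ContinuousLinearMap.lsmul ℝ ℝ, volume] F' :=
    convolution_congr _ (ae_eq_refl k) hae
  have h := eLpNorm_convolution_sub_le_of_stronglyMeasurable h1 hp hF.1.stronglyMeasurable_mk
    ((memLp_congr_ae hae).1 hF) hkc hks hk0 hk1 (δ := δ) fun z hz => by
      refine le_of_eq_of_le (eLpNorm_congr_ae ?_) (hδ z hz)
      have h2 := (measurePreserving_add_left volume (-z)).quasiMeasurePreserving.ae_eq_comp hae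
      filter_upwards [hae, h2] with x hx hx2
      simp only [Function.comp_apply] at hx2
      rw [hx, hx2]
  refine le_of_eq_of_le (eLpNorm_congr_ae ?_) h
  filter_upwards [hae] with x hx
  rw [hconv, hx]

/-- The `j`-th coordinate unit vector. -/
abbrev unitVec (j : Fin 3) : E3 := EuclideanSpace.single j 1

/-- Approximability in `D^{1,2}(Ω)` by smooth compactly supported functions on space. -/
def SmoothApprox (Ω : Set E3) (u : E3 → E3) (G : Fin 3 → E3 → E3) : Prop :=
  ∀ δ : ℝ≥0∞, 0 < δ → ∃ φ : E3 → E3, ContDiff ℝ ∞ φ ∧ HasCompactSupport φ ∧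
    eLpNorm (fun x => φ x - u x) 6 (volume.restrict Ω) ≤ δ ∧
    ∀ j, eLpNorm (fun x => fderiv ℝ φ x (unitVec j) - G j x) 2 (volume.restrict Ω) ≤ δ

/-- `1/3 + 1/6 = 1/2`: derivatives of cutoffs in `L³` times `u ∈ L⁶` land in `L²`. -/
instance : ENNReal.HolderTriple 3 6 2 where
  inv_add_inv_eq_inv := by
    rw [← ENNReal.toReal_eq_toReal_iff' (by finiteness) (by finiteness),
      ENNReal.toReal_add (by finiteness) (by finiteness)]
    norm_num

lemma memLp_smul_of_hasCompactSupport {μ : Measure E3} {p : ℝ≥0∞} {m : E3 → ℝ} (hm : Continuous m)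
    (hmc : HasCompactSupport m) {f : E3 → E3} (hf : MemLp f p μ) :
    MemLp (fun x => m x • f x) p μ := by
  obtain ⟨C, hC⟩ := hm.bounded_above_of_compact_support hmc
  refine hf.of_le_mul (c := C) (hm.aestronglyMeasurable.smul hf.1) (Eventually.of_forall fun x => ?_)
  rw [norm_smul]
  exact mul_le_mul_of_nonneg_right (hC x) (norm_nonneg _)

lemma memLp_two_smul_of_hasCompactSupport {Ω : Set E3} {m : E3 → ℝ} (hm : Continuous m)
    (hmc : HasCompactSupport m) {f : E3 → E3} (hf : MemLp f 6 (volume.restrict Ω)) :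
    MemLp (fun x => m x • f x) 2 (volume.restrict Ω) :=
  hf.smul (hm.memLp_of_hasCompactSupport hmc : MemLp m 3 (volume.restrict Ω))

lemma integrable_smul_of_memLp {Ω : Set E3} {p : ℝ≥0∞} (hp : 1 ≤ p) {a : E3 → ℝ} (ha : Continuous a)
    (hac : HasCompactSupport a) {f : E3 → E3} (hf : MemLp f p (volume.restrict Ω)) :
    Integrable (fun x => a x • f x) (volume.restrict Ω) :=
  (hf.locallyIntegrable hp).integrable_smul_left_of_hasCompactSupport ha hac

lemma fderiv_convolution_apply {k : E3 → ℝ} (hk : ContDiff ℝ ∞ k) (hks : HasCompactSupport k)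
    {v : E3 → E3} (hv : LocallyIntegrable v) (x e : E3) :
    fderiv ℝ (k ⋆[ContinuousLinearMap.lsmul ℝ ℝ, volume] v) x e =
      ∫ y, fderiv ℝ k (x - y) e • v y := by
  rw [(hks.hasFDerivAt_convolution_left _ (hk.of_le (by exact_mod_cast le_top)) hv x).fderiv]
  have hex := (hks.fderiv ℝ).convolutionExists_left
    ((ContinuousLinearMap.lsmul ℝ ℝ : ℝ →L[ℝ] E3 →L[ℝ] E3).precompL E3)
    (hk.continuous_fderiv (by simp)) hv x
  rw [convolution_def, ContinuousLinearMap.integral_apply hex,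
    ← integral_sub_left_eq_self _ volume x]
  refine integral_congr_ae (Eventually.of_forall fun y => ?_)
  simp [ContinuousLinearMap.precompL_apply]

/-- The mollification of a localized function commutes with weak differentiation on `Ω`, if the
supports of the translated kernels stay in `Ω`. -/
lemma fderiv_convolution_indicator {Ω : Set E3} (hΩ : MeasurableSet Ω) {u : E3 → E3}
    {G : Fin 3 → E3 → E3} (h : IsD12 Ω u G) {m : E3 → ℝ} (hm : ContDiff ℝ ∞ m)
    (hmc : HasCompactSupport m) {k : E3 → ℝ} (hk : ContDiff ℝ ∞ k) (hks : HasCompactSupport k)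
    {x : E3} (hx : ∀ y ∈ tsupport m, x - y ∈ tsupport k → y ∈ Ω) (j : Fin 3) :
    fderiv ℝ (k ⋆[ContinuousLinearMap.lsmul ℝ ℝ, volume] Ω.indicator fun y => m y • u y) x
        (unitVec j) =
      (k ⋆[ContinuousLinearMap.lsmul ℝ ℝ, volume] Ω.indicator fun y =>
        m y • G j y + fderiv ℝ m y (unitVec j) • u y) x := by
  -- The test function for the weak derivative. The support hypothesis places it inside `Ω`, so
  -- extending by zero across the boundary creates no boundary term.
  set ψ : E3 → ℝ := fun y => k (x - y) * m y with hψ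
  have hkx : ContDiff ℝ ∞ fun y => k (x - y) := hk.comp (contDiff_const.sub contDiff_id)
  have hψs : ContDiff ℝ ∞ ψ := hkx.mul hm
  have hψc : HasCompactSupport ψ := hmc.mul_left
  have hts : tsupport ψ ⊆ Ω := fun y hy => by
    refine hx y (tsupport_mul_subset_right hy) ?_
    have h1 : tsupport (fun y => k (x - y)) ⊆ (fun y => x - y) ⁻¹' tsupport k :=
      closure_minimal (fun z hz => subset_tsupport k hz)
        ((isClosed_tsupport k).preimage (by fun_prop))
    exact h1 (tsupport_mul_subset_left hy)
  have hw := h.weakGrad ψ hψs hψc hts j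
  have hdk : ∀ y, HasFDerivAt (fun y => k (x - y)) (-fderiv ℝ k (x - y)) y := fun y => by
    have h1 := (hk.differentiable (by simp) (x - y)).hasFDerivAt
    have h2 : HasFDerivAt (fun y : E3 => x - y) (-ContinuousLinearMap.id ℝ E3) y :=
      (hasFDerivAt_id y).const_sub x
    refine (h1.comp y h2).congr_fderiv ?_
    ext; simp
  have hdψ : ∀ y, fderiv ℝ ψ y (unitVec j) =
      k (x - y) * fderiv ℝ m y (unitVec j) - fderiv ℝ k (x - y) (unitVec j) * m y := fun y => by
    have h1 : fderiv ℝ ψ y = _ := ((hdk y).mul (hm.differentiable (by simp) y).hasFDerivAt).fderiv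
    rw [h1]
    simp
    ring
  have cm := hm.continuous
  have cdm : Continuous fun y => fderiv ℝ m y (unitVec j) :=
    (hm.continuous_fderiv (by simp)).clm_apply continuous_const
  have cdk : Continuous fun y => fderiv ℝ k (x - y) (unitVec j) :=
    ((hk.continuous_fderiv (by simp)).comp (by fun_prop)).clm_apply continuous_const
  have i1 : Integrable (fun y => (k (x - y) * fderiv ℝ m y (unitVec j)) • u y)
      (volume.restrict Ω) :=
    integrable_smul_of_memLp (by norm_num) (hkx.continuous.mul cdm)
      ((hmc.fderiv_apply ℝ (unitVec j)).mul_left) h.memLp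
  have i2 : Integrable (fun y => (fderiv ℝ k (x - y) (unitVec j) * m y) • u y)
      (volume.restrict Ω) :=
    integrable_smul_of_memLp (by norm_num) (cdk.mul cm) hmc.mul_left h.memLp
  have i3 : Integrable (fun y => (k (x - y) * m y) • G j y) (volume.restrict Ω) :=
    integrable_smul_of_memLp (by norm_num) (hkx.continuous.mul cm) hmc.mul_left (h.memLp_grad j)
  have hv : MemLp (Ω.indicator fun y => m y • u y) 6 volume :=
    (memLp_indicator_iff_restrict hΩ).2 (memLp_smul_of_hasCompactSupport cm hmc h.memLp)
  rw [fderiv_convolution_apply hk hks (hv.locallyIntegrable (by norm_num)), convolution_lsmul_swap]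
  have e1 : ∀ (a : E3 → ℝ) (f : E3 → E3), ∫ y, a y • Ω.indicator f y = ∫ y in Ω, a y • f y :=
    fun a f => by
      rw [← integral_indicator hΩ]
      refine integral_congr_ae (Eventually.of_forall fun y => ?_)
      by_cases hy : y ∈ Ω <;> simp [hy]
  rw [e1, e1]
  have e2 : ∫ y in Ω, fderiv ℝ ψ y (unitVec j) • u y =
      (∫ y in Ω, (k (x - y) * fderiv ℝ m y (unitVec j)) • u y)
        - ∫ y in Ω, (fderiv ℝ k (x - y) (unitVec j) * m y) • u y := by
    rw [← integral_sub i1 i2]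
    refine integral_congr_ae (Eventually.of_forall fun y => ?_)
    dsimp only
    rw [hdψ, sub_smul]
  have e3 : ∫ y in Ω, k (x - y) • (m y • G j y + fderiv ℝ m y (unitVec j) • u y) =
      (∫ y in Ω, (k (x - y) * m y) • G j y)
        + ∫ y in Ω, (k (x - y) * fderiv ℝ m y (unitVec j)) • u y := by
    rw [← integral_add i3 i1]
    refine integral_congr_ae (Eventually.of_forall fun y => ?_)
    dsimp only
    rw [smul_add, smul_smul, smul_smul]
  have e4 : ∫ y in Ω, fderiv ℝ k (x - y) (unitVec j) • m y • u y =
      ∫ y in Ω, (fderiv ℝ k (x - y) (unitVec j) * m y) • u y := by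
    simp_rw [smul_smul]
  rw [e3, e4]
  rw [e2] at hw
  have alg : ∀ a b p : E3, a - b = -p → b = p + a := fun a b p h => by
    rw [sub_eq_iff_eq_add] at h
    rw [h]; abel
  exact alg _ _ _ hw

/-- Approximation of localized functions under a cone condition on the complement. -/
lemma smoothApprox_of_coneOn {Ω U : Set E3} (hΩ : IsOpen Ω) (hU : ConeOn Ωᶜ U) {u : E3 → E3}
    {G : Fin 3 → E3 → E3} (h : IsD12 Ω u G) {m : E3 → ℝ} (hm : ContDiff ℝ ∞ m)
    (hmc : HasCompactSupport m) (hmU : tsupport m ⊆ U) :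
    SmoothApprox Ω (fun x => m x • u x) fun j x =>
      m x • G j x + fderiv ℝ m x (unitVec j) • u x := by
  intro δ hδ
  obtain ⟨n, c, t₀, hc, ht₀, hcone⟩ := hU
  set v := Ω.indicator fun y => m y • u y with hvdef
  set H := fun j => Ω.indicator fun y => m y • G j y + fderiv ℝ m y (unitVec j) • u y with hHdef
  have cdm : ∀ j, Continuous fun y => fderiv ℝ m y (unitVec j) := fun j =>
    (hm.continuous_fderiv (by simp)).clm_apply continuous_const
  have hv : MemLp v 6 volume := (memLp_indicator_iff_restrict hΩ.measurableSet).2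
    (memLp_smul_of_hasCompactSupport hm.continuous hmc h.memLp)
  have hH : ∀ j, MemLp (H j) 2 volume := fun j => (memLp_indicator_iff_restrict hΩ.measurableSet).2
    ((memLp_smul_of_hasCompactSupport hm.continuous hmc (h.memLp_grad j)).add
      (memLp_two_smul_of_hasCompactSupport (cdm j) (hmc.fderiv_apply ℝ _) h.memLp))
  have hev : ∀ᶠ z : E3 in 𝓝 0, eLpNorm (fun x => v (z + x) - v x) 6 volume < δ ∧
      ∀ j, eLpNorm (fun x => H j (z + x) - H j x) 2 volume < δ :=
    ((tendsto_eLpNorm_translate_sub (by norm_num) (by norm_num) hv).eventually_lt_const hδ).and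
      (eventually_all.2 fun j =>
        (tendsto_eLpNorm_translate_sub (by norm_num) (by norm_num) (hH j)).eventually_lt_const hδ)
  obtain ⟨r, hr, hball⟩ := Metric.eventually_nhds_iff.1 hev
  obtain ⟨t, ht, htt₀, htr⟩ : ∃ t : ℝ, 0 < t ∧ t < t₀ ∧ t * (‖n‖ + c) < r := by
    have hs : 0 < ‖n‖ + c := by positivity
    refine ⟨min (t₀ / 2) (r / (2 * (‖n‖ + c))), by positivity, ?_, ?_⟩
    · exact (min_le_left _ _).trans_lt (by linarith)
    · calc _ ≤ r / (2 * (‖n‖ + c)) * (‖n‖ + c) := by gcongr; exact min_le_right _ _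
        _ = r / 2 := by field_simp
        _ < r := by linarith
  have htc : 0 < t * c := mul_pos ht hc
  -- The kernel is centred at `-t n` with radius `t c`, so at `x` it samples points `y` with `x = y
  -- - t (n + w)` and `‖w‖ ≤ c`. If `y` were in the complement of `Ω`, the cone condition would put
  -- `x` there as well; hence for `x ∈ Ω` only values in `Ω` are used.
  let b : ContDiffBump (-(t • n)) := ⟨t * c / 2, t * c, by positivity, by linarith⟩
  set k := b.normed volume with hkdef
  have hk : ContDiff ℝ ∞ k := b.contDiff_normed
  have hks : HasCompactSupport k := b.hasCompactSupport_normed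
  have hkne : ∀ z, k z ≠ 0 → dist (-z) 0 < r := fun z hz => by
    have h1 : z ∈ Metric.ball (-(t • n)) (t * c) := by
      rw [← b.support_normed_eq (μ := volume)]; exact hz
    rw [dist_zero_right, norm_neg]
    rw [Metric.mem_ball, dist_eq_norm, sub_neg_eq_add] at h1
    calc ‖z‖ = ‖(z + t • n) - t • n‖ := by rw [add_sub_cancel_right]
      _ ≤ ‖z + t • n‖ + ‖t • n‖ := norm_sub_le _ _
      _ < t * c + t * ‖n‖ := by
          rw [norm_smul, Real.norm_of_nonneg ht.le]; linarith
      _ < r := by linarith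
  have hvs : HasCompactSupport v := hmc.mono fun x hx => by
    rw [Function.mem_support] at hx ⊢
    intro h0
    exact hx (indicator_apply_eq_zero.2 fun _ => by rw [h0, zero_smul])
  refine ⟨k ⋆[ContinuousLinearMap.lsmul ℝ ℝ, volume] v,
    hks.contDiff_convolution_left _ hk (hv.locallyIntegrable (by norm_num)), hks.convolution _ hvs,
    ?_, fun j => ?_⟩
  · calc _ = eLpNorm (fun x => (k ⋆[ContinuousLinearMap.lsmul ℝ ℝ, volume] v) x - v x) 6
          (volume.restrict Ω) := by
          refine eLpNorm_congr_ae ?_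
          filter_upwards [ae_restrict_mem hΩ.measurableSet] with x hx
          rw [hvdef, indicator_of_mem hx]
      _ ≤ _ := eLpNorm_mono_measure _ Measure.restrict_le_self
      _ ≤ δ := eLpNorm_convolution_sub_le (by norm_num) (by norm_num) hv hk.continuous hks
          b.nonneg_normed b.integral_normed fun z hz => (hball (hkne z hz)).1.le
  · calc _ = eLpNorm (fun x => (k ⋆[ContinuousLinearMap.lsmul ℝ ℝ, volume] H j) x - H j x) 2
          (volume.restrict Ω) := by
          refine eLpNorm_congr_ae ?_
          filter_upwards [ae_restrict_mem hΩ.measurableSet] with x hx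
          rw [fderiv_convolution_indicator hΩ.measurableSet h hm hmc hk hks _ j]
          · rw [hHdef]; simp only [indicator_of_mem hx]
          · intro y hy hxy
            by_contra hyΩ
            rw [b.tsupport_normed_eq, Metric.mem_closedBall, dist_eq_norm, sub_neg_eq_add] at hxy
            have h1 := hcone y (hmU hy) hyΩ (t⁻¹ • (y - x) - n) (by
              have : t⁻¹ • (y - x) - n = -(t⁻¹ • (x - y + t • n)) := by
                rw [smul_add, inv_smul_smul₀ ht.ne', ← neg_sub x y, smul_neg]; abel
              rw [this, norm_neg, norm_smul, norm_inv, Real.norm_of_nonneg ht.le,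
                inv_mul_le_iff₀ ht]
              exact hxy) t ht htt₀
            rw [add_sub_cancel, smul_inv_smul₀ ht.ne', sub_sub_cancel] at h1
            exact h1 hx
      _ ≤ _ := eLpNorm_mono_measure _ Measure.restrict_le_self
      _ ≤ δ := eLpNorm_convolution_sub_le (by norm_num) (by norm_num) (hH j) hk.continuous hks
          b.nonneg_normed b.integral_normed fun z hz => ((hball (hkne z hz)).2 j).le

lemma smoothApprox_zero (Ω : Set E3) : SmoothApprox Ω (fun _ => 0) fun _ _ => 0 := by
  intro δ _
  refine ⟨fun _ => 0, contDiff_const, HasCompactSupport.zero, ?_, fun j => ?_⟩ <;> simp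

lemma SmoothApprox.add {Ω : Set E3} {u v : E3 → E3} {G H : Fin 3 → E3 → E3}
    (hum : AEStronglyMeasurable u (volume.restrict Ω))
    (hvm : AEStronglyMeasurable v (volume.restrict Ω))
    (hGm : ∀ j, AEStronglyMeasurable (G j) (volume.restrict Ω))
    (hHm : ∀ j, AEStronglyMeasurable (H j) (volume.restrict Ω))
    (hu : SmoothApprox Ω u G) (hv : SmoothApprox Ω v H) :
    SmoothApprox Ω (fun x => u x + v x) fun j x => G j x + H j x := by
  intro δ hδ
  obtain ⟨φ, hφ, hφc, h1, h2⟩ := hu (δ / 2) (ENNReal.half_pos hδ.ne')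
  obtain ⟨ψ, hψ, hψc, h3, h4⟩ := hv (δ / 2) (ENNReal.half_pos hδ.ne')
  refine ⟨fun x => φ x + ψ x, hφ.add hψ, hφc.add hψc, ?_, fun j => ?_⟩
  · calc _ = eLpNorm ((fun x => φ x - u x) + fun x => ψ x - v x) 6 (volume.restrict Ω) := by
          congr 1; ext1 x; simp only [Pi.add_apply]; abel
      _ ≤ _ := eLpNorm_add_le (hφ.continuous.aestronglyMeasurable.sub hum)
          (hψ.continuous.aestronglyMeasurable.sub hvm) (by norm_num)
      _ ≤ δ / 2 + δ / 2 := add_le_add h1 h3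
      _ = δ := ENNReal.add_halves δ
  · have cφ : Continuous fun x => fderiv ℝ φ x (unitVec j) :=
      (hφ.continuous_fderiv (by simp)).clm_apply continuous_const
    have cψ : Continuous fun x => fderiv ℝ ψ x (unitVec j) :=
      (hψ.continuous_fderiv (by simp)).clm_apply continuous_const
    calc _ = eLpNorm ((fun x => fderiv ℝ φ x (unitVec j) - G j x)
          + fun x => fderiv ℝ ψ x (unitVec j) - H j x) 2 (volume.restrict Ω) := by
          congr 1; ext1 x
          rw [fderiv_fun_add (hφ.differentiable (by simp) x) (hψ.differentiable (by simp) x)]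
          simp only [Pi.add_apply, add_apply]; abel
      _ ≤ _ := eLpNorm_add_le (cφ.aestronglyMeasurable.sub (hGm j))
          (cψ.aestronglyMeasurable.sub (hHm j)) (by norm_num)
      _ ≤ δ / 2 + δ / 2 := add_le_add (h2 j) (h4 j)
      _ = δ := ENNReal.add_halves δ

lemma SmoothApprox.sum {Ω : Set E3} {ι : Type*} (s : Finset ι) {u : ι → E3 → E3}
    {G : ι → Fin 3 → E3 → E3}
    (hum : ∀ i, AEStronglyMeasurable (u i) (volume.restrict Ω))
    (hGm : ∀ i j, AEStronglyMeasurable (G i j) (volume.restrict Ω))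
    (h : ∀ i, SmoothApprox Ω (u i) (G i)) :
    SmoothApprox Ω (fun x => ∑ i ∈ s, u i x) fun j x => ∑ i ∈ s, G i j x := by
  classical
  induction s using Finset.induction_on with
  | empty => simpa using smoothApprox_zero Ω
  | insert a s ha ih =>
    simp_rw [Finset.sum_insert ha]
    exact SmoothApprox.add (hum a) (Finset.aestronglyMeasurable_fun_sum s fun i _ => hum i)
      (hGm a) (fun j => Finset.aestronglyMeasurable_fun_sum s fun i _ => hGm i j) (h a) ih

/-- Approximation of localized functions if the complement has the local cone property. -/
lemma smoothApprox_smul {Ω : Set E3} (hΩ : IsOpen Ω)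
    (hcone : ∀ x, ∃ U, IsOpen U ∧ x ∈ U ∧ ConeOn Ωᶜ U) {u : E3 → E3} {G : Fin 3 → E3 → E3}
    (h : IsD12 Ω u G) {η : E3 → ℝ} (hη : ContDiff ℝ ∞ η) (hηc : HasCompactSupport η) :
    SmoothApprox Ω (fun x => η x • u x) fun j x =>
      η x • G j x + fderiv ℝ η x (unitVec j) • u x := by
  choose U hUo hxU hU using hcone
  obtain ⟨t, ht⟩ := hηc.isCompact.elim_finite_subcover U hUo
    fun x _ => mem_iUnion.2 ⟨x, hxU x⟩
  obtain ⟨f, hf⟩ := SmoothPartitionOfUnity.exists_isSubordinate 𝓘(ℝ, E3) (isClosed_tsupport η)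
    (fun i : t => U i) (fun i => hUo i) (by
      rwa [iUnion_subtype])
  have hfs : ∀ i, ContDiff ℝ ∞ (f i) := fun i => (f i).contMDiff.contDiff
  set m : t → E3 → ℝ := fun i x => f i x * η x with hm
  have hms : ∀ i, ContDiff ℝ ∞ (m i) := fun i => (hfs i).mul hη
  have hmc : ∀ i, HasCompactSupport (m i) := fun i => hηc.mul_left
  have hsum : ∀ x, ∑ i, m i x = η x := fun x => by
    by_cases hx : x ∈ tsupport η
    · rw [← Finset.sum_mul, ← finsum_eq_sum_of_fintype, f.sum_eq_one hx, one_mul]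
    · simp [hm, image_eq_zero_of_notMem_tsupport hx]
  have hdsum : ∀ x e, ∑ i, fderiv ℝ (m i) x e = fderiv ℝ η x e := fun x e => by
    have h1 : η = fun x => ∑ i, m i x := funext fun x => (hsum x).symm
    conv_rhs => rw [h1]
    rw [fderiv_fun_sum fun i _ => (hms i).differentiable (by simp) x]
    simp
  have cdm : ∀ i j, Continuous fun y => fderiv ℝ (m i) y (unitVec j) := fun i j =>
    ((hms i).continuous_fderiv (by simp)).clm_apply continuous_const
  have key := SmoothApprox.sum (Ω := Ω) (Finset.univ : Finset t)
    (u := fun i x => m i x • u x)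
    (G := fun i j x => m i x • G j x + fderiv ℝ (m i) x (unitVec j) • u x)
    (fun i => (hms i).continuous.aestronglyMeasurable.smul h.memLp.1)
    (fun i j => ((hms i).continuous.aestronglyMeasurable.smul (h.memLp_grad j).1).add
      ((cdm i j).aestronglyMeasurable.smul h.memLp.1))
    (fun i => smoothApprox_of_coneOn hΩ (hU i) h (hms i) (hmc i)
      ((tsupport_mul_subset_left).trans (hf i)))
  simp_rw [Finset.sum_add_distrib, ← Finset.sum_smul, hsum, hdsum] at key
  exact key

lemma tendsto_eLpNorm_indicator_norm_ge {μ : Measure E3} {p : ℝ≥0∞} (hp0 : p ≠ 0) (hp : p ≠ ⊤)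
    {f : E3 → E3} (hf : MemLp f p μ) :
    Tendsto (fun n : ℕ => eLpNorm ({x : E3 | (n : ℝ) + 1 ≤ ‖x‖}.indicator f) p μ) atTop (𝓝 0) := by
  have hq : 0 < p.toReal := ENNReal.toReal_pos hp0 hp
  have hm : ∀ n : ℕ, MeasurableSet {x : E3 | (n : ℝ) + 1 ≤ ‖x‖} := fun n =>
    (isClosed_le continuous_const continuous_norm).measurableSet
  have hfin : ∫⁻ x, ‖f x‖ₑ ^ p.toReal ∂μ ≠ ⊤ :=
    (lintegral_rpow_enorm_lt_top_of_eLpNorm_lt_top hp0 hp hf.2).ne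
  have hlim : Tendsto (fun n : ℕ => ∫⁻ x, ‖{x : E3 | (n : ℝ) + 1 ≤ ‖x‖}.indicator f x‖ₑ ^ p.toReal ∂μ)
      atTop (𝓝 (∫⁻ _, 0 ∂μ)) := by
    refine tendsto_lintegral_of_dominated_convergence' (fun x => ‖f x‖ₑ ^ p.toReal)
      (fun n => ((hf.1.indicator (hm n)).enorm.pow_const _)) (fun n => Eventually.of_forall fun x => ?_)
      hfin (Eventually.of_forall fun x => ?_)
    · exact ENNReal.rpow_le_rpow (enorm_indicator_le_enorm_self _ _) hq.le
    · obtain ⟨N, hN⟩ := exists_nat_gt ‖x‖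
      refine tendsto_const_nhds.congr' ?_
      filter_upwards [eventually_ge_atTop N] with n hn
      have : x ∉ {x : E3 | (n : ℝ) + 1 ≤ ‖x‖} := by
        rw [Set.mem_ofPred_eq, not_le]
        have : (N : ℝ) ≤ n := by exact_mod_cast hn
        linarith
      rw [indicator_of_notMem this, enorm_zero, ENNReal.zero_rpow_of_pos hq]
  simp_rw [eLpNorm_eq_lintegral_rpow_enorm_toReal hp0 hp]
  rw [lintegral_zero] at hlim
  have := hlim.ennrpow_const (1 / p.toReal)
  rwa [ENNReal.zero_rpow_of_pos (by positivity)] at this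

/-- Cutoff functions at infinity, with gradients bounded in `L³`. -/
lemma exists_cutoff_infinity : ∃ C : ℝ≥0∞, C ≠ ⊤ ∧ ∀ n : ℕ, ∃ η : E3 → ℝ, ContDiff ℝ ∞ η ∧
    HasCompactSupport η ∧ (∀ x, ‖η x - 1‖ ≤ 1) ∧ (∀ x, ‖x‖ < n + 1 → η x = 1) ∧
    (∀ x, ‖x‖ < n + 1 → fderiv ℝ η x = 0) ∧
    ∀ j, eLpNorm (fun x => fderiv ℝ η x (unitVec j)) 3 volume ≤ C := by
  let b : ContDiffBump (0 : E3) := ⟨1, 2, one_pos, one_lt_two⟩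
  have hb : ContDiff ℝ ∞ b := b.contDiff
  obtain ⟨M, hM⟩ := (hb.continuous_fderiv (by simp)).bounded_above_of_compact_support
    (b.hasCompactSupport.fderiv ℝ)
  have hM0 : 0 ≤ M := (norm_nonneg _).trans (hM 0)
  set B : ℝ≥0∞ := volume (Metric.ball (0 : E3) 1) with hB
  -- At scale `r` the gradient is at most `M / r` on a ball of volume `(2r)³ B`. Its `L³` norm is
  -- therefore at most `2 M B^{1/3}` for every `r`: `L³` is the scale-invariant exponent in
  -- dimension three.
  refine ⟨ENNReal.ofReal (2 * M) * B ^ (1 / 3 : ℝ), ENNReal.mul_ne_top ENNReal.ofReal_ne_top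
    (ENNReal.rpow_ne_top_of_nonneg (by norm_num) measure_ball_lt_top.ne), fun n => ?_⟩
  set r : ℝ := n + 1 with hr
  have hr0 : 0 < r := by positivity
  have hscale : ∀ x : E3, ‖r⁻¹ • x‖ = ‖x‖ / r := fun x => by
    rw [norm_smul, norm_inv, Real.norm_of_nonneg hr0.le]; field_simp
  set η : E3 → ℝ := fun x => b (r⁻¹ • x) with hη
  have hη1 : ∀ x : E3, ‖x‖ < r → η x = 1 := fun x hx => b.one_of_mem_closedBall (by
    rw [mem_closedBall_zero_iff, hscale]
    exact (div_le_one hr0).2 hx.le)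
  have hη0 : ∀ x : E3, 2 * r < ‖x‖ → η x = 0 := fun x hx => b.zero_of_le_dist (by
    rw [dist_zero_right, hscale, le_div_iff₀ hr0]
    exact hx.le)
  have hd : ∀ x e, ‖fderiv ℝ η x e‖ ≤ M / r * ‖e‖ := fun x e => by
    have h1 : HasFDerivAt η ((fderiv ℝ b (r⁻¹ • x)).comp (r⁻¹ • ContinuousLinearMap.id ℝ E3)) x :=
      (hb.differentiable (by simp) _).hasFDerivAt.comp x ((hasFDerivAt_id x).const_smul r⁻¹)
    rw [h1.fderiv, ContinuousLinearMap.comp_apply]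
    refine (ContinuousLinearMap.le_opNorm _ _).trans ?_
    rw [smul_apply, ContinuousLinearMap.id_apply, hscale, div_mul_eq_mul_div,
      mul_div_assoc]
    exact mul_le_mul_of_nonneg_right (hM _) (by positivity)
  have hd0 : ∀ x : E3, 2 * r < ‖x‖ → fderiv ℝ η x = 0 := fun x hx => by
    have : η =ᶠ[𝓝 x] fun _ => 0 := by
      filter_upwards [(isOpen_lt continuous_const continuous_norm).mem_nhds hx] with y hy
      exact hη0 y hy
    rw [this.fderiv_eq]; simp
  refine ⟨η, hb.comp (contDiff_const_smul _), ?_, fun x => ?_, hη1, fun x hx => ?_, fun j => ?_⟩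
  · refine HasCompactSupport.of_support_subset_isCompact (isCompact_closedBall (0 : E3) (2 * r))
      fun x hx => ?_
    rw [mem_closedBall_zero_iff]
    by_contra h
    exact hx (hη0 x (not_le.1 h))
  · have h0 : 0 ≤ η x := b.nonneg
    have h1 : η x ≤ 1 := b.le_one
    rw [Real.norm_eq_abs, abs_le]
    constructor <;> linarith
  · have : η =ᶠ[𝓝 x] fun _ => 1 := by
      filter_upwards [(isOpen_lt continuous_norm continuous_const).mem_nhds hx] with y hy
      exact hη1 y hy
    rw [this.fderiv_eq]; simp
  · calc eLpNorm (fun x => fderiv ℝ η x (unitVec j)) 3 volume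
        ≤ eLpNorm ((Metric.closedBall (0 : E3) (2 * r)).indicator fun _ => M / r) 3 volume := by
          refine eLpNorm_mono fun x => ?_
          by_cases hx : x ∈ Metric.closedBall (0 : E3) (2 * r)
          · rw [indicator_of_mem hx, Real.norm_of_nonneg (by positivity : 0 ≤ M / r)]
            refine (hd x _).trans ?_
            simp
          · rw [hd0 x (by simpa using hx)]; simp
      _ = ENNReal.ofReal (M / r) * (ENNReal.ofReal ((2 * r) ^ 3) * B) ^ (1 / 3 : ℝ) := by
          rw [eLpNorm_indicator_const Metric.isClosed_closedBall.measurableSet (by norm_num)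
            (by norm_num), Real.enorm_of_nonneg (by positivity),
            Measure.addHaar_closedBall _ _ (by positivity)]
          simp [hB]
      _ = _ := by
          rw [ENNReal.mul_rpow_of_nonneg _ _ (by norm_num), ENNReal.ofReal_rpow_of_nonneg
            (by positivity) (by norm_num), ← mul_assoc, ← ENNReal.ofReal_mul (by positivity)]
          have : ((2 * r) ^ 3) ^ (1 / 3 : ℝ) = 2 * r := by
            rw [← Real.rpow_natCast, ← Real.rpow_mul (by positivity)]; norm_num
          rw [this]
          congr 2
          field_simp

/-- Density of smooth compactly supported functions in `D^{1,2}(Ω)`. -/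
lemma IsD12.smoothApprox {Ω : Set E3} (hΩ : IsOpen Ω)
    (hcone : ∀ x, ∃ U, IsOpen U ∧ x ∈ U ∧ ConeOn Ωᶜ U) {u : E3 → E3} {G : Fin 3 → E3 → E3}
    (h : IsD12 Ω u G) : SmoothApprox Ω u G := by
  intro δ hδ
  obtain ⟨C, hC, hη⟩ := exists_cutoff_infinity
  set μ := volume.restrict Ω with hμ
  set S : ℕ → Set E3 := fun n => {x | (n : ℝ) + 1 ≤ ‖x‖} with hS
  have hSm : ∀ n, MeasurableSet (S n) := fun n =>
    (isClosed_le continuous_const continuous_norm).measurableSet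
  have hu0 := tendsto_eLpNorm_indicator_norm_ge (by norm_num) (by norm_num) h.memLp
  have hG0 := fun j => tendsto_eLpNorm_indicator_norm_ge (by norm_num) (by norm_num) (h.memLp_grad j)
  have hCu : Tendsto (fun n => eLpNorm ((S n).indicator u) 6 μ + C * eLpNorm ((S n).indicator u) 6 μ)
      atTop (𝓝 0) := by
    simpa using hu0.add (ENNReal.Tendsto.const_mul hu0 (Or.inr hC))
  have hsum : ∀ j, Tendsto (fun n => eLpNorm ((S n).indicator (G j)) 2 μ
      + C * eLpNorm ((S n).indicator u) 6 μ) atTop (𝓝 0) := fun j => by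
    simpa using (hG0 j).add (ENNReal.Tendsto.const_mul hu0 (Or.inr hC))
  have hδ2 := ENNReal.half_pos hδ.ne'
  obtain ⟨n, hn1, hn2⟩ := ((hCu.eventually_lt_const hδ2).and
    (eventually_all.2 fun j => (hsum j).eventually_lt_const hδ2)).exists
  obtain ⟨η, hηs, hηc, hη1, hη2, hη3, hη4⟩ := hη n
  have cd : ∀ j, Continuous fun y => fderiv ℝ η y (unitVec j) := fun j =>
    (hηs.continuous_fderiv (by simp)).clm_apply continuous_const
  obtain ⟨φ, hφ, hφc, h1, h2⟩ := smoothApprox_smul hΩ hcone h hηs hηc _ hδ2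
  have hcut : ∀ f : E3 → E3, ∀ x, ‖η x • f x - f x‖ ≤ ‖(S n).indicator f x‖ := fun f x => by
    by_cases hx : x ∈ S n
    · rw [indicator_of_mem hx, show η x • f x - f x = (η x - 1) • f x by rw [sub_smul, one_smul],
        norm_smul]
      exact mul_le_of_le_one_left (norm_nonneg _) (hη1 x)
    · rw [hη2 x (not_le.1 hx)]; simp
  have cφ : ∀ j, Continuous fun x => fderiv ℝ φ x (unitVec j) := fun j =>
    (hφ.continuous_fderiv (by simp)).clm_apply continuous_const
  refine ⟨φ, hφ, hφc, ?_, fun j => ?_⟩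
  · calc eLpNorm (fun x => φ x - u x) 6 μ
        = eLpNorm ((fun x => φ x - η x • u x) + fun x => η x • u x - u x) 6 μ := by
          congr 1; ext1 x; simp only [Pi.add_apply]; abel
      _ ≤ _ := eLpNorm_add_le (hφ.continuous.aestronglyMeasurable.sub
          (hηs.continuous.aestronglyMeasurable.smul h.memLp.1))
          ((hηs.continuous.aestronglyMeasurable.smul h.memLp.1).sub h.memLp.1) (by norm_num)
      _ ≤ δ / 2 + δ / 2 := add_le_add h1 ((eLpNorm_mono (hcut u)).trans (le_self_add.trans hn1.le))
      _ = δ := ENNReal.add_halves δ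
  · have mG : AEStronglyMeasurable (fun x => η x • G j x) μ :=
      hηs.continuous.aestronglyMeasurable.smul (h.memLp_grad j).1
    have mu : AEStronglyMeasurable (fun x => fderiv ℝ η x (unitVec j) • u x) μ :=
      (cd j).aestronglyMeasurable.smul h.memLp.1
    -- The derivative of the cutoff is only bounded in `L³`, not small; smallness comes from the
    -- `L⁶` tail of `u` on its support.
    have e3 : eLpNorm (fun x => fderiv ℝ η x (unitVec j) • u x) 2 μ ≤
        C * eLpNorm ((S n).indicator u) 6 μ := by
      calc _ = eLpNorm ((fun x => fderiv ℝ η x (unitVec j)) • (S n).indicator u) 2 μ := by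
            congr 1; ext1 x
            simp only [Pi.smul_apply']
            by_cases hx : x ∈ S n
            · rw [indicator_of_mem hx]
            · rw [hη3 x (not_le.1 hx)]; simp
        _ ≤ eLpNorm (fun x => fderiv ℝ η x (unitVec j)) 3 μ * eLpNorm ((S n).indicator u) 6 μ :=
            eLpNorm_smul_le_mul_eLpNorm (h.memLp.1.indicator (hSm n)) (cd j).aestronglyMeasurable
        _ ≤ _ := by
            refine mul_le_mul' ?_ le_rfl
            exact (eLpNorm_mono_measure _ Measure.restrict_le_self).trans (hη4 j)
    calc eLpNorm (fun x => fderiv ℝ φ x (unitVec j) - G j x) 2 μ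
        = eLpNorm ((fun x => fderiv ℝ φ x (unitVec j)
            - (η x • G j x + fderiv ℝ η x (unitVec j) • u x))
          + ((fun x => η x • G j x - G j x) + fun x => fderiv ℝ η x (unitVec j) • u x)) 2 μ := by
          congr 1; ext1 x; simp only [Pi.add_apply]; abel
      _ ≤ _ := eLpNorm_add_le ((cφ j).aestronglyMeasurable.sub (mG.add mu))
          ((mG.sub (h.memLp_grad j).1).add mu) (by norm_num)
      _ ≤ δ / 2 + δ / 2 := by
          refine add_le_add (h2 j) (le_trans ?_ (hn2 j).le)
          refine (eLpNorm_add_le (mG.sub (h.memLp_grad j).1) mu (by norm_num)).trans ?_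
          exact add_le_add (eLpNorm_mono (hcut (G j))) e3
      _ = δ := ENNReal.add_halves δ

/-! ### Existence of traces and passage to the limit. -/

lemma gradNorm_le {Ω : Set E3} {G : Fin 3 → E3 → E3} {b : Fin 3 → ℝ≥0∞}
    (h : ∀ j, eLpNorm (G j) 2 (volume.restrict Ω) ≤ b j) :
    gradNorm Ω G ≤ (∑ j, b j ^ 2) ^ (1 / 2 : ℝ) :=
  ENNReal.rpow_le_rpow (Finset.sum_le_sum fun j _ => pow_le_pow_left' (h j) 2) (by norm_num)

lemma gradNorm_le_of_forall_le {Ω : Set E3} {G : Fin 3 → E3 → E3} {b : ℝ≥0∞}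
    (h : ∀ j, eLpNorm (G j) 2 (volume.restrict Ω) ≤ b) : gradNorm Ω G ≤ 2 * b := by
  refine (gradNorm_le h).trans ?_
  calc _ ≤ ((2 * b) ^ 2) ^ (1 / 2 : ℝ) := by
        refine ENNReal.rpow_le_rpow ?_ (by norm_num)
        rw [Finset.sum_const, Finset.card_univ, Fintype.card_fin, nsmul_eq_mul, mul_pow]
        exact mul_le_mul' (by norm_num) le_rfl
    _ = _ := by rw [← ENNReal.rpow_two, ← ENNReal.rpow_mul]; norm_num

/-- Existence of traces, and their bound, from a bound for smooth functions. -/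
lemma SmoothApprox.exists_isTrace {Ω : Set E3} {μ : Measure E3} [IsFiniteMeasure μ] {c : ℝ≥0∞}
    (hc : c ≠ ⊤)
    (hb : ∀ ψ : E3 → E3, ContDiff ℝ ∞ ψ → HasCompactSupport ψ →
      eLpNorm ψ 2 μ ≤ c * gradNorm Ω fun j x => fderiv ℝ ψ x (unitVec j))
    {u : E3 → E3} {G : Fin 3 → E3 → E3} (hG : ∀ j, MemLp (G j) 2 (volume.restrict Ω))
    (h : SmoothApprox Ω u G) : ∃ g, IsTrace Ω μ u G g := by
  -- With `δ n = 2⁻ⁿ / a` the boundary values satisfy a summable Cauchy bound: one `2` comes from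
  -- the triangle inequality, one from `gradNorm_le_of_forall_le`. The `+ 1` makes `a` nonzero when
  -- `c = 0`.
  set a : ℝ≥0∞ := 4 * c + 1 with ha
  have ha0 : a ≠ 0 := by rw [ha]; simp
  have hat : a ≠ ⊤ := by rw [ha]; finiteness
  set δ : ℕ → ℝ≥0∞ := fun n => 2⁻¹ ^ n / a with hδ
  have hδ0 : ∀ n, 0 < δ n := fun n =>
    ENNReal.div_pos (pow_ne_zero _ (by simp)) hat
  have hanti : ∀ m n, m ≤ n → δ n ≤ δ m := fun m n hmn =>
    ENNReal.div_le_div_right (pow_le_pow_right_of_le_one' (by norm_num) hmn) _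
  have hδt : Tendsto δ atTop (𝓝 0) := by
    have h1 : Tendsto (fun n : ℕ => (2⁻¹ : ℝ≥0∞) ^ n) atTop (𝓝 0) :=
      ENNReal.tendsto_pow_atTop_nhds_zero_of_lt_one (by norm_num)
    have h2 := ENNReal.Tendsto.div_const h1 (Or.inr ha0)
    rwa [ENNReal.zero_div] at h2
  choose φ hφ hφc h6 h2 using fun n => h (δ n) (hδ0 n)
  have hmem : ∀ n, MemLp (φ n) 2 μ := fun n => (hφ n).continuous.memLp_of_hasCompactSupport (hφc n)
  have cφ : ∀ n j, Continuous fun x => fderiv ℝ (φ n) x (unitVec j) := fun n j =>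
    ((hφ n).continuous_fderiv (by simp)).clm_apply continuous_const
  have hcau : ∀ N n m : ℕ, N ≤ n → N ≤ m → eLpNorm (φ n - φ m) 2 μ < 2 * 2⁻¹ ^ N := by
    intro N n m hn hm
    have hj : ∀ j, eLpNorm (fun x => fderiv ℝ (φ n - φ m) x (unitVec j)) 2 (volume.restrict Ω) ≤
        2 * δ N := fun j => by
      calc _ = eLpNorm ((fun x => fderiv ℝ (φ n) x (unitVec j) - G j x)
            - fun x => fderiv ℝ (φ m) x (unitVec j) - G j x) 2 (volume.restrict Ω) := by
            congr 1; ext1 x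
            rw [fderiv_sub ((hφ n).differentiable (by simp) x) ((hφ m).differentiable (by simp) x)]
            simp only [Pi.sub_apply, sub_apply]
            abel
        _ ≤ _ := eLpNorm_sub_le ((cφ n j).aestronglyMeasurable.sub (hG j).1)
            ((cφ m j).aestronglyMeasurable.sub (hG j).1) (by norm_num)
        _ ≤ δ N + δ N := add_le_add ((h2 n j).trans (hanti _ _ hn)) ((h2 m j).trans (hanti _ _ hm))
        _ = _ := (two_mul _).symm
    calc _ ≤ _ := hb _ ((hφ n).sub (hφ m)) ((hφc n).sub (hφc m))
      _ ≤ c * (2 * (2 * δ N)) := mul_le_mul' le_rfl (gradNorm_le_of_forall_le hj)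
      _ = 4 * c * δ N := by ring
      _ ≤ a * δ N := mul_le_mul' le_self_add le_rfl
      _ = 2⁻¹ ^ N := ENNReal.mul_div_cancel ha0 hat
      _ < 2 * 2⁻¹ ^ N := by
          have h0 : (2⁻¹ : ℝ≥0∞) ^ N ≠ 0 := pow_ne_zero _ (by simp)
          have ht : (2⁻¹ : ℝ≥0∞) ^ N ≠ ⊤ := by finiteness
          rw [two_mul]
          exact ENNReal.lt_add_right ht h0
  obtain ⟨g, hg, hlim⟩ := Lp.cauchy_complete_eLpNorm (by norm_num) hmem
    (B := fun N => 2 * 2⁻¹ ^ N) (by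
      rw [ENNReal.tsum_mul_left, ENNReal.tsum_geometric, ENNReal.one_sub_inv_two, inv_inv]
      finiteness) hcau
  refine ⟨g, hg, φ, hφ, hφc, ?_, fun j => ?_, hlim⟩
  · exact tendsto_of_tendsto_of_tendsto_of_le_of_le tendsto_const_nhds hδt (fun _ => zero_le) h6
  · exact tendsto_of_tendsto_of_tendsto_of_le_of_le tendsto_const_nhds hδt (fun _ => zero_le)
      fun n => h2 n j

/-- The bound passes to the limit along the approximating sequence that any given trace carries with
it, so uniqueness of traces plays no role. -/
lemma IsTrace.eLpNorm_le {Ω : Set E3} {μ : Measure E3} {c : ℝ≥0∞} (hc : c ≠ ⊤)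
    (hb : ∀ ψ : E3 → E3, ContDiff ℝ ∞ ψ → HasCompactSupport ψ →
      eLpNorm ψ 2 μ ≤ c * gradNorm Ω fun j x => fderiv ℝ ψ x (unitVec j))
    {u : E3 → E3} {G : Fin 3 → E3 → E3} (hG : ∀ j, MemLp (G j) 2 (volume.restrict Ω))
    {g : E3 → E3} (h : IsTrace Ω μ u G g) : eLpNorm g 2 μ ≤ c * gradNorm Ω G := by
  obtain ⟨hg, φ, hφ, hφc, -, h2, hlim⟩ := h
  have cφ : ∀ n j, Continuous fun x => fderiv ℝ (φ n) x (unitVec j) := fun n j =>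
    ((hφ n).continuous_fderiv (by simp)).clm_apply continuous_const
  set a : Fin 3 → ℝ≥0∞ := fun j => eLpNorm (G j) 2 (volume.restrict Ω) with ha
  set d : ℕ → Fin 3 → ℝ≥0∞ := fun n j => eLpNorm
    (fun x => fderiv ℝ (φ n) x (unitVec j) - G j x) 2 (volume.restrict Ω) with hd
  have hle : ∀ n, eLpNorm g 2 μ ≤ eLpNorm (fun x => φ n x - g x) 2 μ
      + c * (∑ j, (d n j + a j) ^ 2) ^ (1 / 2 : ℝ) := fun n => by
    calc eLpNorm g 2 μ = eLpNorm (φ n - fun x => φ n x - g x) 2 μ := by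
          congr 1; ext1 x; simp only [Pi.sub_apply]; abel
      _ ≤ eLpNorm (φ n) 2 μ + eLpNorm (fun x => φ n x - g x) 2 μ :=
          eLpNorm_sub_le (hφ n).continuous.aestronglyMeasurable
            ((hφ n).continuous.aestronglyMeasurable.sub hg.1) (by norm_num)
      _ ≤ c * (∑ j, (d n j + a j) ^ 2) ^ (1 / 2 : ℝ) + eLpNorm (fun x => φ n x - g x) 2 μ := by
          refine add_le_add ((hb _ (hφ n) (hφc n)).trans (mul_le_mul' le_rfl (gradNorm_le fun j => ?_)))
            le_rfl
          calc _ = eLpNorm ((fun x => fderiv ℝ (φ n) x (unitVec j) - G j x) + G j) 2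
                (volume.restrict Ω) := by
                congr 1; ext1 x; simp only [Pi.add_apply]; abel
            _ ≤ _ := eLpNorm_add_le ((cφ n j).aestronglyMeasurable.sub (hG j).1) (hG j).1
                (by norm_num)
      _ = _ := add_comm _ _
  have hsum : Tendsto (fun n => ∑ j, (d n j + a j) ^ 2) atTop (𝓝 (∑ j, (0 + a j) ^ 2)) :=
    tendsto_finsetSum _ fun j _ => ENNReal.Tendsto.pow ((h2 j).add tendsto_const_nhds)
  have hT := hlim.add (ENNReal.Tendsto.const_mul (hsum.ennrpow_const (1 / 2 : ℝ)) (Or.inr hc))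
  simp only [zero_add] at hT
  exact ge_of_tendsto' hT hle

/-- The operator norm is dominated by the Hilbert–Schmidt norm. The estimates above use the former
for the derivative, `gradNorm` the latter. -/
lemma norm_sq_le_sum_unitVec (A : E3 →L[ℝ] E3) : ‖A‖ ^ 2 ≤ ∑ j, ‖A (unitVec j)‖ ^ 2 := by
  have h : ‖A‖ ≤ √(∑ j, ‖A (unitVec j)‖ ^ 2) := by
    refine A.opNorm_le_bound (Real.sqrt_nonneg _) fun v => ?_
    calc ‖A v‖ = ‖∑ j, v j • A (unitVec j)‖ := by
          conv_lhs => rw [E3_eq_sum v, map_sum]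
          simp_rw [map_smul]
      _ ≤ ∑ j, ‖A (unitVec j)‖ * ‖v j‖ := (norm_sum_le _ _).trans_eq
          (Finset.sum_congr rfl fun j _ => by rw [norm_smul, mul_comm])
      _ ≤ √(∑ j, ‖A (unitVec j)‖ ^ 2) * √(∑ j, ‖v j‖ ^ 2) :=
          Real.sum_mul_le_sqrt_mul_sqrt _ _ _
      _ = _ := by rw [EuclideanSpace.norm_eq]
  calc _ ≤ √(∑ j, ‖A (unitVec j)‖ ^ 2) ^ 2 := pow_le_pow_left₀ (norm_nonneg _) h 2
    _ = _ := Real.sq_sqrt (Finset.sum_nonneg fun j _ => sq_nonneg _)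

lemma lintegral_sq_fderiv_le_gradNorm {Ω : Set E3} {ψ : E3 → E3} (hψ : ContDiff ℝ 1 ψ) :
    (∫⁻ x in Ω, ENNReal.ofReal (‖fderiv ℝ ψ x‖ ^ 2)) ^ (1 / 2 : ℝ) ≤
      gradNorm Ω fun j x => fderiv ℝ ψ x (unitVec j) := by
  refine ENNReal.rpow_le_rpow ?_ (by norm_num)
  have hm : ∀ j, Measurable fun x => ‖fderiv ℝ ψ x (unitVec j)‖ₑ ^ 2 := fun j =>
    ((hψ.continuous_fderiv one_ne_zero).clm_apply continuous_const).measurable.enorm.pow_const 2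
  have e : ∀ j, eLpNorm (fun x => fderiv ℝ ψ x (unitVec j)) 2 (volume.restrict Ω) ^ 2 =
      ∫⁻ x in Ω, ‖fderiv ℝ ψ x (unitVec j)‖ₑ ^ 2 := fun j => by
    have := eLpNorm_nnreal_pow_eq_lintegral (μ := volume.restrict Ω) (p := 2) two_ne_zero
      (f := fun x => fderiv ℝ ψ x (unitVec j))
    simpa using this
  simp_rw [e]
  rw [← lintegral_finsetSum _ fun j _ => hm j]
  refine lintegral_mono fun x => ?_
  calc _ ≤ ENNReal.ofReal (∑ j, ‖fderiv ℝ ψ x (unitVec j)‖ ^ 2) :=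
        ENNReal.ofReal_le_ofReal (norm_sq_le_sum_unitVec _)
    _ = _ := by
        rw [ENNReal.ofReal_sum_of_nonneg fun j _ => sq_nonneg _]
        refine Finset.sum_congr rfl fun j _ => ?_
        rw [ENNReal.ofReal_pow (norm_nonneg _), ofReal_norm]

/-! ### Uniformity of the constant, and the conclusion. -/

namespace FramedLoop

variable {L : FramedLoop}

lemma isFiniteMeasure_surf {R : ℝ} (hκ : 2 * L.kappaMax * R ≤ 1) {ε : ℝ} (h0 : 0 ≤ ε) (hε : ε < R) :
    IsFiniteMeasure (L.surf ε) := by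
  refine ⟨?_⟩
  rw [← setLIntegral_one, Measure.restrict_univ]
  refine (lintegral_surf_le hκ h0 hε measurable_const).trans_lt ?_
  simp only [lintegral_const, Measure.restrict_apply_univ, Real.volume_Ioo, period_univ]
  finiteness

/-- A radius, depending only on the curvature and the chord-arc constant, of an embedded tube. -/
lemma ChordArc.tubeInj_max {c : ℝ} (hc : 0 < c) (h : L.ChordArc c) {r : ℝ} (hr : L.IsTubeRadius r) :
    L.TubeInj (max r (1 / (2 * L.kappaMax * (1 + 2 / c)))) ∧
      2 * L.kappaMax * max r (1 / (2 * L.kappaMax * (1 + 2 / c))) ≤ 1 := by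
  have hκ : 0 < L.kappaMax := zero_lt_two.trans_le L.two_le_kappaMax
  have hc2 : 0 < 2 / c := by positivity
  rcases max_choice r (1 / (2 * L.kappaMax * (1 + 2 / c))) with e | e <;> rw [e]
  · exact ⟨hr.tubeInj, hr.le_curv⟩
  · constructor
    · refine h.tubeInj hc ?_
      rw [show L.kappaMax * (1 / (2 * L.kappaMax * (1 + 2 / c))) * (1 + 2 / c) = 1 / 2 by field_simp]
      norm_num
    · rw [mul_one_div, div_le_one (by positivity)]
      nlinarith

lemma exists_eLpNorm_surf_le (c κ : ℝ) (hc : 0 < c) : ∃ C : ℝ, 0 < C ∧ ∀ L : FramedLoop,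
    L.ChordArc c → L.kappaMax = κ → ∀ r : ℝ, L.IsTubeRadius r → ∀ ε : ℝ, 0 < ε → ε < r / 4 →
    ∀ ψ : E3 → E3, ContDiff ℝ 1 ψ → HasCompactSupport ψ →
      eLpNorm ψ 2 (L.surf ε) ≤ ENNReal.ofReal (C * √ε * |Real.log ε| ^ (1 / 2 : ℝ)) *
        gradNorm (L.outer ε) fun j x => fderiv ℝ ψ x (unitVec j) := by
  obtain ⟨C₀, hC₀, h⟩ := exists_lintegral_surf_le
  set r₀ := 1 / (2 * κ * (1 + 2 / c)) with hr₀
  -- No curve is given yet, so `κ` is an arbitrary real; if `κ = 0` then `r₀ = 0` and `1 / r₀ ^ 2`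
  -- is `0` by convention, and the sum is still positive.
  have hq0 : 0 < 1 / r₀ ^ 2 + 1 := by positivity
  refine ⟨√(C₀ * (1 / r₀ ^ 2 + 1)), by positivity, ?_⟩
  intro L hch hκ r hr ε hε hεr ψ hψ hψc
  obtain ⟨hR, hRκ⟩ := hch.tubeInj_max hc hr
  rw [hκ, ← hr₀] at hR hRκ
  rw [← hκ] at hRκ
  -- The bound `R ≥ r` guarantees `4ε < R`, and `R ≥ r₀` bounds `1 / R²` in terms of `c` and `κ`
  -- only.
  set R := max r r₀ with hRdef
  have hrR : r ≤ R := le_max_left _ _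
  have hR0 : 0 < R := hr.pos.trans_le hrR
  have hR4 := R_le_quarter hRκ hR0.le
  have hr₀0 : 0 < r₀ := by
    have : 0 < κ := hκ ▸ zero_lt_two.trans_le L.two_le_kappaMax
    positivity
  have key := h L R hR hRκ ε hε (by linarith) ψ hψ hψc
  -- `ε < R/4 ≤ 1/16 < 1/e`, so the term `1 / R²` without a logarithm can be absorbed into `|log
  -- ε|`.
  have hlog : 1 ≤ |Real.log ε| := by
    have h1 : Real.log ε ≤ -1 := by
      rw [Real.log_le_iff_le_exp hε, Real.exp_neg]
      have := Real.exp_one_lt_d9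
      have h2 : (1 : ℝ) / 16 ≤ (Real.exp 1)⁻¹ := by
        rw [one_div]; exact inv_anti₀ (Real.exp_pos 1) (by linarith)
      linarith
    rw [abs_of_nonpos (by linarith)]; linarith
  have hlogR : Real.log (R / ε) ≤ |Real.log ε| := by
    rw [Real.log_div hR0.ne' hε.ne']
    have : Real.log R ≤ 0 := Real.log_nonpos hR0.le (by linarith)
    linarith [neg_le_abs (Real.log ε)]
  have hRr : 1 / R ^ 2 ≤ 1 / r₀ ^ 2 :=
    one_div_le_one_div_of_le (by positivity) (pow_le_pow_left₀ hr₀0.le (le_max_right _ _) 2)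
  have hK : C₀ * ε * (1 / R ^ 2 + Real.log (R / ε)) ≤
      C₀ * (1 / r₀ ^ 2 + 1) * ε * |Real.log ε| := by
    have h1 : 1 / R ^ 2 + Real.log (R / ε) ≤ (1 / r₀ ^ 2 + 1) * |Real.log ε| := by
      have : 1 / r₀ ^ 2 ≤ 1 / r₀ ^ 2 * |Real.log ε| := le_mul_of_one_le_right (by positivity) hlog
      linarith
    calc _ ≤ C₀ * ε * ((1 / r₀ ^ 2 + 1) * |Real.log ε|) := by gcongr
      _ = _ := by ring
  rw [eLpNorm_eq_lintegral_rpow_enorm_toReal two_ne_zero (by norm_num)]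
  simp only [ENNReal.toReal_ofNat, ENNReal.rpow_two]
  calc _ ≤ (ENNReal.ofReal (C₀ * (1 / r₀ ^ 2 + 1) * ε * |Real.log ε|) *
        ∫⁻ x in L.outer ε, ENNReal.ofReal (‖fderiv ℝ ψ x‖ ^ 2)) ^ (1 / 2 : ℝ) :=
        ENNReal.rpow_le_rpow (key.trans (mul_le_mul' (ENNReal.ofReal_le_ofReal hK) le_rfl))
          (by norm_num)
    _ ≤ _ := by
        rw [ENNReal.mul_rpow_of_nonneg _ _ (by norm_num)]
        refine mul_le_mul' (le_of_eq ?_) (lintegral_sq_fderiv_le_gradNorm hψ)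
        rw [ENNReal.ofReal_rpow_of_nonneg (by positivity) (by norm_num),
          Real.mul_rpow (by positivity) (abs_nonneg _), Real.mul_rpow (by positivity) hε.le,
          ← Real.sqrt_eq_rpow, ← Real.sqrt_eq_rpow]

end FramedLoop

end

theorem mainTheorem7 (cΓ κmax : ℝ) (hc : 0 < cΓ) :
    ∃ C : ℝ, 0 < C ∧
      ∀ L : FramedLoop, L.ChordArc cΓ → L.kappaMax = κmax →
      ∀ rmax : ℝ, L.IsTubeRadius rmax →
      ∀ ε : ℝ, 0 < ε → ε < rmax / 4 →
      ∀ (u : E3 → E3) (G : Fin 3 → E3 → E3), IsD12 (L.ext ε) u G →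
        (∃ g : E3 → E3, IsTrace (L.ext ε) (L.surf ε) u G g) ∧
        ∀ g : E3 → E3, IsTrace (L.ext ε) (L.surf ε) u G g →
          eLpNorm g 2 (L.surf ε) ≤
            ENNReal.ofReal (C * √ε * |Real.log ε| ^ (1 / 2 : ℝ)) * gradNorm (L.ext ε) G := by
  obtain ⟨C, hC, h⟩ := FramedLoop.exists_eLpNorm_surf_le cΓ κmax hc
  refine ⟨C, hC, fun L hch hκ rmax hr ε hε hεr u G hu => ?_⟩
  have hout : L.ext ε = L.outer ε := L.ext_eq hε
  have hopen : IsOpen (L.outer ε) := isOpen_lt continuous_const (Metric.continuous_infDist_pt _)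
  rw [hout] at hu ⊢
  have hεr' : ε < rmax := by linarith [hr.pos]
  have := FramedLoop.isFiniteMeasure_surf hr.le_curv hε.le hεr'
  have hb : ∀ ψ : E3 → E3, ContDiff ℝ ∞ ψ → HasCompactSupport ψ → eLpNorm ψ 2 (L.surf ε) ≤
      ENNReal.ofReal (C * √ε * |Real.log ε| ^ (1 / 2 : ℝ)) *
        gradNorm (L.outer ε) fun j x => fderiv ℝ ψ x (unitVec j) := fun ψ hψ hψc =>
    h L hch hκ rmax hr ε hε hεr ψ (hψ.of_le (by exact_mod_cast le_top)) hψc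
  refine ⟨?_, fun g hg => hg.eLpNorm_le ENNReal.ofReal_ne_top hb hu.memLp_grad⟩
  exact (hu.smoothApprox hopen (hr.tubeInj.exists_coneOn hε hεr')).exists_isTrace
    ENNReal.ofReal_ne_top hb hu.memLp_grad
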